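/- **Setting.** Let $\Theta=(\theta_i)_{i\ge 0}$ be a sequence in $[0,\infty)$ with $\sum_{i\ge 0}\theta_i^2=1$, $\theta_1\ge\theta_2\ge\cdots$, and $\theta_0\neq 0$ or $\sum_{i\ge1}\theta_i=\infty$. Let $(X_i)_{i\ge1}$ be independent exponential random variables of parameters $(\theta_i)_{i\ge 1}$ (for $\theta_i=0$ the variable $X_i$ plays no role) and let $\mu=\theta_0^2\,dx+\sum_{i\ge1}\theta_i\delta_{X_i}$, a random measure on $\mathbb R^+=[0,\infty)$. Conditionally on $\mu$, let $0<Y_1<Y_2<\cdots$ be the points of a Poisson point process on $\mathbb R^+$ of rate $\mu[0,l]\,dl$; conditionally on $(\mu,(Y_i)_{i\ge 1})$, let $(Z_i)_{i\ge1}$ be independent, $Z_i$ having law $\mu(\cdot\cap[0,Y_i])/\mu[0,Y_i]$. Put $Y_0=Z_0=0$. Let $d$ be the metric on $\mathbb R^+$ obtained by gluing, successively for $n\ge 0$, the segment $(Y_n,Y_{n+1}]$ at the point $Z_n$: $d(x,y)=|x-y|$ for $x,y\in(Y_n,Y_{n+1}]$, and $d(x,y)=d(x,Z_n)+|y-Y_n|$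 for $x\in[0,Y_n]$, $y\in(Y_n,Y_{n+1}]$. The $\Theta$-ICRT $\mathcal T$ is the completion of $(\mathbb R^+,d)$. For a Borel measure $\nu$ on $\mathbb R^+$ and $l\ge 0$, let $\nu_l$ be the restriction of $\nu$ to $\mathcal T_l=([0,l],d)\subset\mathcal T$, and consider the normalized measure $\nu_l/\nu[0,l]$ as a measure on $\mathcal T$. **Proposition.** There is a random probability measure $p$ on $\mathcal T$ such that almost surely, as $l\to\infty$, $\mu_l/\mu[0,l]$ converges weakly to $p$, and moreover: 1. Let $\mu^{\leadsto}$ be the Lebesgue measure on $\mathbb R^+$. Almost surely $\mu^{\leadsto}_l/\mu^{\leadsto}[0,l]\to p$ weakly as $l\to\infty$. 2. Let $\mu^{\bullet}=\sum_{i\ge1}\delta_{Y_i}$. Almost surely $\mu^{\bullet}_l/\mu^{\bullet}[0,l]\to p$ weakly as $l\to\infty$. 3. More generally, let $\mu^\alpha$ be a random Borel measure on $\mathbb R^+$ which is $\sigma(\mu,(Y_i)_{i\ge 1})$-measurable and such that almost surely (i) $\mu^\alpha[0,l]<\infty$ for every $l>0$, and $\mu^\alpha(\mathbb R^+)=\infty$;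 (ii) there exists $\varepsilon>0$ such that $\mu^\alpha(Y_{i-1},Y_i]=o\big(\mu^\alpha[0,Y_i]^{1-\varepsilon}\big)$ as $i\to\infty$; (iii) for all $\varepsilon>0$, $\sum_{i=1}^n\mu^\alpha(Y_{i-1},Y_i]\,\mathbf 1_{Y_i-Y_{i-1}>\varepsilon}=o\big(\mu^\alpha[0,Y_n]\big)$ as $n\to\infty$. Then almost surely $\mu^\alpha_l/\mu^\alpha[0,l]\to p$ weakly as $l\to\infty$. -/

import Mathlib

open MeasureTheory ProbabilityTheory Filter Set Topology
open scoped NNReal ENNReal BoundedContinuousFunction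

noncomputable section

namespace ICRT

/-! ### The deterministic stick-breaking construction -/

/-- Admissible input of the stick-breaking construction: cuts `0 = y₀ < y₁ < y₂ < ⋯`
tending to infinity, and glue points `zᵢ ≤ yᵢ` (so that `z₀ = 0`). -/
structure Sticks where
  y : ℕ → ℝ≥0
  z : ℕ → ℝ≥0
  y_zero : y 0 = 0
  strictMono_y : StrictMono y
  tendsto_y : Tendsto y atTop atTop
  z_le : ∀ i, z i ≤ y i

/-- The distance `dₙ` on `[0, yₙ]`: `d₀` is trivial, and `dₙ₊₁` is obtained from `dₙ` by gluing
the segment `(yₙ, yₙ₊₁]` at the point `zₙ`. (The value is only relevant on `[0, yₙ]`.) -/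
def stepDist (y z : ℕ → ℝ≥0) : ℕ → ℝ≥0 → ℝ≥0 → ℝ
  | 0, _, _ => 0
  | n + 1, a, b =>
    if a ≤ y n then
      if b ≤ y n then stepDist y z n a b
      else stepDist y z n a (z n) + |(b : ℝ) - y n|
    else
      if b ≤ y n then stepDist y z n b (z n) + |(a : ℝ) - y n|
      else |(a : ℝ) - b|

section stepDist

variable {y z : ℕ → ℝ≥0}

theorem stepDist_nonneg (n : ℕ) (a b : ℝ≥0) : 0 ≤ stepDist y z n a b := by
  induction n generalizing a b with
  | zero => simp [stepDist]
  | succ n ih =>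
    unfold stepDist
    split_ifs
    · exact ih _ _
    · exact add_nonneg (ih _ _) (abs_nonneg _)
    · exact add_nonneg (ih _ _) (abs_nonneg _)
    · exact abs_nonneg _

theorem stepDist_self (n : ℕ) (a : ℝ≥0) : stepDist y z n a a = 0 := by
  induction n generalizing a with
  | zero => simp [stepDist]
  | succ n ih =>
    unfold stepDist
    split_ifs
    · exact ih _
    · simp

theorem stepDist_comm (n : ℕ) (a b : ℝ≥0) : stepDist y z n a b = stepDist y z n b a := by
  induction n generalizing a b with
  | zero => simp [stepDist]
  | succ n ih =>
    unfold stepDist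
    split_ifs
    · exact ih _ _
    · rfl
    · rfl
    · exact abs_sub_comm _ _

theorem stepDist_triangle (hz : ∀ i, z i ≤ y i) (n : ℕ) (a b c : ℝ≥0) (ha : a ≤ y n)
    (hb : b ≤ y n) (hc : c ≤ y n) :
    stepDist y z n a c ≤ stepDist y z n a b + stepDist y z n b c := by
  induction n generalizing a b c with
  | zero => simp [stepDist]
  | succ n ih =>
    have hzn := hz n
    have key : ∀ u v : ℝ≥0, u ≤ y n → v ≤ y n →
        stepDist y z n u v ≤ stepDist y z n u (z n) + stepDist y z n v (z n) := by
      intro u v hu hv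
      have := ih u (z n) v hu hzn hv
      rwa [stepDist_comm n (z n) v] at this
    have key2 : ∀ u v : ℝ≥0, u ≤ y n → v ≤ y n →
        stepDist y z n u (z n) ≤ stepDist y z n u v + stepDist y z n v (z n) :=
      fun u v hu hv => ih u v (z n) hu hv hzn
    simp only [stepDist]
    split_ifs with h1 h2 h3 h3 h2 h3 h3
    · exact ih _ _ _ h1 h3 h2
    · have := key a c h1 h2
      have := abs_nonneg ((b : ℝ) - y n)
      linarith
    · have := key2 a b h1 h3
      linarith
    · have := abs_sub_le (c : ℝ) b (y n)
      rw [abs_sub_comm (c : ℝ) b] at this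
      linarith
    · have := key2 c b h2 h3
      rw [stepDist_comm n c b] at this
      linarith
    · have := abs_sub_le (a : ℝ) b (y n)
      linarith
    · have := abs_sub_le (a : ℝ) (y n) c
      rw [abs_sub_comm (y n : ℝ) c] at this
      have := stepDist_nonneg (y := y) (z := z) n b (z n)
      linarith
    · exact abs_sub_le _ _ _

theorem eq_of_stepDist_eq_zero (y_zero : y 0 = 0) (n : ℕ) (a b : ℝ≥0) (ha : a ≤ y n)
    (hb : b ≤ y n) (h : stepDist y z n a b = 0) : a = b := by
  induction n generalizing a b with
  | zero => simp_all
  | succ n ih =>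
    simp only [stepDist] at h
    split_ifs at h with h1 h2 h2
    · exact ih _ _ h1 h2 h
    · have h3 : (y n : ℝ) < b := by exact_mod_cast not_le.1 h2
      have := stepDist_nonneg (y := y) (z := z) n a (z n)
      have := abs_pos.2 (sub_ne_zero.2 h3.ne')
      linarith
    · have h3 : (y n : ℝ) < a := by exact_mod_cast not_le.1 h1
      have := stepDist_nonneg (y := y) (z := z) n b (z n)
      have := abs_pos.2 (sub_ne_zero.2 h3.ne')
      linarith
    · exact_mod_cast sub_eq_zero.1 (abs_eq_zero.1 h)

theorem stepDist_of_le (hy : Monotone y) {n m : ℕ} (hnm : n ≤ m) {a b : ℝ≥0} (ha : a ≤ y n)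
    (hb : b ≤ y n) : stepDist y z m a b = stepDist y z n a b := by
  induction m, hnm using Nat.le_induction with
  | base => rfl
  | succ m hm ih =>
    rw [stepDist, if_pos (ha.trans (hy hm)), if_pos (hb.trans (hy hm)), ih]

end stepDist

namespace Sticks

variable (S : Sticks)

theorem exists_le_y (a b : ℝ≥0) : ∃ n, a ≤ S.y n ∧ b ≤ S.y n :=
  ((S.tendsto_y.eventually_ge_atTop a).and (S.tendsto_y.eventually_ge_atTop b)).exists

/-- The first `n` for which `a` and `b` both lie in `[0, yₙ]`. -/
def level (a b : ℝ≥0) : ℕ := by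
  classical exact Nat.find (S.exists_le_y a b)

theorem level_spec (a b : ℝ≥0) : a ≤ S.y (S.level a b) ∧ b ≤ S.y (S.level a b) := by
  classical exact Nat.find_spec (S.exists_le_y a b)

/-- The distance `d` on the half-line, which agrees with `dₙ` on `[0, yₙ]` for each `n`
(see `glueDist_eq`). -/
def glueDist (a b : ℝ≥0) : ℝ := stepDist S.y S.z (S.level a b) a b

theorem glueDist_eq {n : ℕ} {a b : ℝ≥0} (ha : a ≤ S.y n) (hb : b ≤ S.y n) :
    S.glueDist a b = stepDist S.y S.z n a b := by
  have h := S.level_spec a b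
  rcases le_total n (S.level a b) with hn | hn
  · exact stepDist_of_le S.strictMono_y.monotone hn ha hb
  · exact (stepDist_of_le S.strictMono_y.monotone hn h.1 h.2).symm

theorem glueDist_comm (a b : ℝ≥0) : S.glueDist a b = S.glueDist b a := by
  have h := S.level_spec a b
  rw [S.glueDist_eq h.1 h.2, S.glueDist_eq h.2 h.1, stepDist_comm]

/-- A copy of the half-line `[0, ∞)`, to be endowed with the distance `d`. -/
@[nolint unusedArguments]
def Line (_ : Sticks) : Type := ℝ≥0

/-- The identity map from `[0, ∞)` to `([0, ∞), d)`. -/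
def toLine (a : ℝ≥0) : S.Line := a

instance : MetricSpace S.Line where
  dist a b := S.glueDist a b
  dist_self a := stepDist_self _ _
  dist_comm a b := S.glueDist_comm a b
  dist_triangle a b c := by
    have h := S.level_spec a b
    have h' := S.level_spec c c
    have hm := S.strictMono_y.monotone
    have m1 := hm (le_max_left (S.level a b) (S.level c c))
    have m2 := hm (le_max_right (S.level a b) (S.level c c))
    have ha := h.1.trans m1
    have hb := h.2.trans m1
    have hc := h'.1.trans m2
    change S.glueDist a c ≤ S.glueDist a b + S.glueDist b c
    rw [S.glueDist_eq ha hc, S.glueDist_eq ha hb, S.glueDist_eq hb hc]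
    exact stepDist_triangle S.z_le _ _ _ _ ha hb hc
  eq_of_dist_eq_zero := by
    intro a b h
    have hl := S.level_spec a b
    exact eq_of_stepDist_eq_zero S.y_zero _ _ _ hl.1 hl.2 h

theorem dist_toLine (a b : ℝ≥0) : dist (S.toLine a) (S.toLine b) = S.glueDist a b := rfl

/-- The tree `SB(y, z)`: the completion of `([0, ∞), d)`. -/
abbrev Tree : Type := UniformSpace.Completion S.Line

instance : MeasurableSpace S.Tree := borel _

instance : BorelSpace S.Tree := ⟨rfl⟩

/-- The canonical map from the half-line into the tree. -/
def toTree (a : ℝ≥0) : S.Tree := (S.toLine a : UniformSpace.Completion S.Line)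

theorem dist_toTree_of_mem_Ioc {n : ℕ} {a b : ℝ≥0} (ha : a ∈ Ioc (S.y n) (S.y (n + 1)))
    (hb : b ∈ Ioc (S.y n) (S.y (n + 1))) : dist (S.toTree a) (S.toTree b) = dist a b := by
  rw [toTree, toTree, UniformSpace.Completion.dist_eq, dist_toLine, S.glueDist_eq ha.2 hb.2,
    stepDist, if_neg (not_le.2 ha.1), if_neg (not_le.2 hb.1)]
  rfl

/-- The canonical map into the tree is Borel, so that images of measures under it make sense. -/
theorem measurable_toTree : Measurable S.toTree := by
  have hcover : (⋃ o : Option ℕ, (o.elim {0} fun n => Ioc (S.y n) (S.y (n + 1)))) =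
      (univ : Set ℝ≥0) := by
    refine eq_univ_of_forall fun a => mem_iUnion.2 ?_
    by_cases h0 : a = 0
    · exact ⟨none, h0⟩
    · classical
      have hex : ∃ n, a ≤ S.y n := (S.exists_le_y a a).imp fun n h => h.1
      obtain ⟨k, hk⟩ : ∃ k, Nat.find hex = k + 1 := by
        refine Nat.exists_eq_succ_of_ne_zero fun h => h0 ?_
        have := Nat.find_spec hex
        rw [h, S.y_zero] at this
        exact le_antisymm this (zero_le)
      refine ⟨some k, ?_, ?_⟩
      · exact not_le.1 (Nat.find_min hex (by omega))
      · have := Nat.find_spec hex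
        rwa [hk] at this
  refine measurable_of_isOpen fun U hU => ?_
  rw [← univ_inter (S.toTree ⁻¹' U), ← hcover, iUnion_inter]
  refine MeasurableSet.iUnion fun o => ?_
  cases o with
  | none => exact ((finite_singleton (0 : ℝ≥0)).inter_of_left _).measurableSet
  | some n =>
    have hc : ContinuousOn S.toTree (Ioc (S.y n) (S.y (n + 1))) := by
      refine continuousOn_iff_continuous_domRestrict.2 (Isometry.continuous ?_)
      exact Isometry.of_dist_eq fun a b => S.dist_toTree_of_mem_Ioc a.2 b.2
    obtain ⟨V, hV, hVU⟩ := continuousOn_iff'.1 hc U hU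
    change MeasurableSet (Ioc (S.y n) (S.y (n + 1)) ∩ S.toTree ⁻¹' U)
    rw [inter_comm, hVU]
    exact hV.measurableSet.inter measurableSet_Ioc

/-- For a measure `ν` on the half-line, the probability measure `ν_l / ν[0, l]`, where `ν_l` is the
restriction of `ν` to `[0, l]`, seen as a measure on the tree. -/
def normalized (ν : Measure ℝ≥0) (l : ℝ≥0) : Measure S.Tree :=
  ((ν (Icc 0 l))⁻¹ • ν.restrict (Icc 0 l)).map S.toTree

/-- The counting measure `∑_{i ≥ 1} δ_{yᵢ}` on the cuts. -/
def cutMeasure : Measure ℝ≥0 := Measure.sum fun i : ℕ => Measure.dirac (S.y (i + 1))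

end Sticks

/-- The measures `ν l` converge weakly, as `l → ∞`, to the probability measure `p`; the `ν l` are
required to be probability measures for `l` large enough. -/
def ConvergesWeakly {T : Type*} [TopologicalSpace T] [MeasurableSpace T] (ν : ℝ≥0 → Measure T)
    (p : ProbabilityMeasure T) : Prop :=
  (∀ᶠ l in atTop, IsProbabilityMeasure (ν l)) ∧
    ∀ f : T →ᵇ ℝ, Tendsto (fun l => ∫ x, f x ∂(ν l)) atTop (𝓝 (∫ x, f x ∂(p : Measure T)))

/-! ### The random tree -/

/-- The parameter space: sequences `(θᵢ)_{i ≥ 0}` in `[0, ∞)` with `∑ θᵢ² = 1`,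
`θ₁ ≥ θ₂ ≥ ⋯`, and `θ₀ ≠ 0` or `∑_{i ≥ 1} θᵢ = ∞`. -/
structure IsParameter (θ : ℕ → ℝ≥0) : Prop where
  hasSum_sq : HasSum (fun i => θ i ^ 2) 1
  antitone : ∀ i, 1 ≤ i → θ (i + 1) ≤ θ i
  ne_zero_or : θ 0 ≠ 0 ∨ ¬ Summable fun i => θ (i + 1)

/-- Lebesgue measure on the half-line `[0, ∞)`. -/
def lebesgue : Measure ℝ≥0 := (volume : Measure ℝ).comap ((↑) : ℝ≥0 → ℝ)

/-- The measure `μ = θ₀² dx + ∑_{i ≥ 1} θᵢ δ_{xᵢ}` on the half-line. -/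
def massMeasure (θ x : ℕ → ℝ≥0) : Measure ℝ≥0 :=
  θ 0 ^ 2 • lebesgue + Measure.sum fun i : ℕ => θ (i + 1) • Measure.dirac (x (i + 1))

variable {Ω : Type*}

/-- The σ-algebra generated by the random measure `μ`. -/
@[reducible]
def sigmaMass (θ : ℕ → ℝ≥0) (X : ℕ → Ω → ℝ≥0) : MeasurableSpace Ω :=
  MeasurableSpace.comap (fun ω => massMeasure θ fun i => X i ω) inferInstance

/-- The σ-algebra generated by the random measure `μ` and the cuts `(Yᵢ)`. -/
@[reducible]
def sigmaMassCuts (θ : ℕ → ℝ≥0) (X : ℕ → Ω → ℝ≥0) (S : Ω → Sticks) : MeasurableSpace Ω :=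
  sigmaMass θ X ⊔ ⨆ i, MeasurableSpace.comap (fun ω => (S ω).y i) inferInstance

/-- The random input `S = (Y, Z)` of the stick-breaking construction, together with the variables
`(Xᵢ)_{i ≥ 1}`, has the law that defines the inhomogeneous continuum random tree of parameter `θ`,
i.e. `ω ↦ (S ω).Tree` is this random tree. When `θᵢ = 0` for some `i ≥ 1`, the variable `Xᵢ` has no
role (an exponential variable of parameter `0` would be infinite) and its law is arbitrary. -/
structure IsICRT [MeasurableSpace Ω] (P : Measure Ω) (θ : ℕ → ℝ≥0) (X : ℕ → Ω → ℝ≥0)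
    (S : Ω → Sticks) : Prop where
  measurable_X : ∀ i, Measurable (X i)
  measurable_Y : ∀ i, Measurable fun ω => (S ω).y i
  measurable_Z : ∀ i, Measurable fun ω => (S ω).z i
  /-- The `Xᵢ`, `i ≥ 1`, are independent. -/
  indep_X : iIndepFun (fun i : {i : ℕ // 1 ≤ i ∧ 0 < θ i} => X i) P
  /-- For `i ≥ 1`, `Xᵢ` is exponential of parameter `θᵢ`. -/
  law_X : ∀ i, 1 ≤ i → 0 < θ i → P.map (fun ω => (X i ω : ℝ)) = expMeasure (θ i)
  /-- Conditionally on `μ`, the `Yᵢ`, `i ≥ 1`, form a Poisson point process of rate `μ[0, l] dl`: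
  the numbers of points in disjoint bounded Borel sets are independent Poisson variables whose
  means are given by the intensity measure. -/
  law_Y : ∀ (k : ℕ) (A : Fin k → Set ℝ≥0) (n : Fin k → ℕ),
    (∀ j, MeasurableSet (A j)) → (∀ j, Bornology.IsBounded (A j)) →
    Pairwise (Function.onFun Disjoint A) →
    P⟦{ω | ∀ j, (S ω).cutMeasure (A j) = n j} | sigmaMass θ X⟧ =ᵐ[P] fun ω =>
      ∏ j, (poissonMeasure
        (∫⁻ l in A j, massMeasure θ (fun i => X i ω) (Icc 0 l) ∂lebesgue).toNNReal).real {n j}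
  /-- Conditionally on `μ` and `(Yᵢ)`, the `Zᵢ`, `i ≥ 1`, are independent with respective laws
  `μ_{Yᵢ} / μ[0, Yᵢ]`. -/
  law_Z : ∀ (n : ℕ) (B : ℕ → Set ℝ≥0), (∀ i, MeasurableSet (B i)) →
    P⟦{ω | ∀ i ∈ Finset.Icc 1 n, (S ω).z i ∈ B i} | sigmaMassCuts θ X S⟧ =ᵐ[P] fun ω =>
      ∏ i ∈ Finset.Icc 1 n,
        (massMeasure θ (fun i => X i ω))[|Icc 0 ((S ω).y i)].real (B i)

/-- The growth conditions (i)–(iii) on a measure `ν` on the half-line, relative to the cuts. -/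
structure GrowthConditions (S : Sticks) (ν : Measure ℝ≥0) : Prop where
  /-- (i) `ν[0, l] < ∞` for every `l`. -/
  finite : ∀ l, 0 < l → ν (Icc 0 l) < ∞
  /-- (i) `ν` has infinite total mass. -/
  infinite : ν univ = ∞
  /-- (ii) For some `ε > 0`, `ν(yᵢ₋₁, yᵢ] = o(ν[0, yᵢ]^{1 - ε})`. -/
  stick : ∃ ε : ℝ, 0 < ε ∧
    (fun i => ν.real (Ioc (S.y i) (S.y (i + 1)))) =o[atTop]
      fun i => ν.real (Icc 0 (S.y (i + 1))) ^ (1 - ε)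
  /-- (iii) For every `ε > 0`, `∑_{i ≤ n} ν(yᵢ₋₁, yᵢ] 1_{yᵢ - yᵢ₋₁ > ε} = o(ν[0, yₙ])`. -/
  long_sticks : ∀ ε : ℝ, 0 < ε →
    (fun n => ∑ i ∈ Finset.range n, if ε < (S.y (i + 1) : ℝ) - S.y i then
        ν.real (Ioc (S.y i) (S.y (i + 1))) else 0) =o[atTop]
      fun n => ν.real (Icc 0 (S.y n))

end ICRT

end

/-! Fix a level `K` and project the tree on `[0, Y_K]`: every point has an ancestor there and a
height above it. A stick inherits the ancestor of its gluing point, and its heights start from the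
height of that point. Conditionally on `(μ, Y)`, the point `Z_n` has the normalized law of `μ` on
`[0, Y_n]`, independently of the earlier gluing points. Hence the `μ`-proportion in `[0, Y_n]` of
the points whose ancestor lies in a given cell is a bounded martingale in `n`, and that of the
points higher than `ε` is a bounded submartingale. Both converge
(`IsICRT.ae_exists_tendsto_proportion`).

Weak convergence follows if, in addition, the limiting proportion of points higher than `ε` above
`[0, Y_K]` becomes small for some large `K`. Indeed, integrals of bounded Lipschitz functions are
then determined, up to a small error, by finitely many cell proportions
(`Sticks.exists_abs_integral_sub_sum_le`). Such integrals are Cauchy, the measures are tight because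
the tree is complete and each `[0, R]` is totally bounded, and Prokhorov's theorem supplies the
limit (`Equidistributes.exists_convergesWeakly`). Two measures with the same limiting cell
proportions have the same limit. Times between two cuts are handled by monotonicity along a stick.

For the heights, the conditional mean height given `(μ, Y)` grows at step `n` by the integral of `x
- Y_n` over the new stick against the normalized mass (`stickHeight`). By Markov's inequality and
Fatou's lemma it suffices that these increments be summable. At times when the mean mass is of order
`2 ^ k`, Chebyshev's inequality and Borel-Cantelli show that the mass is at least `2 ^ k / 2`. Cuts
then arrive at rate at least `2 ^ k / 2`, so a point is typically at distance of order `2 ^ (-k)`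
from the preceding cut. Each block of times contributes of order `2 ^ (-k)` to the mean, whence
`IsICRT.ae_tsum_stickHeight_ne_top`.

For a measure `ν` determined by `(μ, Y)`, the `ν`-proportion of a cell is an average of the
indicators of `Z_i` falling in it, with weights `ν(Y_i, Y_{i+1}]` that are fixed given `(μ, Y)`.
Condition (ii) makes the squares of weight over total mass summable, so martingale convergence and
Kronecker's lemma replace the indicators by the `μ`-proportions, which converge
(`IsICRT.ae_gluingLLN`). Condition (iii) removes the long sticks from the height estimate. Lebesgue
measure and the counting measure of the cuts satisfy (i)-(iii) because, given `μ`, grid cells are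
empty of cuts independently, with probabilities that tend to `0` (`IsICRT.ae_sparseEmptyCells`). -/

noncomputable section

namespace ICRT

/-! ### Weighted averages of real sequences -/

/-- Toeplitz's lemma. `W` need not start at `0`; the initial value is negligible because `W` tends
to infinity. -/
theorem tendsto_weighted_average {w W x : ℕ → ℝ} {L : ℝ} (hw : ∀ n, 0 ≤ w n)
    (hW : ∀ n, W (n + 1) = W n + w n) (hWt : Tendsto W atTop atTop)
    (hx : Tendsto x atTop (𝓝 L)) :
    Tendsto (fun n => (∑ i ∈ Finset.range n, w i * x i) / W n) atTop (𝓝 L) := by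
  have hsum : ∀ n, ∑ i ∈ Finset.range n, w i = W n - W 0 := by
    intro n
    induction n with
    | zero => simp
    | succ n ih => rw [Finset.sum_range_succ, ih, hW]; ring
  have hS : Tendsto (fun n => ∑ i ∈ Finset.range n, w i) atTop atTop := by
    simp_rw [hsum]
    exact tendsto_atTop_add_const_right _ _ hWt
  have h1 : (fun i => w i * (x i - L)) =o[atTop] w := by
    have : (fun i => x i - L) =o[atTop] (fun _ => (1 : ℝ)) := by
      rw [Asymptotics.isLittleO_one_iff]
      simpa using hx.sub_const L
    simpa using (Asymptotics.isBigO_refl w atTop).mul_isLittleO this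
  have h2 := h1.sum_range hw hS
  have h3 : (fun n => ∑ i ∈ Finset.range n, w i) =O[atTop] W := by
    simp_rw [hsum]
    refine (Asymptotics.isBigO_refl W atTop).sub ?_
    refine Asymptotics.IsLittleO.isBigO ?_
    exact Asymptotics.isLittleO_const_left.2 (Or.inr (tendsto_norm_atTop_atTop.comp hWt))
  have h4 := (h2.trans_isBigO h3).tendsto_div_nhds_zero
  have h5 : Tendsto (fun n => L * (1 - W 0 / W n)) atTop (𝓝 (L * (1 - 0))) :=
    ((hWt.const_div_atTop (W 0)).const_sub 1).const_mul L
  have h6 := h4.add h5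
  simp only [sub_zero, mul_one, zero_add] at h6
  refine h6.congr' ?_
  filter_upwards [hWt.eventually_gt_atTop 0] with n hn
  have : ∑ i ∈ Finset.range n, w i * (x i - L) =
      (∑ i ∈ Finset.range n, w i * x i) - L * (W n - W 0) := by
    rw [← hsum, Finset.mul_sum, ← Finset.sum_sub_distrib]
    exact Finset.sum_congr rfl fun i _ => by ring
  rw [this]
  field_simp
  ring

/-- Kronecker's lemma. -/
theorem tendsto_kronecker {w W b : ℕ → ℝ} {s : ℝ} (hw : ∀ n, 0 ≤ w n)
    (hW : ∀ n, W (n + 1) = W n + w n) (hWt : Tendsto W atTop atTop)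
    (hb : Tendsto (fun n => ∑ i ∈ Finset.range n, b i) atTop (𝓝 s)) :
    Tendsto (fun n => (∑ i ∈ Finset.range n, W (i + 1) * b i) / W n) atTop (𝓝 0) := by
  have h1 := hb.sub (tendsto_weighted_average hw hW hWt hb)
  rw [sub_self] at h1
  refine h1.congr' ?_
  -- Abel summation: after division by `W n`, what remains is a partial sum minus a weighted average
  -- of partial sums, and both have the same limit.
  have habel : ∀ n, ∑ i ∈ Finset.range n, W (i + 1) * b i =
      W n * (∑ i ∈ Finset.range n, b i) -
        ∑ i ∈ Finset.range n, w i * ∑ j ∈ Finset.range i, b j := by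
    intro n
    induction n with
    | zero => simp
    | succ n ih =>
      rw [Finset.sum_range_succ, ih, Finset.sum_range_succ _ n, Finset.sum_range_succ _ n, hW]
      ring
  filter_upwards [hWt.eventually_gt_atTop 0] with n hn
  rw [habel]
  field_simp

/-- Two tangent inequalities, for `exp` and `log`. With `x` a ratio of consecutive terms of `W`,
this compares a relative increment of `W` with an increment of `W ^ (-ε)`. -/
theorem one_sub_le_rpow_neg {x ε : ℝ} (hx : 0 < x) (hε : 0 < ε) :
    ε * (1 - x) ≤ x ^ (-ε) - 1 := by
  have h1 : Real.log x ≤ x - 1 := Real.log_le_sub_one_of_pos hx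
  have h2 := Real.add_one_le_exp (Real.log x * -ε)
  rw [Real.rpow_def_of_pos hx]
  nlinarith

/-- If the increments `w n` of `W` are at most `W (n + 1) ^ (1 - ε)`, then the squares of
`w n / W (n + 1)` are summable. -/
theorem summable_sq_div_of_le_rpow {w W : ℕ → ℝ} {ε : ℝ} (hε : 0 < ε) (hw : ∀ n, 0 ≤ w n)
    (hW : ∀ n, W (n + 1) = W n + w n) (hWt : Tendsto W atTop atTop)
    (hle : ∀ᶠ n in atTop, w n ≤ W (n + 1) ^ (1 - ε)) :
    Summable fun n => (w n / W (n + 1)) ^ 2 := by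
  obtain ⟨N, hN⟩ := eventually_atTop.1 (hle.and (hWt.eventually_gt_atTop 0))
  rw [← summable_nat_add_iff N]
  have hpos : ∀ n, 0 < W (n + N) := fun n => (hN _ (by omega)).2
  refine summable_of_sum_range_le (c := W N ^ (-ε) / ε) (fun n => sq_nonneg _) fun n => ?_
  -- One factor of the square is at most `W (n + N + 1) ^ (-ε)` by hypothesis; times the other
  -- factor, it is dominated by a telescoping difference.
  have key : ∀ n, (w (n + N) / W (n + N + 1)) ^ 2 ≤
      (W (n + N) ^ (-ε) - W (n + N + 1) ^ (-ε)) / ε := by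
    intro n
    have hp := hpos n
    have hp1 : 0 < W (n + N + 1) := by
      have := hpos (n + 1)
      rwa [show n + 1 + N = n + N + 1 by ring] at this
    have h1 := (hN (n + N) (by omega)).1
    have h2 := one_sub_le_rpow_neg (div_pos hp hp1) hε
    have h3 : (W (n + N) / W (n + N + 1)) ^ (-ε) * W (n + N + 1) ^ (-ε) = W (n + N) ^ (-ε) := by
      rw [← Real.mul_rpow (div_pos hp hp1).le hp1.le, div_mul_cancel₀ _ hp1.ne']
    have h4 : 1 - W (n + N) / W (n + N + 1) = w (n + N) / W (n + N + 1) := by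
      rw [eq_div_iff hp1.ne', sub_mul, div_mul_cancel₀ _ hp1.ne', hW]; ring
    rw [h4] at h2
    have h5 : w (n + N) / W (n + N + 1) ≤ W (n + N + 1) ^ (-ε) := by
      rw [div_le_iff₀ hp1, ← Real.rpow_add_one hp1.ne']
      exact h1.trans_eq (by congr 1; ring)
    have h6 : 0 ≤ w (n + N) / W (n + N + 1) := div_nonneg (hw _) hp1.le
    rw [le_div_iff₀ hε]
    have h7 := mul_le_mul_of_nonneg_right h2 (Real.rpow_nonneg hp1.le (-ε))
    rw [sub_mul, h3, one_mul] at h7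
    refine le_trans ?_ h7
    have := mul_le_mul_of_nonneg_left h5 h6
    nlinarith
  calc ∑ i ∈ Finset.range n, (w (i + N) / W (i + N + 1)) ^ 2
      ≤ ∑ i ∈ Finset.range n, (W (i + N) ^ (-ε) / ε - W (i + 1 + N) ^ (-ε) / ε) := by
        refine Finset.sum_le_sum fun i _ => (key i).trans_eq ?_
        rw [sub_div, show i + 1 + N = i + N + 1 by ring]
    _ = W N ^ (-ε) / ε - W (n + N) ^ (-ε) / ε := by
        rw [Finset.sum_range_sub' (fun i => W (i + N) ^ (-ε) / ε)]; simp
    _ ≤ W N ^ (-ε) / ε := by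
        have := div_nonneg (Real.rpow_nonneg (hpos n).le (-ε)) hε.le
        linarith

/-! ### Convergence of martingale transforms -/

section Martingale

variable {Ω : Type*} {mΩ : MeasurableSpace Ω} {P : Measure Ω} [IsProbabilityMeasure P]
  {𝓕 : Filtration ℕ mΩ} {a d : ℕ → Ω → ℝ}

/-- The transform is a martingale with orthogonal increments, so its second moment is at most `C`.
It is thus bounded in `L¹` and Doob's convergence theorem applies. -/
theorem ae_exists_tendsto_sum_mul_of_sum_sq_le
    (hd : ∀ n, Measurable[𝓕 (n + 1)] (d n)) (hd1 : ∀ n ω, |d n ω| ≤ 1)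
    (hd0 : ∀ n, P[d n | 𝓕 n] =ᵐ[P] 0) (ha : ∀ n, Measurable[𝓕 n] (a n)) {C : ℝ}
    (hC : ∀ n ω, ∑ i ∈ Finset.range n, a i ω ^ 2 ≤ C) :
    ∀ᵐ ω ∂P, ∃ s, Tendsto (fun n => ∑ i ∈ Finset.range n, a i ω * d i ω) atTop (𝓝 s) := by
  set s : ℕ → Ω → ℝ := fun n ω => ∑ i ∈ Finset.range n, a i ω * d i ω with hs
  have hC0 : ∀ ω, 0 ≤ C := fun ω => by simpa using hC 0 ω
  have hab : ∀ n ω, |a n ω| ≤ √C := by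
    intro n ω
    refine Real.abs_le_sqrt (le_trans ?_ (hC (n + 1) ω))
    exact Finset.single_le_sum (f := fun i => a i ω ^ 2) (fun i _ => sq_nonneg _)
      (Finset.self_mem_range_succ n)
  have hmeas : ∀ n, Measurable[𝓕 n] (s n) := by
    intro n
    refine Finset.measurable_fun_sum _ fun i hi => ?_
    have hi' := Finset.mem_range.1 hi
    exact ((ha i).mono (𝓕.mono hi'.le) le_rfl).mul ((hd i).mono (𝓕.mono hi') le_rfl)
  have hmul : ∀ n ω, |a n ω * d n ω| ≤ √C := fun n ω => by
    rw [abs_mul]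
    exact (mul_le_mul (hab n ω) (hd1 n ω) (abs_nonneg _) (Real.sqrt_nonneg _)).trans_eq (mul_one _)
  have hsb : ∀ n ω, |s n ω| ≤ n * √C := fun n ω => by
    refine (Finset.abs_sum_le_sum_abs _ _).trans ?_
    refine (Finset.sum_le_sum fun i _ => hmul i ω).trans ?_
    simp
  have hbint : ∀ (f : Ω → ℝ) (c : ℝ), Measurable f → (∀ ω, |f ω| ≤ c) → Integrable f P :=
    fun f c hf hc => Integrable.of_bound hf.aestronglyMeasurable c
      (ae_of_all _ fun ω => by simpa using hc ω)
  have hdm : ∀ n, Measurable (d n) := fun n => (hd n).mono (𝓕.le _) le_rfl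
  have ham : ∀ n, Measurable (a n) := fun n => (ha n).mono (𝓕.le _) le_rfl
  have hsm : ∀ n, Measurable (s n) := fun n => (hmeas n).mono (𝓕.le _) le_rfl
  have hdi : ∀ n, Integrable (d n) P := fun n => hbint _ 1 (hdm n) (hd1 n)
  have hmart : Martingale s 𝓕 P := by
    refine martingale_of_condExp_sub_eq_zero_nat (fun n => (hmeas n).stronglyMeasurable)
      (fun n => hbint _ _ (hsm n) (hsb n)) fun n => ?_
    have : s (n + 1) - s n = a n * d n := by
      ext ω; simp [hs, Finset.sum_range_succ]
    rw [this]
    refine (condExp_mul_of_stronglyMeasurable_left (ha n).stronglyMeasurable ?_ (hdi n)).trans ?_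
    · exact hbint _ _ ((ham n).mul (hdm n)) (hmul n)
    · filter_upwards [hd0 n] with ω h
      simp [h]
  have hsq : ∀ n, ∫ ω, s n ω ^ 2 ∂P ≤ ∫ ω, ∑ i ∈ Finset.range n, a i ω ^ 2 ∂P := by
    intro n
    induction n with
    | zero => simp [hs]
    | succ n ih =>
      have e1 : (fun ω => s (n + 1) ω ^ 2) = fun ω =>
          s n ω ^ 2 + ((2 * s n ω * a n ω) * d n ω + (a n ω * d n ω) ^ 2) := by
        ext ω; simp only [hs, Finset.sum_range_succ]; ring
      have b1 : ∀ ω, |2 * s n ω * a n ω| ≤ 2 * (n * √C) * √C := fun ω => by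
        rw [abs_mul, abs_mul, abs_two]
        exact mul_le_mul (mul_le_mul_of_nonneg_left (hsb n ω) zero_le_two) (hab n ω)
          (abs_nonneg _) (by positivity)
      have m1 : Measurable[𝓕 n] fun ω => 2 * s n ω * a n ω := ((hmeas n).const_mul 2).mul (ha n)
      have i0 : Integrable (fun ω => s n ω ^ 2) P :=
        hbint _ ((n * √C) ^ 2) ((hsm n).pow_const 2) fun ω => by
          rw [abs_pow]; exact pow_le_pow_left₀ (abs_nonneg _) (hsb n ω) 2
      have i1 : Integrable (fun ω => (2 * s n ω * a n ω) * d n ω) P :=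
        hbint _ (2 * (n * √C) * √C) ((m1.mono (𝓕.le _) le_rfl).mul (hdm n)) fun ω => by
          rw [abs_mul]
          exact (mul_le_mul (b1 ω) (hd1 n ω) (abs_nonneg _) (by positivity)).trans_eq (mul_one _)
      have i2 : Integrable (fun ω => (a n ω * d n ω) ^ 2) P :=
        hbint _ (√C ^ 2) (((ham n).mul (hdm n)).pow_const 2) fun ω => by
          rw [abs_pow]; exact pow_le_pow_left₀ (abs_nonneg _) (hmul n ω) 2
      have i3 : Integrable (fun ω => a n ω ^ 2) P :=
        hbint _ (√C ^ 2) ((ham n).pow_const 2) fun ω => by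
          rw [abs_pow]; exact pow_le_pow_left₀ (abs_nonneg _) (hab n ω) 2
      have i4 : Integrable (fun ω => ∑ i ∈ Finset.range n, a i ω ^ 2) P :=
        hbint _ C (Finset.measurable_fun_sum _ fun i _ => (ham i).pow_const 2) fun ω => by
          rw [abs_of_nonneg (Finset.sum_nonneg fun i _ => sq_nonneg _)]; exact hC n ω
      -- The cross term vanishes: its first factor is known at time `n` and `d n` has zero
      -- conditional mean.
      have z1 : ∫ ω, (2 * s n ω * a n ω) * d n ω ∂P = 0 := by
        rw [← integral_condExp (𝓕.le n)]
        have := condExp_mul_of_stronglyMeasurable_left (μ := P) (g := d n)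
          m1.stronglyMeasurable i1 (hdi n)
        refine integral_eq_zero_of_ae (this.trans ?_)
        filter_upwards [hd0 n] with ω h
        simp [h]
      have i12 : Integrable (fun ω => (2 * s n ω * a n ω) * d n ω + (a n ω * d n ω) ^ 2) P :=
        i1.add i2
      rw [e1, integral_add i0 i12, integral_add i1 i2, z1, zero_add]
      simp_rw [Finset.sum_range_succ]
      rw [integral_add i4 i3]
      refine add_le_add ih (integral_mono i2 i3 fun ω => ?_)
      change (a n ω * d n ω) ^ 2 ≤ a n ω ^ 2
      rw [mul_pow]
      have : d n ω ^ 2 ≤ 1 := (sq_le_one_iff_abs_le_one _).2 (hd1 n ω)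
      nlinarith [sq_nonneg (a n ω)]
  have hbdd : ∀ n, eLpNorm (s n) 1 P ≤ ((C + 1).toNNReal : ℝ≥0) := by
    intro n
    have hi : Integrable (s n) P := hmart.integrable n
    rw [eLpNorm_one_eq_lintegral_enorm, ← ofReal_integral_norm_eq_lintegral_enorm hi]
    refine ENNReal.ofReal_le_ofReal ?_
    have hi2 : Integrable (fun ω => s n ω ^ 2) P :=
        hbint _ ((n * √C) ^ 2) ((hsm n).pow_const 2) fun ω => by
          rw [abs_pow]; exact pow_le_pow_left₀ (abs_nonneg _) (hsb n ω) 2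
    have i4 : Integrable (fun ω => ∑ i ∈ Finset.range n, a i ω ^ 2) P :=
        hbint _ C (Finset.measurable_fun_sum _ fun i _ => (ham i).pow_const 2) fun ω => by
          rw [abs_of_nonneg (Finset.sum_nonneg fun i _ => sq_nonneg _)]; exact hC n ω
    calc ∫ ω, ‖s n ω‖ ∂P ≤ ∫ ω, (s n ω ^ 2 + 1) ∂P := by
          refine integral_mono hi.norm (hi2.add (integrable_const _)) fun ω => ?_
          rw [Real.norm_eq_abs, ← sq_abs]
          nlinarith [sq_nonneg (|s n ω| - 1), abs_nonneg (s n ω)]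
      _ = (∫ ω, s n ω ^ 2 ∂P) + 1 := by
          rw [integral_add hi2 (integrable_const _)]; simp
      _ ≤ C + 1 := by
          refine add_le_add_left ((hsq n).trans ?_) 1
          refine (integral_mono i4 (integrable_const C) fun ω => hC n ω).trans_eq ?_
          simp
  exact hmart.submartingale.exists_ae_tendsto_of_bdd hbdd

/-- Let `d` be bounded martingale differences and `a` a predictable sequence with summable squares.
Then the martingale transform `∑ a i * d i` converges. -/
theorem ae_exists_tendsto_sum_mul
    (hd : ∀ n, Measurable[𝓕 (n + 1)] (d n)) (hd1 : ∀ n ω, |d n ω| ≤ 1)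
    (hd0 : ∀ n, P[d n | 𝓕 n] =ᵐ[P] 0) (ha : ∀ n, Measurable[𝓕 n] (a n))
    (hs : ∀ᵐ ω ∂P, Summable fun n => a n ω ^ 2) :
    ∀ᵐ ω ∂P, ∃ s, Tendsto (fun n => ∑ i ∈ Finset.range n, a i ω * d i ω) atTop (𝓝 s) := by
  classical
  have hpm : ∀ n, Measurable[𝓕 n] fun ω => ∑ i ∈ Finset.range (n + 1), a i ω ^ 2 := fun n =>
    Finset.measurable_fun_sum _ fun i hi =>
      ((ha i).mono (𝓕.mono (Nat.lt_succ_iff.1 (Finset.mem_range.1 hi))) le_rfl).pow_const 2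
  -- Localization: `a` is replaced by `0` once its sum of squares exceeds `C`. That sum includes the
  -- current index, which is still predictable, so the bound `C` holds without overshoot.
  have key : ∀ C : ℕ, ∀ᵐ ω ∂P, ∃ s, Tendsto (fun n => ∑ i ∈ Finset.range n,
      (if ∑ j ∈ Finset.range (i + 1), a j ω ^ 2 ≤ C then a i ω else 0) * d i ω) atTop (𝓝 s) := by
    intro C
    refine ae_exists_tendsto_sum_mul_of_sum_sq_le (C := C) hd hd1 hd0 (fun n => ?_) fun n ω => ?_
    · exact Measurable.ite (measurableSet_le (hpm n) measurable_const) (ha n) measurable_const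
    · induction n with
      | zero => simp
      | succ n ih =>
        by_cases h : ∑ j ∈ Finset.range (n + 1), a j ω ^ 2 ≤ C
        · refine le_trans (Finset.sum_le_sum fun i _ => ?_) h
          split_ifs
          · exact le_rfl
          · simpa using sq_nonneg _
        · rw [Finset.sum_range_succ, if_neg h]
          simpa using ih
  filter_upwards [ae_all_iff.2 key, hs] with ω h1 h2
  obtain ⟨C, hC⟩ := exists_nat_ge (∑' n, a n ω ^ 2)
  obtain ⟨s, hs⟩ := h1 C
  refine ⟨s, hs.congr fun n => Finset.sum_congr rfl fun i _ => ?_⟩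
  rw [if_pos]
  exact (h2.sum_le_tsum _ fun i _ => sq_nonneg _).trans hC

end Martingale

end ICRT

namespace ICRT

/-! ### Ancestors in a given level -/

/-- For `x ≤ y (K + m)`, the projection of `x` on `[0, y K]` in the tree, and the height of `x` above
`[0, y K]`. -/
def stepAncestor (y z : ℕ → ℝ≥0) (K : ℕ) : ℕ → ℝ≥0 → ℝ≥0 × ℝ≥0
  | 0, x => (x, 0)
  | m + 1, x =>
    if x ≤ y (K + m) then stepAncestor y z K m x
    else ((stepAncestor y z K m (z (K + m))).1,
      (stepAncestor y z K m (z (K + m))).2 + (x - y (K + m)))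

theorem stepAncestor_of_le {y z : ℕ → ℝ≥0} (hy : Monotone y) {K m m' : ℕ} (h : m ≤ m') {x : ℝ≥0}
    (hx : x ≤ y (K + m)) : stepAncestor y z K m' x = stepAncestor y z K m x := by
  induction m', h using Nat.le_induction with
  | base => rfl
  | succ m' hm ih => rw [stepAncestor, if_pos (hx.trans (hy (by omega))), ih]

/-- Ancestors of points of `[0, y (K + m)]` involve only the earlier gluing points; this makes them
functions of the truncated `gluingState`. -/
theorem stepAncestor_congr {y z z' : ℕ → ℝ≥0} {K m : ℕ} (h : ∀ i < K + m, z i = z' i) (x : ℝ≥0) :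
    stepAncestor y z K m x = stepAncestor y z' K m x := by
  induction m generalizing x with
  | zero => rfl
  | succ m ih =>
    have ih' := ih fun i hi => h i (by omega)
    simp only [stepAncestor, ih', h (K + m) (by omega)]

theorem measurable_stepAncestor (K m : ℕ) :
    Measurable fun p : ((ℕ → ℝ≥0) × (ℕ → ℝ≥0)) × ℝ≥0 => stepAncestor p.1.1 p.1.2 K m p.2 := by
  induction m with
  | zero => exact measurable_snd.prodMk measurable_const
  | succ m ih =>
    have hy : Measurable fun p : ((ℕ → ℝ≥0) × (ℕ → ℝ≥0)) × ℝ≥0 => p.1.1 (K + m) :=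
      (measurable_pi_apply _).comp (measurable_fst.comp measurable_fst)
    have hz : Measurable fun p : ((ℕ → ℝ≥0) × (ℕ → ℝ≥0)) × ℝ≥0 => p.1.2 (K + m) :=
      (measurable_pi_apply _).comp (measurable_snd.comp measurable_fst)
    have h := ih.comp (measurable_fst.prodMk hz)
    exact Measurable.ite (measurableSet_le measurable_snd hy) ih
      (h.fst.prodMk (h.snd.add (measurable_snd.sub hy)))

/-- The cells of mesh `1 / m` of the half-line, subdivided by the cuts. -/
def cell (y : ℕ → ℝ≥0) (m i j : ℕ) : Set ℝ≥0 :=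
  {x | (i = 0 ∧ x = 0) ∨ ∃ n, i = n + 1 ∧ y n < x ∧ x ≤ y (n + 1) ∧ ⌈x * m⌉₊ = j}

theorem measurableSet_cell (m i j : ℕ) :
    MeasurableSet {p : (ℕ → ℝ≥0) × ℝ≥0 | p.2 ∈ cell p.1 m i j} := by
  have h : ∀ n, Measurable fun p : (ℕ → ℝ≥0) × ℝ≥0 => p.1 n := fun n =>
    (measurable_pi_apply _).comp measurable_fst
  have hc : Measurable fun p : (ℕ → ℝ≥0) × ℝ≥0 => ⌈p.2 * m⌉₊ :=
    Nat.measurable_ceil.comp (measurable_snd.mul_const _)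
  refine MeasurableSet.union ?_ ?_
  · exact (MeasurableSet.const _).inter (measurableSet_eq_fun measurable_snd measurable_const)
  · have : {p : (ℕ → ℝ≥0) × ℝ≥0 | ∃ n, i = n + 1 ∧ p.1 n < p.2 ∧ p.2 ≤ p.1 (n + 1) ∧
        ⌈p.2 * m⌉₊ = j} = ⋃ n, {p : (ℕ → ℝ≥0) × ℝ≥0 | i = n + 1 ∧ p.1 n < p.2 ∧
        p.2 ≤ p.1 (n + 1) ∧ ⌈p.2 * m⌉₊ = j} := by ext; simp
    change MeasurableSet {p : (ℕ → ℝ≥0) × ℝ≥0 | ∃ n, i = n + 1 ∧ p.1 n < p.2 ∧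
      p.2 ≤ p.1 (n + 1) ∧ ⌈p.2 * m⌉₊ = j}
    rw [this]
    refine MeasurableSet.iUnion fun n => ?_
    exact (MeasurableSet.const _).inter ((measurableSet_lt (h n) measurable_snd).inter
      ((measurableSet_le measurable_snd (h (n + 1))).inter (hc (measurableSet_singleton j))))

namespace Sticks

variable (S : Sticks)

/-- The projection of `x` on `[0, y K]` in the tree, and the height of `x` above `[0, y K]`. -/
def ancestor (K : ℕ) (x : ℝ≥0) : ℝ≥0 × ℝ≥0 := stepAncestor S.y S.z K (S.level x x) x

theorem ancestor_eq {K m : ℕ} {x : ℝ≥0} (hx : x ≤ S.y (K + m)) :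
    S.ancestor K x = stepAncestor S.y S.z K m x := by
  have hm := S.strictMono_y.monotone
  have h := (S.level_spec x x).1.trans (hm (Nat.le_add_left _ K))
  rcases le_total m (S.level x x) with hl | hl
  · exact stepAncestor_of_le hm hl hx
  · exact (stepAncestor_of_le hm hl h).symm

theorem ancestor_of_le {K : ℕ} {x : ℝ≥0} (hx : x ≤ S.y K) : S.ancestor K x = (x, 0) :=
  S.ancestor_eq (m := 0) hx

theorem ancestor_of_mem_Ioc {K n : ℕ} (hn : K ≤ n) {x : ℝ≥0}
    (hx : x ∈ Ioc (S.y n) (S.y (n + 1))) :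
    S.ancestor K x = ((S.ancestor K (S.z n)).1, (S.ancestor K (S.z n)).2 + (x - S.y n)) := by
  obtain ⟨m, rfl⟩ := Nat.exists_eq_add_of_le hn
  rw [S.ancestor_eq (m := m + 1) hx.2, stepAncestor, if_neg (not_le.2 hx.1),
    S.ancestor_eq (S.z_le _)]

/-- Induction along the construction of the tree. -/
theorem induction_on_sticks {K : ℕ} {p : ℝ≥0 → Prop} (h0 : ∀ x ≤ S.y K, p x)
    (h1 : ∀ n, K ≤ n → p (S.z n) → ∀ x ∈ Ioc (S.y n) (S.y (n + 1)), p x) (x : ℝ≥0) : p x := by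
  have key : ∀ m, ∀ x ≤ S.y (K + m), p x := by
    intro m
    induction m with
    | zero => exact h0
    | succ m ih =>
      intro x hx
      by_cases h : x ≤ S.y (K + m)
      · exact ih x h
      · exact h1 _ (by omega) (ih _ (S.z_le _)) x ⟨not_le.1 h, hx⟩
  exact key (S.level x x) x
    ((S.level_spec x x).1.trans (S.strictMono_y.monotone (Nat.le_add_left _ K)))

theorem ancestor_fst_le (K : ℕ) (x : ℝ≥0) : (S.ancestor K x).1 ≤ S.y K := by
  induction x using S.induction_on_sticks (K := K) with
  | h0 x hx => rwa [S.ancestor_of_le hx]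
  | h1 n hn h x hx => rwa [S.ancestor_of_mem_Ioc hn hx]

theorem dist_toTree_of_le_of_mem_Ioc {n : ℕ} {a b : ℝ≥0} (ha : a ≤ S.y n)
    (hb : b ∈ Ioc (S.y n) (S.y (n + 1))) :
    dist (S.toTree a) (S.toTree b) = dist (S.toTree a) (S.toTree (S.z n)) + (b - S.y n : ℝ≥0) := by
  have hm := S.strictMono_y.monotone (Nat.le_succ n)
  simp only [toTree, UniformSpace.Completion.dist_eq, dist_toLine]
  rw [S.glueDist_eq (ha.trans hm) hb.2, stepDist, if_pos ha, if_neg (not_le.2 hb.1),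
    S.glueDist_eq ha (S.z_le n), NNReal.coe_sub hb.1.le, abs_of_nonneg]
  exact sub_nonneg.2 (NNReal.coe_le_coe.2 hb.1.le)

theorem dist_toTree_ancestor_le (K : ℕ) (x : ℝ≥0) :
    dist (S.toTree (S.ancestor K x).1) (S.toTree x) ≤ (S.ancestor K x).2 := by
  induction x using S.induction_on_sticks (K := K) with
  | h0 x hx => simp [S.ancestor_of_le hx]
  | h1 n hn h x hx =>
    rw [S.ancestor_of_mem_Ioc hn hx, S.dist_toTree_of_le_of_mem_Ioc
      ((S.ancestor_fst_le K _).trans (S.strictMono_y.monotone hn)) hx]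
    rw [NNReal.coe_add]
    exact add_le_add_left h _

/-- A larger base subtree lies closer to every point, so a height bound at one level persists at all
later levels. -/
theorem ancestor_snd_anti {K K' : ℕ} (hK : K ≤ K') (x : ℝ≥0) :
    (S.ancestor K' x).2 ≤ (S.ancestor K x).2 := by
  induction x using S.induction_on_sticks (K := K') with
  | h0 x hx => simp [S.ancestor_of_le hx]
  | h1 n hn h x hx =>
    rw [S.ancestor_of_mem_Ioc hn hx, S.ancestor_of_mem_Ioc (hK.trans hn) hx]
    exact add_le_add_left h _

theorem measurable_ancestor (K : ℕ) : Measurable (S.ancestor K) := by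
  refine measurable_of_tendsto_metrizable
    (f := fun m x => stepAncestor S.y S.z K m x) (fun m => ?_) (tendsto_pi_nhds.2 fun x => ?_)
  · exact (measurable_stepAncestor K m).comp (measurable_prodMk_left (x := (S.y, S.z)))
  · refine tendsto_const_nhds.congr' ?_
    filter_upwards [eventually_ge_atTop (S.level x x)] with m hm
    exact S.ancestor_eq ((S.level_spec x x).1.trans (S.strictMono_y.monotone (by omega)))

theorem exists_mem_Ioc {x : ℝ≥0} (hx : 0 < x) : ∃ n, x ∈ Ioc (S.y n) (S.y (n + 1)) := by
  classical
  have hex : ∃ n, x ≤ S.y n := (S.exists_le_y x x).imp fun n h => h.1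
  obtain ⟨k, hk⟩ : ∃ k, Nat.find hex = k + 1 := by
    refine Nat.exists_eq_succ_of_ne_zero fun h => hx.not_ge ?_
    have := Nat.find_spec hex
    rwa [h, S.y_zero] at this
  refine ⟨k, not_le.1 (Nat.find_min hex (by omega)), ?_⟩
  have := Nat.find_spec hex
  rwa [hk] at this

theorem eq_of_mem_Ioc {x : ℝ≥0} {n n' : ℕ} (h : x ∈ Ioc (S.y n) (S.y (n + 1)))
    (h' : x ∈ Ioc (S.y n') (S.y (n' + 1))) : n = n' := by
  have h1 := S.strictMono_y.lt_iff_lt.1 (h.1.trans_le h'.2)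
  have h2 := S.strictMono_y.lt_iff_lt.1 (h'.1.trans_le h.2)
  omega

theorem exists_mem_cell {K : ℕ} (m : ℕ) {x : ℝ≥0} (hx : x ≤ S.y K) :
    ∃ q ∈ Finset.range (K + 1) ×ˢ Finset.range (⌈S.y K * m⌉₊ + 1), x ∈ cell S.y m q.1 q.2 := by
  rcases eq_zero_or_pos x with rfl | h0
  · exact ⟨(0, 0), by simp, Or.inl ⟨rfl, rfl⟩⟩
  · obtain ⟨n, hn⟩ := S.exists_mem_Ioc h0
    refine ⟨(n + 1, ⌈x * m⌉₊), ?_, Or.inr ⟨n, rfl, hn.1, hn.2, rfl⟩⟩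
    have h1 := S.strictMono_y.lt_iff_lt.1 (hn.1.trans_le hx)
    have h2 : ⌈x * m⌉₊ ≤ ⌈S.y K * m⌉₊ := Nat.ceil_mono (by gcongr)
    simp only [Finset.mem_product, Finset.mem_range]
    omega

theorem eq_of_mem_cell {m : ℕ} {x : ℝ≥0} {q q' : ℕ × ℕ} (h : x ∈ cell S.y m q.1 q.2)
    (h' : x ∈ cell S.y m q'.1 q'.2) (h0 : x ≠ 0) : q = q' := by
  rcases h with h | ⟨n, h1, h2, h3, h4⟩
  · exact absurd h.2 h0
  rcases h' with h' | ⟨n', h1', h2', h3', h4'⟩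
  · exact absurd h'.2 h0
  have := S.eq_of_mem_Ioc ⟨h2, h3⟩ ⟨h2', h3'⟩
  ext <;> omega

/-- Two points of a cell lie on the same stick, where the tree distance is the usual one, and in one
grid interval of length `1 / m`. -/
theorem dist_toTree_le_of_mem_cell {m i j : ℕ} (hm : 0 < m) {x x' : ℝ≥0} (h : x ∈ cell S.y m i j)
    (h' : x' ∈ cell S.y m i j) : dist (S.toTree x) (S.toTree x') ≤ 1 / m := by
  have hm' : (0 : ℝ) < m := by exact_mod_cast hm
  rcases h with h | ⟨n, h1, h2, h3, h4⟩
  · rcases h' with h' | ⟨n', h1', h2', h3', h4'⟩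
    · rw [h.2, h'.2, dist_self]; positivity
    · omega
  rcases h' with h' | ⟨n', h1', h2', h3', h4'⟩
  · omega
  obtain rfl : n = n' := by omega
  rw [S.dist_toTree_of_mem_Ioc ⟨h2, h3⟩ ⟨h2', h3'⟩, le_div_iff₀ hm', NNReal.dist_eq]
  have key : ∀ u : ℝ≥0, 0 < u → ⌈u * m⌉₊ = j → (u : ℝ) * m ≤ j ∧ (j : ℝ) < u * m + 1 := by
    intro u hu h
    have h1 := Nat.le_ceil (u * m)
    have h2 := Nat.ceil_lt_add_one (zero_le (a := u * m))
    rw [h] at h1 h2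
    exact ⟨by exact_mod_cast h1, by exact_mod_cast h2⟩
  have k1 := key x (lt_of_le_of_lt zero_le h2) h4
  have k2 := key x' (lt_of_le_of_lt zero_le h2') h4'
  rw [← abs_of_pos hm', ← abs_mul, abs_le]
  constructor <;> nlinarith

end Sticks

/-! ### A criterion for weak convergence -/

/-- The normalized restrictions of `ν` to `[0, l]` concentrate, as `l → ∞`, around the finite levels
of the tree, and their projections on the finite levels converge to a limit described by `L`. -/
structure Equidistributes (S : Sticks) (ν : Measure ℝ≥0) (L : ℕ → ℕ → ℕ → ℕ → ℝ) : Prop where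
  prob : ∀ᶠ l in atTop, IsProbabilityMeasure (ν[|Icc 0 l])
  proj : ∀ K m i j, 0 < K → 0 < m →
    Tendsto (fun l => (ν[|Icc 0 l]).real {x | (S.ancestor K x).1 ∈ cell S.y m i j}) atTop
      (𝓝 (L K m i j))
  height : ∀ ε : ℝ≥0, 0 < ε → ∀ δ : ℝ, 0 < δ → ∃ K, 0 < K ∧
    ∀ᶠ l in atTop, (ν[|Icc 0 l]).real {x | ε < (S.ancestor K x).2} ≤ δ

namespace Sticks

variable (S : Sticks)

theorem normalized_eq (ν : Measure ℝ≥0) (l : ℝ≥0) :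
    S.normalized ν l = (ν[|Icc 0 l]).map S.toTree := rfl

/-- Replace `x` by a fixed representative of the cell of its ancestor. Unless `x` is higher than
`ε`, this moves it by at most `1 / m + ε`. The coefficients `c` do not depend on `ρ`, so different
measures can be compared through the same finite sum. -/
theorem exists_abs_integral_sub_sum_le {f : S.Tree → ℝ} {Lf : ℝ≥0} (hf : LipschitzWith Lf f)
    {C : ℝ} (hC : ∀ x, |f x| ≤ C) {K m : ℕ} (hm : 0 < m) :
    ∃ c : ℕ × ℕ → ℝ, ∀ (ρ : Measure ℝ≥0) [IsProbabilityMeasure ρ] (ε : ℝ≥0),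
      |(∫ x, f (S.toTree x) ∂ρ) -
        ∑ q ∈ Finset.range (K + 1) ×ˢ Finset.range (⌈S.y K * m⌉₊ + 1),
          c q * ρ.real {x | (S.ancestor K x).1 ∈ cell S.y m q.1 q.2}| ≤
      Lf * (1 / m + ε) + 2 * C * ρ.real {x | ε < (S.ancestor K x).2} := by
  classical
  have hC0 : 0 ≤ C := (abs_nonneg _).trans (hC (S.toTree 0))
  set s := Finset.range (K + 1) ×ˢ Finset.range (⌈S.y K * m⌉₊ + 1) with hs
  -- All cells with first index `0` equal `{0}`; only the one with second index `0` gets a nonzero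
  -- coefficient, so that the point `0` is counted once.
  set c : ℕ × ℕ → ℝ := fun q =>
    if h : (cell S.y m q.1 q.2).Nonempty ∧ (q.1 = 0 → q.2 = 0) then f (S.toTree h.1.some) else 0
    with hc
  refine ⟨c, fun ρ _ ε => ?_⟩
  have hcell : ∀ q : ℕ × ℕ, MeasurableSet {x | (S.ancestor K x).1 ∈ cell S.y m q.1 q.2} := by
    intro q
    have := (measurableSet_cell m q.1 q.2).preimage (measurable_prodMk_left (x := S.y))
    exact this.preimage (S.measurable_ancestor K).fst
  have hht : MeasurableSet {x | ε < (S.ancestor K x).2} :=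
    measurableSet_lt measurable_const (S.measurable_ancestor K).snd
  set g : ℝ≥0 → ℝ := fun x => ∑ q ∈ s,
    {x | (S.ancestor K x).1 ∈ cell S.y m q.1 q.2}.indicator (fun _ => c q) x with hg
  have hgi : Integrable g ρ := integrable_finsetSum _ fun q _ =>
    (integrable_const (c q)).indicator (hcell q)
  have hint : ∫ x, g x ∂ρ =
      ∑ q ∈ s, c q * ρ.real {x | (S.ancestor K x).1 ∈ cell S.y m q.1 q.2} := by
    rw [integral_finsetSum _ fun q _ => (integrable_const (c q)).indicator (hcell q)]
    refine Finset.sum_congr rfl fun q _ => ?_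
    rw [integral_indicator (hcell q), setIntegral_const, smul_eq_mul, mul_comm]
  have hfi : Integrable (fun x => f (S.toTree x)) ρ :=
    Integrable.of_bound (hf.continuous.measurable.comp S.measurable_toTree).aestronglyMeasurable C
      (ae_of_all _ fun x => hC _)
  have hpt : ∀ x, ∃ u, g x = f (S.toTree u) ∧
      dist (S.toTree u) (S.toTree (S.ancestor K x).1) ≤ 1 / m := by
    intro x
    by_cases h0 : (S.ancestor K x).1 = 0
    · have hmem : (0 : ℝ≥0) ∈ cell S.y m 0 0 := Or.inl ⟨rfl, rfl⟩
      have hne : (cell S.y m 0 0).Nonempty := ⟨_, hmem⟩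
      have : g x = c (0, 0) := by
        rw [hg]
        simp only
        rw [Finset.sum_eq_single (0, 0)]
        · rw [indicator_of_mem]
          simpa [h0] using hmem
        · rintro ⟨i, j⟩ hq hne
          by_cases hi : i = 0
          · have hj : j ≠ 0 := fun hj => hne (by rw [hi, hj])
            have : c (i, j) = 0 := by simp [hc, hi, hj]
            simp [this]
          · rw [indicator_of_notMem]
            rw [mem_ofPred_eq, h0]
            rintro (h | ⟨n, h1, h2, h3⟩)
            · exact hi h.1
            · exact not_lt_zero h2
        · intro h; simp [hs] at h
      refine ⟨hne.some, ?_, ?_⟩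
      · rw [this]
        simp [hc, hne]
      · rw [h0]
        exact S.dist_toTree_le_of_mem_cell hm hne.some_mem hmem
    · obtain ⟨q, hq, hx⟩ := S.exists_mem_cell m (S.ancestor_fst_le K x)
      have hne : (cell S.y m q.1 q.2).Nonempty := ⟨_, hx⟩
      have h10 : q.1 ≠ 0 := by
        rcases hx with h | ⟨n, h1, -⟩
        · exact absurd h.2 h0
        · omega
      refine ⟨hne.some, ?_, S.dist_toTree_le_of_mem_cell hm hne.some_mem hx⟩
      rw [hg]
      simp only
      rw [Finset.sum_eq_single q]
      · rw [indicator_of_mem (by exact hx)]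
        simp [hc, hne, h10]
      · intro q' hq' hne'
        rw [indicator_of_notMem]
        exact fun h => hne' (S.eq_of_mem_cell h hx h0)
      · exact fun h => absurd hq h
  have hpw : ∀ x, |f (S.toTree x) - g x| ≤ Lf * (1 / m + ε) +
      {x | ε < (S.ancestor K x).2}.indicator (fun _ => 2 * C) x := by
    intro x
    obtain ⟨u, hu, hd⟩ := hpt x
    rw [hu]
    by_cases h : ε < (S.ancestor K x).2
    · rw [indicator_of_mem (by exact h)]
      have h1 := abs_sub (f (S.toTree x)) (f (S.toTree u))
      have := hC (S.toTree x)
      have := hC (S.toTree u)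
      have : 0 ≤ (Lf : ℝ) * (1 / m + ε) := by positivity
      linarith
    · rw [indicator_of_notMem (by exact h), add_zero, ← Real.dist_eq]
      refine (hf.dist_le_mul _ _).trans ?_
      gcongr
      rw [dist_comm]
      refine (dist_triangle _ _ _).trans (add_le_add hd ?_)
      exact (S.dist_toTree_ancestor_le K x).trans (NNReal.coe_le_coe.2 (not_lt.1 h))
  rw [← hint, ← integral_sub hfi hgi]
  refine (abs_integral_le_integral_abs).trans ?_
  have hi2 : Integrable (fun x => Lf * (1 / m + ε) +
      {x | ε < (S.ancestor K x).2}.indicator (fun _ => 2 * C) x : ℝ≥0 → ℝ) ρ :=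
    (integrable_const _).add ((integrable_const _).indicator hht)
  refine (integral_mono (hfi.sub hgi).abs hi2 hpw).trans_eq ?_
  rw [integral_add (integrable_const _) ((integrable_const _).indicator hht),
    integral_indicator hht, setIntegral_const, smul_eq_mul]
  simp [mul_comm]

end Sticks

/-! ### Comparison of integrals, tightness and existence of the limit. -/

namespace Equidistributes

variable {S : Sticks} {μ ν : Measure ℝ≥0} {L : ℕ → ℕ → ℕ → ℕ → ℝ}

theorem integral_normalized (f : S.Tree → ℝ) (hf : Continuous f) (l : ℝ≥0) :
    ∫ x, f x ∂(S.normalized ν l) = ∫ x, f (S.toTree x) ∂(ν[|Icc 0 l]) := by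
  rw [S.normalized_eq, integral_map S.measurable_toTree.aemeasurable
    hf.measurable.aestronglyMeasurable]

/-- Both integrals are close to the same combination of the limits `L`. The two times vary
separately, so taking `ν = μ` yields the Cauchy property. -/
theorem tendsto_integral_sub (hμ : Equidistributes S μ L) (hν : Equidistributes S ν L)
    {f : S.Tree → ℝ} {Lf : ℝ≥0} (hf : LipschitzWith Lf f) {C : ℝ} (hC : ∀ x, |f x| ≤ C) :
    Tendsto (fun q : ℝ≥0 × ℝ≥0 => (∫ x, f x ∂(S.normalized μ q.1)) -
      ∫ x, f x ∂(S.normalized ν q.2)) (atTop ×ˢ atTop) (𝓝 0) := by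
  have hC0 : 0 ≤ C := (abs_nonneg _).trans (hC (S.toTree 0))
  rw [Metric.tendsto_nhds]
  intro η hη
  obtain ⟨m, hm, hm'⟩ : ∃ m : ℕ, 0 < m ∧ (Lf : ℝ) * (1 / m) < η / 10 := by
    obtain ⟨m, hm⟩ := exists_nat_gt (Lf / (η / 10))
    have hm0 : (0 : ℝ) < m := lt_of_le_of_lt (by positivity) hm
    refine ⟨m, by exact_mod_cast hm0, ?_⟩
    rw [mul_one_div, div_lt_comm₀ hm0 (by positivity)]
    exact hm
  set ε : ℝ≥0 := 1 / m with hε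
  have hε0 : 0 < ε := by rw [hε]; positivity
  -- Each integral incurs at most `η / 5` from `Lf * (1 / m + ε)`, `η / 10` from the high points and
  -- `η / 10` from the cell proportions, hence less than `η / 2` in total.
  have hδ : (0 : ℝ) < η / (20 * (C + 1)) := by positivity
  obtain ⟨K₁, hK₁, h₁⟩ := hμ.height ε hε0 _ hδ
  obtain ⟨K₂, hK₂, h₂⟩ := hν.height ε hε0 _ hδ
  set K := max K₁ K₂ with hK
  obtain ⟨c, hc⟩ := S.exists_abs_integral_sub_sum_le hf hC (K := K) hm
  set s := Finset.range (K + 1) ×ˢ Finset.range (⌈S.y K * m⌉₊ + 1)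
  have hsum : ∀ {ν}, Equidistributes S ν L → Tendsto (fun l => ∑ q ∈ s, c q *
      (ν[|Icc 0 l]).real {x | (S.ancestor K x).1 ∈ cell S.y m q.1 q.2}) atTop
      (𝓝 (∑ q ∈ s, c q * L K m q.1 q.2)) := fun hν =>
    tendsto_finsetSum _ fun q _ =>
        (hν.proj K m q.1 q.2 (hK₁.trans_le (le_max_left _ _)) hm).const_mul _
  have hone : ∀ {ν} {K'}, Equidistributes S ν L → K' ≤ K →
      (∀ᶠ l in atTop, (ν[|Icc 0 l]).real {x | ε < (S.ancestor K' x).2} ≤ η / (20 * (C + 1))) →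
      ∀ᶠ l in atTop, |(∫ x, f x ∂(S.normalized ν l)) - ∑ q ∈ s, c q * L K m q.1 q.2| < η / 2 := by
    intro ν K' hν hK' h
    filter_upwards [h, hν.prob, Metric.tendsto_nhds.1 (hsum hν) (η / 10) (by positivity)]
      with l h1 h2 h3
    have h4 := hc (ν[|Icc 0 l]) ε
    have h5 : (ν[|Icc 0 l]).real {x | ε < (S.ancestor K x).2} ≤ η / (20 * (C + 1)) :=
      (measureReal_mono fun x hx => lt_of_lt_of_le hx (S.ancestor_snd_anti hK' x)).trans h1
    rw [integral_normalized f hf.continuous]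
    have h6 : 2 * C * (ν[|Icc 0 l]).real {x | ε < (S.ancestor K x).2} ≤ η / 10 := by
      refine (mul_le_mul_of_nonneg_left h5 (by positivity)).trans ?_
      rw [mul_div_assoc', div_le_div_iff₀ (by positivity) (by positivity)]
      nlinarith
    have h7 : (Lf : ℝ) * (1 / m + ε) ≤ η / 5 := by
      have : (ε : ℝ) = 1 / m := by simp [hε]
      rw [this, mul_add]; linarith
    rw [Real.dist_eq] at h3
    rw [abs_lt] at h3 ⊢
    have h8 := abs_le.1 (h4.trans (add_le_add h7 h6))
    constructor <;> linarith [h8.1, h8.2, h3.1, h3.2]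
  filter_upwards [(hone hμ (le_max_left _ _) h₁).prod_mk (hone hν (le_max_right _ _) h₂)]
    with q hq
  rw [Real.dist_eq, sub_zero, abs_lt]
  have h1 := abs_lt.1 hq.1
  have h2 := abs_lt.1 hq.2
  constructor <;> linarith [h1.1, h1.2, h2.1, h2.2]

theorem isProbabilityMeasure_normalized (h : Equidistributes S ν L) :
    ∀ᶠ l in atTop, IsProbabilityMeasure (S.normalized ν l) := by
  filter_upwards [h.prob] with l hl
  rw [S.normalized_eq]
  exact Measure.isProbabilityMeasure_map S.measurable_toTree.aemeasurable

/-- Bounded Lipschitz functions determine weak convergence of probability measures. -/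
theorem convergesWeakly_of_lipschitz (h : Equidistributes S ν L) {p : ProbabilityMeasure S.Tree}
    (hp : ∀ (f : S.Tree → ℝ) (Lf : ℝ≥0) (C : ℝ), LipschitzWith Lf f → (∀ x, |f x| ≤ C) →
      Tendsto (fun l => ∫ x, f x ∂(S.normalized ν l)) atTop (𝓝 (∫ x, f x ∂(p : Measure S.Tree)))) :
    ConvergesWeakly (S.normalized ν) p := by
  classical
  have hprob := h.isProbabilityMeasure_normalized
  refine ⟨hprob, fun f => ?_⟩
  -- The value `p` at the times when the normalized measure is not a probability measure is
  -- arbitrary; there are none for large `l`.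
  set q : ℝ≥0 → ProbabilityMeasure S.Tree := fun l =>
    if hl : IsProbabilityMeasure (S.normalized ν l) then ⟨S.normalized ν l, hl⟩ else p with hq
  have hqe : ∀ᶠ l in atTop, (q l : Measure S.Tree) = S.normalized ν l := by
    filter_upwards [hprob] with l hl
    simp [hq, hl]
  have hlim : Tendsto q atTop (𝓝 p) := by
    rw [tendsto_iff_forall_lipschitz_integral_tendsto]
    rintro g ⟨C, hC⟩ ⟨Lf, hLf⟩
    refine (hp g Lf (C + |g (S.toTree 0)|) hLf fun x => ?_).congr' ?_
    · have h1 := hC x (S.toTree 0)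
      rw [Real.dist_eq] at h1
      have h2 := abs_sub_abs_le_abs_sub (g x) (g (S.toTree 0))
      linarith
    · filter_upwards [hqe] with l hl
      rw [hl]
  refine ((ProbabilityMeasure.tendsto_iff_forall_integral_tendsto.1 hlim) f).congr' ?_
  filter_upwards [hqe] with l hl
  rw [hl]

theorem convergesWeakly_of_convergesWeakly (hμ : Equidistributes S μ L)
    (hν : Equidistributes S ν L) {p : ProbabilityMeasure S.Tree}
    (hp : ConvergesWeakly (S.normalized μ) p) : ConvergesWeakly (S.normalized ν) p := by
  refine hν.convergesWeakly_of_lipschitz fun f Lf C hf hC => ?_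
  have h1 := (hμ.tendsto_integral_sub hν hf hC).comp (tendsto_id.prodMk tendsto_id)
  have h2 := hp.2 (BoundedContinuousFunction.ofNormedAddCommGroup f hf.continuous C hC)
  have h3 := h2.sub h1
  simpa using h3

/-- The closed `ε`-neighbourhood of the subtree `[0, R]`. -/
def neighborhood (S : Sticks) (R : ℝ≥0) (ε : ℝ) : Set S.Tree :=
  {x | Metric.infDist x (S.toTree '' Iic R) ≤ ε}

theorem isClosed_neighborhood (R : ℝ≥0) (ε : ℝ) : IsClosed (neighborhood S R ε) :=
  isClosed_le (Metric.continuous_infDist_pt _) continuous_const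

theorem exists_measure_compl_neighborhood_le (h : Equidistributes S ν L) {ε : ℝ≥0} (hε : 0 < ε)
    {δ : ℝ≥0} (hδ : 0 < δ) :
    ∃ R, ∀ l, IsProbabilityMeasure (ν[|Icc 0 l]) →
      S.normalized ν l (neighborhood S R ε)ᶜ ≤ δ := by
  obtain ⟨K, hK, hKl⟩ := h.height ε hε δ hδ
  obtain ⟨l₀, hl₀⟩ := eventually_atTop.1 hKl
  -- For `l ≤ l₀` the measure is carried by the image of `[0, l₀]`; for larger `l` the height bound
  -- above `[0, y K]` applies. The radius covers both cases.
  refine ⟨max l₀ (S.y K), fun l hl => ?_⟩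
  rw [S.normalized_eq, Measure.map_apply S.measurable_toTree
    (isClosed_neighborhood _ _).measurableSet.compl]
  rcases le_total l l₀ with hll | hll
  · refine le_trans (le_of_eq ?_) zero_le
    have : S.toTree ⁻¹' (neighborhood S (max l₀ (S.y K)) ε)ᶜ ⊆ (Icc 0 l)ᶜ := by
      intro x hx hxl
      refine hx ?_
      rw [neighborhood, mem_ofPred_eq, Metric.infDist_zero_of_mem]
      · exact ε.2
      · exact mem_image_of_mem _ (hxl.2.trans (hll.trans (le_max_left _ _)))
    refine measure_mono_null this ?_
    rw [cond_apply measurableSet_Icc, inter_compl_self, measure_empty, mul_zero]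
  · have h1 := hl₀ l hll
    rw [← ENNReal.ofReal_coe_nnreal, ← ENNReal.toReal_le_toReal (measure_ne_top _ _)
      ENNReal.ofReal_ne_top, ENNReal.toReal_ofReal (NNReal.coe_nonneg δ)]
    refine le_trans (measureReal_mono fun x hx => ?_) h1
    rw [mem_ofPred_eq]
    by_contra hlt
    refine hx ?_
    rw [neighborhood, mem_ofPred_eq]
    have hmem : S.toTree (S.ancestor K x).1 ∈ S.toTree '' Iic (max l₀ (S.y K)) :=
      mem_image_of_mem _ ((S.ancestor_fst_le K x).trans (le_max_right _ _))
    refine (Metric.infDist_le_dist_of_mem hmem).trans ?_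
    rw [dist_comm]
    exact (S.dist_toTree_ancestor_le K x).trans (NNReal.coe_le_coe.2 (not_lt.1 hlt))

/-- Finitely many cells of mesh `1 / m` cover it, and each has diameter at most `1 / m`. -/
theorem totallyBounded_image_Iic (R : ℝ≥0) : TotallyBounded (S.toTree '' Iic R) := by
  classical
  rw [Metric.totallyBounded_iff]
  intro ε hε
  obtain ⟨m, hm⟩ := exists_nat_gt (1 / ε)
  have hm0 : (0 : ℝ) < m := lt_trans (by positivity) hm
  obtain ⟨K, hK, -⟩ := S.exists_le_y R R
  set s := Finset.range (K + 1) ×ˢ Finset.range (⌈S.y K * m⌉₊ + 1)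
  refine ⟨(fun q : ℕ × ℕ => if h : (cell S.y m q.1 q.2).Nonempty then S.toTree h.some
    else S.toTree 0) '' s, s.finite_toSet.image _, ?_⟩
  rintro _ ⟨x, hx, rfl⟩
  obtain ⟨q, hq, hxq⟩ := S.exists_mem_cell m (le_trans hx hK)
  have hne : (cell S.y m q.1 q.2).Nonempty := ⟨_, hxq⟩
  refine mem_iUnion₂.2 ⟨_, mem_image_of_mem _ hq, ?_⟩
  rw [dif_pos hne, Metric.mem_ball]
  refine (S.dist_toTree_le_of_mem_cell (by exact_mod_cast hm0) hxq hne.some_mem).trans_lt ?_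
  rwa [one_div_lt hm0 hε]

/-- At each scale, a finite net of one totally bounded `[0, R n]` is also a net of its
neighbourhood, with a slightly larger radius. -/
theorem totallyBounded_iInter_neighborhood (R : ℕ → ℝ≥0) :
    TotallyBounded (⋂ n : ℕ, neighborhood S (R n) ((1 / (n + 1) : ℝ≥0) : ℝ)) := by
  rw [Metric.totallyBounded_iff]
  intro ε hε
  obtain ⟨n, hn⟩ := exists_nat_one_div_lt (half_pos (half_pos hε))
  obtain ⟨t, ht, hcov⟩ := Metric.totallyBounded_iff.1 (totallyBounded_image_Iic (S := S) (R n))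
    (ε / 2) (half_pos hε)
  refine ⟨t, ht, fun x hx => ?_⟩
  have h1 : Metric.infDist x (S.toTree '' Iic (R n)) < ε / 2 := by
    have h2 := mem_iInter.1 hx n
    rw [neighborhood, mem_ofPred_eq] at h2
    push_cast at h2
    linarith
  obtain ⟨u, hu, hxu⟩ := (Metric.infDist_lt_iff
      ⟨S.toTree 0, mem_image_of_mem S.toTree (mem_Iic.2 zero_le)⟩).1 h1
  obtain ⟨v, hv, huv⟩ := mem_iUnion₂.1 (hcov hu)
  refine mem_iUnion₂.2 ⟨v, hv, ?_⟩
  rw [Metric.mem_ball] at huv ⊢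
  linarith [dist_triangle x u v]

/-- The intersection of closed neighbourhoods with shrinking radii is closed and totally bounded,
hence compact in the complete tree. The missing masses are chosen with total below `ε`. -/
theorem isTightMeasureSet_normalized (h : Equidistributes S ν L) :
    IsTightMeasureSet {ρ | ∃ l, IsProbabilityMeasure (ν[|Icc 0 l]) ∧ S.normalized ν l = ρ} := by
  rw [isTightMeasureSet_iff_exists_isCompact_measure_compl_le]
  intro ε hε
  obtain ⟨δ, hδ, hδε⟩ := ENNReal.exists_pos_sum_of_countable hε.ne' ℕ
  choose R hR using fun n : ℕ => h.exists_measure_compl_neighborhood_le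
    (ε := 1 / (n + 1)) (by positivity) (hδ n)
  refine ⟨⋂ n : ℕ, neighborhood S (R n) ((1 / (n + 1) : ℝ≥0) : ℝ), ?_, ?_⟩
  · exact (totallyBounded_iInter_neighborhood R).isCompact_of_isClosed
      (isClosed_iInter fun n => isClosed_neighborhood _ _)
  · rintro _ ⟨l, hl, rfl⟩
    rw [compl_iInter]
    refine (measure_iUnion_le _).trans (le_trans (ENNReal.tsum_le_tsum fun k => ?_) hδε.le)
    exact hR k _ hl

theorem exists_tendsto_integral (h : Equidistributes S ν L) {f : S.Tree → ℝ} {Lf : ℝ≥0}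
    (hf : LipschitzWith Lf f) {C : ℝ} (hC : ∀ x, |f x| ≤ C) :
    ∃ a, Tendsto (fun l => ∫ x, f x ∂(S.normalized ν l)) atTop (𝓝 a) := by
  have hcau : Cauchy (map (fun l => ∫ x, f x ∂(S.normalized ν l)) atTop) := by
    refine cauchy_map_iff.2 ⟨inferInstance, ?_⟩
    rw [Metric.uniformity_eq_comap_nhds_zero, tendsto_comap_iff]
    have := (h.tendsto_integral_sub h hf hC).abs
    simpa only [Function.comp_def, Real.dist_eq, abs_zero] using this
  exact CompleteSpace.complete hcau

/-- Prokhorov's theorem gives a cluster point along the times `l₀ + n`. Since the integrals of each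
bounded Lipschitz function converge as `l → ∞`, their limits must be the integrals against this
cluster point. -/
theorem exists_convergesWeakly (h : Equidistributes S ν L) :
    ∃ p : ProbabilityMeasure S.Tree, ConvergesWeakly (S.normalized ν) p := by
  obtain ⟨l₀, hl₀⟩ := eventually_atTop.1 h.prob
  have hpr : ∀ n : ℕ, IsProbabilityMeasure (S.normalized ν (l₀ + n)) := fun n => by
    have := hl₀ (l₀ + n) le_self_add
    rw [S.normalized_eq]
    exact Measure.isProbabilityMeasure_map S.measurable_toTree.aemeasurable
  let q : ℕ → ProbabilityMeasure S.Tree := fun n => ⟨S.normalized ν (l₀ + n), hpr n⟩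
  have htight : IsTightMeasureSet
      {((ρ : ProbabilityMeasure S.Tree) : Measure S.Tree) | ρ ∈ range q} := by
    refine h.isTightMeasureSet_normalized.subset ?_
    rintro _ ⟨_, ⟨n, rfl⟩, rfl⟩
    exact ⟨l₀ + n, hl₀ _ le_self_add, rfl⟩
  have hcomp := isCompact_closure_of_isTightMeasureSet htight
  obtain ⟨p, -, hp⟩ := hcomp.exists_mapClusterPt (f := atTop) (u := q)
    (le_principal_iff.2 (mem_map.2 (Eventually.of_forall fun n => subset_closure (mem_range_self n))))
  refine ⟨p, h.convergesWeakly_of_lipschitz fun f Lf C hf hC => ?_⟩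
  obtain ⟨a, ha⟩ := h.exists_tendsto_integral hf hC
  have hseq : Tendsto (fun n : ℕ => l₀ + (n : ℝ≥0)) atTop atTop :=
    tendsto_atTop_mono (fun n => le_add_self) tendsto_natCast_atTop_atTop
  have h1 : Tendsto (fun n : ℕ => ∫ x, f x ∂(S.normalized ν (l₀ + n))) atTop (𝓝 a) := ha.comp hseq
  let f' : S.Tree →ᵇ ℝ := BoundedContinuousFunction.ofNormedAddCommGroup f hf.continuous C hC
  have hcont : Continuous fun ρ : ProbabilityMeasure S.Tree => ∫ x, f' x ∂(ρ : Measure S.Tree) :=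
    ProbabilityMeasure.continuous_integral_boundedContinuousFunction f'
  have h2 : MapClusterPt (∫ x, f' x ∂(p : Measure S.Tree)) atTop
      (fun n : ℕ => ∫ x, f x ∂(S.normalized ν (l₀ + n))) :=
    MapClusterPt.continuousAt_comp hcont.continuousAt hp
  have h3 : ∫ x, f' x ∂(p : Measure S.Tree) = a := eq_of_nhds_neBot (ClusterPt.mono h2 h1)
  have h4 : ∫ x, f x ∂(p : Measure S.Tree) = a := h3
  rwa [h4]

end Equidistributes

end ICRT

namespace ICRT

namespace Sticks

variable (S : Sticks)

/-! ### From the cuts to all times -/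

/-- The set `A` is an upper set within each of the sticks of index at least `K`. -/
def IsUpperOnSticks (K : ℕ) (A : Set ℝ≥0) : Prop :=
  ∀ n, K ≤ n → ∀ x ∈ Ioc (S.y n) (S.y (n + 1)), ∀ x' ∈ Ioc (S.y n) (S.y (n + 1)),
    x ≤ x' → x ∈ A → x' ∈ A

theorem cond_real (ν : Measure ℝ≥0) (l : ℝ≥0) (A : Set ℝ≥0) :
    (ν[|Icc 0 l]).real A = ν.real (Icc 0 l ∩ A) / ν.real (Icc 0 l) := by
  rw [measureReal_def, cond_apply measurableSet_Icc, ENNReal.toReal_mul, ENNReal.toReal_inv,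
    div_eq_inv_mul]
  rfl

variable {S} {ν : Measure ℝ≥0}

/-- If `A` has a point of the stick before `l`, all that follows `l` on the stick lies in `A`, so
completing the stick can only increase the proportion. Otherwise the stick has not contributed to
`A` up to `l`, and the proportion has not increased since `y n`. -/
theorem cond_real_le_max {K n : ℕ} (hn : K ≤ n) (hfin : ∀ l, ν (Icc 0 l) ≠ ∞)
    (hpos : ν (Icc 0 (S.y n)) ≠ 0) {A : Set ℝ≥0} (hA : MeasurableSet A)
    (hup : S.IsUpperOnSticks K A) {l : ℝ≥0} (h1 : S.y n ≤ l) (h2 : l ≤ S.y (n + 1)) :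
    (ν[|Icc 0 l]).real A ≤
      max ((ν[|Icc 0 (S.y n)]).real A) ((ν[|Icc 0 (S.y (n + 1))]).real A) := by
  have hmono : ∀ {a b : ℝ≥0}, a ≤ b → ν.real (Icc 0 a) ≤ ν.real (Icc 0 b) := fun hab =>
    measureReal_mono (Icc_subset_Icc_right hab) (hfin _)
  have hp : 0 < ν.real (Icc 0 (S.y n)) := ENNReal.toReal_pos hpos (hfin _)
  have hpl := hp.trans_le (hmono h1)
  have hpn := hpl.trans_le (hmono h2)
  rw [le_max_iff]
  by_cases hx : ∃ x ∈ A, S.y n < x ∧ x ≤ l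
  · right
    obtain ⟨x, hxA, hx1, hx2⟩ := hx
    have hsub : Icc 0 (S.y (n + 1)) ∩ Aᶜ ⊆ Icc 0 l ∩ Aᶜ := by
      rintro u ⟨⟨hu0, hu⟩, huA⟩
      refine ⟨⟨hu0, ?_⟩, huA⟩
      by_contra hul
      push Not at hul
      exact huA (hup n hn x ⟨hx1, hx2.trans h2⟩ u ⟨hx1.trans (hx2.trans_lt hul), hu⟩
        (hx2.trans hul.le) hxA)
    have hc : ∀ l', ν.real (Icc 0 l' ∩ A) + ν.real (Icc 0 l' ∩ Aᶜ) = ν.real (Icc 0 l') := by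
      intro l'
      rw [← measureReal_inter_add_sdiff (s := Icc 0 l') hA (hfin l')]
      rfl
    have h3 : ν.real (Icc 0 (S.y (n + 1)) ∩ Aᶜ) ≤ ν.real (Icc 0 l ∩ Aᶜ) :=
      measureReal_mono hsub ((measure_mono inter_subset_left).trans_lt (hfin l).lt_top).ne
    rw [cond_real, cond_real, div_le_div_iff₀ hpl hpn]
    have h4 := hc l
    have h5 := hc (S.y (n + 1))
    have h6 := hmono h2
    have h7 : 0 ≤ ν.real (Icc 0 (S.y (n + 1)) ∩ Aᶜ) := measureReal_nonneg
    rw [← eq_sub_iff_add_eq] at h4 h5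
    rw [h4, h5]
    nlinarith
  · left
    push Not at hx
    have hsub : Icc 0 l ∩ A ⊆ Icc 0 (S.y n) ∩ A := by
      rintro u ⟨⟨hu0, hu⟩, huA⟩
      refine ⟨⟨hu0, ?_⟩, huA⟩
      by_contra hul
      push Not at hul
      exact (hx u huA hul).not_ge hu
    have h3 : ν.real (Icc 0 l ∩ A) ≤ ν.real (Icc 0 (S.y n) ∩ A) :=
      measureReal_mono hsub ((measure_mono inter_subset_left).trans_lt (hfin _).lt_top).ne
    rw [cond_real, cond_real]
    exact div_le_div₀ measureReal_nonneg h3 hp (hmono h1)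

theorem eventually_exists_mem_Icc (N : ℕ) :
    ∀ᶠ l in atTop, ∃ n, N ≤ n ∧ S.y n ≤ l ∧ l ≤ S.y (n + 1) := by
  filter_upwards [eventually_gt_atTop (S.y N)] with l hl
  obtain ⟨n, hn⟩ := S.exists_mem_Ioc (lt_of_le_of_lt zero_le hl)
  refine ⟨n, ?_, hn.1.le, hn.2⟩
  have := S.strictMono_y.lt_iff_lt.1 (hl.trans_le hn.2)
  omega

theorem eventually_cond_real_lt (hfin : ∀ l, ν (Icc 0 l) ≠ ∞)
    (hpos : ∀ᶠ n in atTop, ν (Icc 0 (S.y n)) ≠ 0) {K : ℕ} {A : Set ℝ≥0} (hA : MeasurableSet A)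
    (hup : S.IsUpperOnSticks K A) {c : ℝ}
    (hc : ∀ᶠ n in atTop, (ν[|Icc 0 (S.y n)]).real A < c) :
    ∀ᶠ l in atTop, (ν[|Icc 0 l]).real A < c := by
  obtain ⟨N, hN⟩ := eventually_atTop.1 (hpos.and hc)
  filter_upwards [S.eventually_exists_mem_Icc (max N K)] with l ⟨n, hn, h1, h2⟩
  have hNn := (le_max_left _ _).trans hn
  exact (cond_real_le_max ((le_max_right _ _).trans hn) hfin (hN n hNn).1 hA hup h1 h2).trans_lt
    (max_lt (hN n hNn).2 (hN (n + 1) (by omega)).2)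

/-- The upper estimate for `A` and the one for its complement give the two halves of the limit. -/
theorem tendsto_cond_real (hfin : ∀ l, ν (Icc 0 l) ≠ ∞)
    (hpos : ∀ᶠ n in atTop, ν (Icc 0 (S.y n)) ≠ 0) {K : ℕ} {A : Set ℝ≥0} (hA : MeasurableSet A)
    (hup : S.IsUpperOnSticks K A) (hup' : S.IsUpperOnSticks K Aᶜ) {a : ℝ}
    (ha : Tendsto (fun n => (ν[|Icc 0 (S.y n)]).real A) atTop (𝓝 a)) :
    Tendsto (fun l => (ν[|Icc 0 l]).real A) atTop (𝓝 a) := by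
  have hcompl : ∀ l, ν (Icc 0 l) ≠ 0 → (ν[|Icc 0 l]).real Aᶜ = 1 - (ν[|Icc 0 l]).real A := by
    intro l hl
    have := cond_isProbabilityMeasure_of_finite hl (hfin l)
    exact probReal_compl_eq_one_sub hA
  refine tendsto_order.2 ⟨fun c hc => ?_, fun c hc => ?_⟩
  · have h1 := eventually_cond_real_lt hfin hpos hA.compl hup' (c := 1 - c) (by
      filter_upwards [ha.eventually_const_lt hc, hpos] with n h1 h2
      rw [hcompl _ h2]; linarith)
    obtain ⟨N, hN⟩ := eventually_atTop.1 hpos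
    filter_upwards [h1, eventually_ge_atTop (S.y N)] with l hl hlN
    rw [hcompl] at hl
    · linarith
    · exact fun h0 => hN N le_rfl (measure_mono_null (Icc_subset_Icc_right hlN) h0)
  · exact eventually_cond_real_lt hfin hpos hA hup (ha.eventually_lt_const hc)

/-- The points whose projection on `[0, y K]` falls in a given cell. -/
def projSet (S : Sticks) (K m i j : ℕ) : Set ℝ≥0 := {x | (S.ancestor K x).1 ∈ cell S.y m i j}

/-- The points at height more than `ε` above `[0, y K]`. -/
def heightSet (S : Sticks) (K : ℕ) (ε : ℝ≥0) : Set ℝ≥0 := {x | ε < (S.ancestor K x).2}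

theorem measurableSet_projSet (K m i j : ℕ) : MeasurableSet (S.projSet K m i j) :=
  ((measurableSet_cell m i j).preimage (measurable_prodMk_left (x := S.y))).preimage
    (S.measurable_ancestor K).fst

theorem measurableSet_heightSet (K : ℕ) (ε : ℝ≥0) : MeasurableSet (S.heightSet K ε) :=
  measurableSet_lt measurable_const (S.measurable_ancestor K).snd

theorem mem_projSet_iff {K m i j n : ℕ} (hn : K ≤ n) {x : ℝ≥0}
    (hx : x ∈ Ioc (S.y n) (S.y (n + 1))) : x ∈ S.projSet K m i j ↔ S.z n ∈ S.projSet K m i j := by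
  simp only [projSet, mem_ofPred_eq, S.ancestor_of_mem_Ioc hn hx]

theorem isUpperOnSticks_projSet (K m i j : ℕ) : S.IsUpperOnSticks K (S.projSet K m i j) :=
  fun n hn x hx x' hx' _ h => by
    rw [mem_projSet_iff hn hx']
    rwa [mem_projSet_iff hn hx] at h

theorem isUpperOnSticks_compl_projSet (K m i j : ℕ) :
    S.IsUpperOnSticks K (S.projSet K m i j)ᶜ :=
  fun n hn x hx x' hx' _ h => by
    rw [mem_compl_iff, mem_projSet_iff hn hx']
    rwa [mem_compl_iff, mem_projSet_iff hn hx] at h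

theorem isUpperOnSticks_heightSet (K : ℕ) (ε : ℝ≥0) : S.IsUpperOnSticks K (S.heightSet K ε) := by
  intro n hn x hx x' hx' hle h
  simp only [heightSet, mem_ofPred_eq, S.ancestor_of_mem_Ioc hn hx'] at h ⊢
  simp only [S.ancestor_of_mem_Ioc hn hx] at h
  refine h.trans_le ?_
  gcongr

theorem heightSet_subset (K : ℕ) {ε ε' : ℝ≥0} (h : ε ≤ ε') :
    S.heightSet K ε' ⊆ S.heightSet K ε := fun _ hx => lt_of_le_of_lt h hx

end Sticks

/-- `projSet` is constant on each stick, so its limit passes from cuts to all times. `heightSet` is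
only upward closed on sticks, which suffices for an upper bound. -/
theorem Equidistributes.of_cuts {S : Sticks} {ν : Measure ℝ≥0} {L : ℕ → ℕ → ℕ → ℕ → ℝ}
    (hfin : ∀ l, ν (Icc 0 l) ≠ ∞) (hpos : ∀ᶠ n in atTop, ν (Icc 0 (S.y n)) ≠ 0)
    (hproj : ∀ K m i j, 0 < K → 0 < m →
      Tendsto (fun n => (ν[|Icc 0 (S.y n)]).real (S.projSet K m i j)) atTop (𝓝 (L K m i j)))
    (hheight : ∀ ε : ℝ≥0, 0 < ε → ∀ δ : ℝ, 0 < δ → ∃ K, 0 < K ∧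
      ∀ᶠ n in atTop, (ν[|Icc 0 (S.y n)]).real (S.heightSet K ε) < δ) :
    Equidistributes S ν L where
  prob := by
    obtain ⟨N, hN⟩ := eventually_atTop.1 hpos
    filter_upwards [eventually_ge_atTop (S.y N)] with l hl
    exact cond_isProbabilityMeasure_of_finite (fun h0 => hN N le_rfl
      (measure_mono_null (Icc_subset_Icc_right hl) h0)) (hfin l)
  proj K m i j hK hm := Sticks.tendsto_cond_real hfin hpos (Sticks.measurableSet_projSet K m i j)
    (Sticks.isUpperOnSticks_projSet K m i j) (Sticks.isUpperOnSticks_compl_projSet K m i j)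
    (hproj K m i j hK hm)
  height ε hε δ hδ := by
    obtain ⟨K, hK, h⟩ := hheight ε hε δ hδ
    refine ⟨K, hK, ?_⟩
    filter_upwards [Sticks.eventually_cond_real_lt hfin hpos (Sticks.measurableSet_heightSet K ε)
      (Sticks.isUpperOnSticks_heightSet K ε) h] with l hl
    exact hl.le

/-! ### Transfer from the mass measure to other measures -/

namespace Sticks

variable {S : Sticks} {μ ν : Measure ℝ≥0}

/-- The law of large numbers for the proportion of `ν`-mass of the sticks that are glued at
points of `A`. -/
def GluingLLN (S : Sticks) (μ ν : Measure ℝ≥0) (K : ℕ) (A : Set ℝ≥0) : Prop :=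
  Tendsto (fun n => (∑ i ∈ Finset.range n, ν.real (Ioc (S.y (K + i)) (S.y (K + i + 1))) *
    (A.indicator 1 (S.z (K + i)) - (μ[|Icc 0 (S.y (K + i))]).real A)) /
      ν.real (Icc 0 (S.y (K + n)))) atTop (𝓝 0)

theorem measure_Ioc_ne_top (hfin : ∀ l, ν (Icc 0 l) ≠ ∞) (a b : ℝ≥0) : ν (Ioc a b) ≠ ∞ :=
  measure_ne_top_of_subset (Ioc_subset_Icc_self.trans (Icc_subset_Icc_left zero_le)) (hfin b)

theorem real_Icc_succ (hfin : ∀ l, ν (Icc 0 l) ≠ ∞) (n : ℕ) :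
    ν.real (Icc 0 (S.y (n + 1))) =
      ν.real (Icc 0 (S.y n)) + ν.real (Ioc (S.y n) (S.y (n + 1))) := by
  have hm := S.strictMono_y.monotone (Nat.le_succ n)
  have hd : Disjoint (Icc 0 (S.y n)) (Ioc (S.y n) (S.y (n + 1))) :=
    disjoint_left.2 fun x hx hx' => hx'.1.not_ge hx.2
  rw [← Icc_union_Ioc_eq_Icc zero_le hm]
  exact measureReal_union hd measurableSet_Ioc (hfin _) (measure_Ioc_ne_top hfin _ _)

theorem real_Icc_inter_succ (hfin : ∀ l, ν (Icc 0 l) ≠ ∞) (n : ℕ) {A : Set ℝ≥0}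
    (hA : MeasurableSet A) : ν.real (Icc 0 (S.y (n + 1)) ∩ A) =
      ν.real (Icc 0 (S.y n) ∩ A) + ν.real (Ioc (S.y n) (S.y (n + 1)) ∩ A) := by
  have hm := S.strictMono_y.monotone (Nat.le_succ n)
  have hd : Disjoint (Icc 0 (S.y n) ∩ A) (Ioc (S.y n) (S.y (n + 1)) ∩ A) :=
    disjoint_left.2 fun x hx hx' => hx'.1.1.not_ge hx.1.2
  rw [← Icc_union_Ioc_eq_Icc zero_le hm, union_inter_distrib_right]
  exact measureReal_union hd (measurableSet_Ioc.inter hA)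
    (measure_ne_top_of_subset inter_subset_left (hfin _))
    (measure_ne_top_of_subset inter_subset_left (measure_Ioc_ne_top hfin _ _))

theorem tendsto_real_Icc (hfin : ∀ l, ν (Icc 0 l) ≠ ∞) (hinf : ν univ = ∞) :
    Tendsto (fun n => ν.real (Icc 0 (S.y n))) atTop atTop := by
  have hU : ⋃ n, Icc 0 (S.y n) = univ := eq_univ_of_forall fun x => by
    obtain ⟨n, hn, -⟩ := S.exists_le_y x x
    exact mem_iUnion.2 ⟨n, zero_le, hn⟩
  have hmono : Monotone fun n => Icc 0 (S.y n) := fun a b hab =>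
    Icc_subset_Icc_right (S.strictMono_y.monotone hab)
  have h := tendsto_measure_iUnion_atTop (μ := ν) hmono
  rw [hU, hinf] at h
  rw [tendsto_atTop]
  intro c
  filter_upwards [h.eventually_const_lt (ENNReal.ofReal_lt_top (r := c))] with n hn
  exact (ENNReal.ofReal_le_iff_le_toReal (hfin _)).1 hn.le

/-- A whole stick shares the ancestor of its gluing point, so it is either inside or outside the
set. -/
theorem real_Icc_inter_projSet (hfin : ∀ l, ν (Icc 0 l) ≠ ∞) (K m i j n : ℕ) :
    ν.real (Icc 0 (S.y (K + n)) ∩ S.projSet K m i j) = ν.real (Icc 0 (S.y K) ∩ S.projSet K m i j) +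
      ∑ k ∈ Finset.range n, ν.real (Ioc (S.y (K + k)) (S.y (K + k + 1))) *
        (S.projSet K m i j).indicator 1 (S.z (K + k)) := by
  induction n with
  | zero => simp
  | succ n ih =>
    rw [← add_assoc, real_Icc_inter_succ hfin _ (measurableSet_projSet K m i j), ih,
      Finset.sum_range_succ, add_assoc]
    congr 2
    by_cases h : S.z (K + n) ∈ S.projSet K m i j
    · rw [indicator_of_mem h, inter_eq_left.2 fun x hx => (mem_projSet_iff (by omega) hx).2 h]
      simp
    · rw [indicator_of_notMem h, mul_zero]
      have : Ioc (S.y (K + n)) (S.y (K + n + 1)) ∩ S.projSet K m i j = ∅ :=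
        eq_empty_of_forall_notMem fun x hx => h ((mem_projSet_iff (by omega) hx.1).1 hx.2)
      rw [this, measureReal_empty]

/-- A stick of length at most `ε` glued at height at most `ε` stays below `2 * ε`; every other stick
is counted in one of the two sums. -/
theorem real_Icc_inter_heightSet_le (hfin : ∀ l, ν (Icc 0 l) ≠ ∞) (K n : ℕ) (ε : ℝ≥0) :
    ν.real (Icc 0 (S.y (K + n)) ∩ S.heightSet K (2 * ε)) ≤
      ∑ k ∈ Finset.range n, ν.real (Ioc (S.y (K + k)) (S.y (K + k + 1))) *
        (S.heightSet K ε).indicator 1 (S.z (K + k)) +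
      ∑ k ∈ Finset.range n, if (ε : ℝ) < (S.y (K + k + 1) : ℝ) - S.y (K + k) then
        ν.real (Ioc (S.y (K + k)) (S.y (K + k + 1))) else 0 := by
  induction n with
  | zero =>
    have : Icc 0 (S.y K) ∩ S.heightSet K (2 * ε) = ∅ := by
      refine eq_empty_of_forall_notMem fun x hx => ?_
      have h1 := hx.2
      rw [heightSet, mem_ofPred_eq, S.ancestor_of_le hx.1.2] at h1
      exact not_lt_zero h1
    simp [this]
  | succ n ih =>
    rw [← add_assoc, real_Icc_inter_succ hfin _ (measurableSet_heightSet K _),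
      Finset.sum_range_succ, Finset.sum_range_succ]
    have hw : 0 ≤ ν.real (Ioc (S.y (K + n)) (S.y (K + n + 1))) := measureReal_nonneg
    have hle : ν.real (Ioc (S.y (K + n)) (S.y (K + n + 1)) ∩ S.heightSet K (2 * ε)) ≤
        ν.real (Ioc (S.y (K + n)) (S.y (K + n + 1))) :=
      measureReal_mono inter_subset_left (measure_Ioc_ne_top hfin _ _)
    have key : ν.real (Ioc (S.y (K + n)) (S.y (K + n + 1)) ∩ S.heightSet K (2 * ε)) ≤
        ν.real (Ioc (S.y (K + n)) (S.y (K + n + 1))) *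
          (S.heightSet K ε).indicator 1 (S.z (K + n)) +
        if (ε : ℝ) < (S.y (K + n + 1) : ℝ) - S.y (K + n) then
          ν.real (Ioc (S.y (K + n)) (S.y (K + n + 1))) else 0 := by
      by_cases h : S.z (K + n) ∈ S.heightSet K ε
      · rw [indicator_of_mem h, Pi.one_apply, mul_one]
        split_ifs <;> linarith
      · split_ifs with hg
        · have : 0 ≤ (S.heightSet K ε).indicator (1 : ℝ≥0 → ℝ) (S.z (K + n)) :=
            indicator_nonneg (fun _ _ => zero_le_one) _
          have := mul_nonneg hw this
          linarith
        · have : Ioc (S.y (K + n)) (S.y (K + n + 1)) ∩ S.heightSet K (2 * ε) = ∅ := by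
            refine eq_empty_of_forall_notMem fun x hx => ?_
            have h1 := hx.2
            rw [heightSet, mem_ofPred_eq, S.ancestor_of_mem_Ioc (by omega) hx.1] at h1
            have h2 : (S.ancestor K (S.z (K + n))).2 ≤ ε := not_lt.1 h
            have h3 : x - S.y (K + n) ≤ ε := by
              rw [← NNReal.coe_le_coe, NNReal.coe_sub hx.1.1.le]
              have : (x : ℝ) ≤ S.y (K + n + 1) := NNReal.coe_le_coe.2 hx.1.2
              linarith
            refine absurd h1 (not_lt.2 ?_)
            rw [two_mul]
            exact add_le_add h2 h3
          rw [this, measureReal_empty, indicator_of_notMem h]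
          simp
    linarith

/-- The law of large numbers replaces indicators by `μ`-proportions, whose weighted average
converges by Toeplitz's lemma. -/
theorem tendsto_average_of_gluingLLN (hfin : ∀ l, ν (Icc 0 l) ≠ ∞) (hinf : ν univ = ∞) {K : ℕ}
    {A : Set ℝ≥0} (h : S.GluingLLN μ ν K A) {a : ℝ}
    (ha : Tendsto (fun n => (μ[|Icc 0 (S.y n)]).real A) atTop (𝓝 a)) :
    Tendsto (fun n => (∑ i ∈ Finset.range n, ν.real (Ioc (S.y (K + i)) (S.y (K + i + 1))) *
      A.indicator 1 (S.z (K + i))) / ν.real (Icc 0 (S.y (K + n)))) atTop (𝓝 a) := by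
  have hWt : Tendsto (fun n => ν.real (Icc 0 (S.y (K + n)))) atTop atTop :=
    (tendsto_real_Icc hfin hinf).comp
      (tendsto_atTop_mono (fun n => Nat.le_add_left n K) tendsto_id)
  have h1 := tendsto_weighted_average (w := fun i => ν.real (Ioc (S.y (K + i)) (S.y (K + i + 1))))
    (W := fun n => ν.real (Icc 0 (S.y (K + n))))
    (x := fun i => (μ[|Icc 0 (S.y (K + i))]).real A) (fun _ => measureReal_nonneg)
    (fun n => real_Icc_succ hfin (K + n)) hWt
    (ha.comp (tendsto_atTop_mono (fun n => Nat.le_add_left n K) tendsto_id))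
  have h2 := h.add h1
  rw [zero_add] at h2
  refine h2.congr fun n => ?_
  rw [← add_div, ← Finset.sum_add_distrib]
  congr 1
  exact Finset.sum_congr rfl fun i _ => by ring

end Sticks

variable {S : Sticks} {μ ν : Measure ℝ≥0} {L : ℕ → ℕ → ℕ → ℕ → ℝ}

theorem GrowthConditions.ne_top (h : GrowthConditions S ν) (l : ℝ≥0) : ν (Icc 0 l) ≠ ∞ :=
  ((measure_mono (Icc_subset_Icc_right le_self_add)).trans_lt
    (h.finite (l + 1) (by positivity))).ne

theorem Equidistributes.of_gluingLLN (hν : GrowthConditions S ν)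
    (hproj : ∀ K m i j, 0 < K → 0 < m →
      Tendsto (fun n => (μ[|Icc 0 (S.y n)]).real (S.projSet K m i j)) atTop (𝓝 (L K m i j)))
    (hheight : ∀ q : ℕ, ∀ δ : ℝ, 0 < δ → ∃ K, 0 < K ∧ ∃ a < δ,
      Tendsto (fun n => (μ[|Icc 0 (S.y n)]).real (S.heightSet K (1 / (q + 1)))) atTop (𝓝 a))
    (hproj' : ∀ K m i j, 0 < K → 0 < m → S.GluingLLN μ ν K (S.projSet K m i j))
    (hheight' : ∀ K q : ℕ, 0 < K → S.GluingLLN μ ν K (S.heightSet K (1 / (q + 1)))) :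
    Equidistributes S ν L := by
  have hfin := hν.ne_top
  have hWt0 := Sticks.tendsto_real_Icc (S := S) hfin hν.infinite
  have hWt : ∀ K : ℕ, Tendsto (fun n => ν.real (Icc 0 (S.y (K + n)))) atTop atTop := fun K =>
    hWt0.comp (tendsto_atTop_mono (fun n => Nat.le_add_left n K) tendsto_id)
  have hpos : ∀ᶠ n in atTop, ν (Icc 0 (S.y n)) ≠ 0 := by
    filter_upwards [hWt0.eventually_gt_atTop 0] with n hn h0
    simp [measureReal_def, h0] at hn
  refine .of_cuts hfin hpos (fun K m i j hK hm => ?_) fun ε hε δ hδ => ?_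
  · rw [← tendsto_add_atTop_iff_nat K]
    have h1 := Sticks.tendsto_average_of_gluingLLN hfin hν.infinite (hproj' K m i j hK hm)
      (hproj K m i j hK hm)
    -- The `ν`-mass already present in `[0, y K]` is asymptotically negligible.
    have h2 := ((hWt K).const_div_atTop (ν.real (Icc 0 (S.y K) ∩ S.projSet K m i j))).add h1
    rw [zero_add] at h2
    refine h2.congr fun n => ?_
    rw [add_comm n K, Sticks.cond_real, Sticks.real_Icc_inter_projSet hfin, add_div]
  · obtain ⟨q, hq⟩ := exists_nat_one_div_lt (half_pos (NNReal.coe_pos.2 hε))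
    obtain ⟨K, hK, a, ha, hlim⟩ := hheight q δ hδ
    refine ⟨K, hK, ?_⟩
    -- Half of `ε` is reserved for the height of the gluing point and half for the length of the
    -- stick.
    have hsub : S.heightSet K ε ⊆ S.heightSet K (2 * (1 / (q + 1))) := by
      refine Sticks.heightSet_subset K ?_
      rw [← NNReal.coe_le_coe]
      push_cast
      linarith
    have h1 := Sticks.tendsto_average_of_gluingLLN hfin hν.infinite (hheight' K q hK) hlim
    have h2 : Tendsto (fun n => (∑ k ∈ Finset.range n,
        if ((1 / (q + 1) : ℝ≥0) : ℝ) < (S.y (K + k + 1) : ℝ) - S.y (K + k) then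
        ν.real (Ioc (S.y (K + k)) (S.y (K + k + 1))) else 0) / ν.real (Icc 0 (S.y (K + n))))
        atTop (𝓝 0) := by
      have h3 := ((hν.long_sticks ((1 / (q + 1) : ℝ≥0) : ℝ) (by positivity)).tendsto_div_nhds_zero).comp
        (tendsto_atTop_mono (fun n => Nat.le_add_left n K) tendsto_id)
      refine squeeze_zero (fun n => ?_) (fun n => ?_) h3
      · exact div_nonneg (Finset.sum_nonneg fun i _ => by split_ifs <;> simp [measureReal_nonneg])
          measureReal_nonneg
      · simp only [Function.comp_apply]
        refine div_le_div_of_nonneg_right ?_ measureReal_nonneg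
        rw [Finset.sum_range_add]
        refine le_add_of_nonneg_left
          (Finset.sum_nonneg fun i _ => by split_ifs <;> simp [measureReal_nonneg])
    have h4 := (h1.add h2).eventually_lt_const (show a + 0 < δ by linarith)
    obtain ⟨N, hN⟩ := eventually_atTop.1 h4
    filter_upwards [eventually_ge_atTop (K + N)] with n hn
    obtain ⟨n, rfl⟩ := Nat.exists_eq_add_of_le ((Nat.le_add_right K N).trans hn)
    refine lt_of_le_of_lt ?_ (hN n (by omega))
    rw [Sticks.cond_real, ← add_div]
    refine div_le_div_of_nonneg_right ?_ measureReal_nonneg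
    refine le_trans (measureReal_mono (inter_subset_inter_right _ hsub) ?_)
      (Sticks.real_Icc_inter_heightSet_le hfin K n _)
    exact measure_ne_top_of_subset inter_subset_left (hfin _)

end ICRT

namespace ICRT

/-! ### Conditionally independent events -/

section CondIndep

variable {Ω : Type*} {G mΩ : MeasurableSpace Ω} {P : Measure Ω}

/-- Pulling out a measurable factor, for the conditional probability `k` of the event `A`. -/
theorem setLIntegral_eq_of_forall_measure_inter [IsFiniteMeasure P]
    (hG : G ≤ mΩ) {A : Set Ω} {k : Ω → ℝ≥0∞} (hk : Measurable k)
    (h : ∀ G₀, MeasurableSet[G] G₀ → P (G₀ ∩ A) = ∫⁻ ω in G₀, k ω ∂P) {g : Ω → ℝ≥0∞}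
    (hg : Measurable[G] g) : ∫⁻ ω in A, g ω ∂P = ∫⁻ ω, k ω * g ω ∂P := by
  -- On `G`, restricting `P` to `A` is the same as weighting it by `k`; a `G`-measurable `g` has the
  -- same integral for both.
  have htrim : (P.restrict A).trim hG = (P.withDensity k).trim hG := by
    refine @Measure.ext Ω G _ _ fun s hs => ?_
    rw [trim_measurableSet_eq hG hs, trim_measurableSet_eq hG hs, Measure.restrict_apply (hG s hs),
      withDensity_apply _ (hG s hs), h s hs]
  rw [← lintegral_trim hG hg, htrim, lintegral_trim hG hg,
    lintegral_withDensity_eq_lintegral_mul _ hk (hg.mono hG le_rfl)]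
  rfl

/-- The σ-algebra generated by the first `n` families of events. -/
@[reducible]
def history (C : ℕ → Set (Set Ω)) (n : ℕ) : MeasurableSpace Ω :=
  MeasurableSpace.generateFrom (piiUnionInter C (Iio n))

theorem history_mono (C : ℕ → Set (Set Ω)) : Monotone (history C) := fun _ _ h =>
  MeasurableSpace.generateFrom_mono (piiUnionInter_mono_right (Iio_subset_Iio h))

theorem measurableSet_history {C : ℕ → Set (Set Ω)} {i n : ℕ} (hi : i < n) {s : Set Ω}
    (hs : s ∈ C i) : MeasurableSet[history C n] s :=
  MeasurableSpace.measurableSet_generateFrom (subset_piiUnionInter (mem_Iio.2 hi) hs)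

theorem history_le {C : ℕ → Set (Set Ω)} (hC : ∀ i, ∀ s ∈ C i, MeasurableSet s) (n : ℕ) :
    history C n ≤ mΩ :=
  generateFrom_piiUnionInter_le C (fun i => MeasurableSpace.generateFrom_le (hC i)) _

/-- If the families `C i`, `i ≥ 1`, are conditionally independent given `G`, with conditional
probabilities `q i`, then `q n` is also the conditional probability given `G` and the previous
families. -/
theorem measure_inter_eq_setLIntegral_of_history [IsProbabilityMeasure P]
    (hG : G ≤ mΩ) {C : ℕ → Set (Set Ω)} (hC0 : C 0 = {s | MeasurableSet[G] s})
    (hCpi : ∀ i, IsPiSystem (C i)) (hC : ∀ i, ∀ s ∈ C i, MeasurableSet s)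
    {β : Type*} {𝓑 : ℕ → Set β} {A : ℕ → β → Set Ω}
    (hA : ∀ i, 0 < i → ∀ s ∈ C i, ∃ b ∈ 𝓑 i, A i b = s)
    (hA' : ∀ i, ∀ b ∈ 𝓑 i, MeasurableSet (A i b))
    {q : ℕ → β → Ω → ℝ≥0∞} (hq : ∀ i, ∀ b ∈ 𝓑 i, Measurable[G] (q i b))
    (H : ∀ (t : Finset ℕ) (f : ℕ → β), 0 ∉ t → (∀ i ∈ t, f i ∈ 𝓑 i) →
      ∀ G₀, MeasurableSet[G] G₀ →
        P (G₀ ∩ ⋂ i ∈ t, A i (f i)) = ∫⁻ ω in G₀, ∏ i ∈ t, q i (f i) ω ∂P)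
    {n : ℕ} (hn : 0 < n) {b : β} (hb : b ∈ 𝓑 n) {E : Set Ω}
    (hE : MeasurableSet[history C n] E) : P (E ∩ A n b) = ∫⁻ ω in E, q n b ω ∂P := by
  classical
  have hle := history_le hC n
  have hqs := hq n b hb
  have key : ∀ E ∈ piiUnionInter C (Iio n), P (E ∩ A n b) = ∫⁻ ω in E, q n b ω ∂P := by
    rintro E ⟨t, ht, f, hf, rfl⟩
    -- The event of index `0`, if any, plays the role of the conditioning set in `H`; the other
    -- indices come from the independent families.
    set G₀ : Set Ω := if 0 ∈ t then f 0 else univ with hG₀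
    have hG₀m : MeasurableSet[G] G₀ := by
      rw [hG₀]
      split_ifs with h0
      · have := hf 0 h0
        rwa [hC0] at this
      · exact MeasurableSet.univ
    have hEq : ⋂ i ∈ t, f i = G₀ ∩ ⋂ i ∈ t.erase 0, f i := by
      rw [hG₀]
      split_ifs with h0
      · conv_lhs => rw [← Finset.insert_erase h0]
        rw [Finset.set_biInter_insert]
      · rw [univ_inter, Finset.erase_eq_of_notMem h0]
    have hnt : n ∉ t.erase 0 := fun h => lt_irrefl n (ht (Finset.mem_of_mem_erase h))
    have hex : ∀ i, ∃ c, i ∈ t.erase 0 → c ∈ 𝓑 i ∧ A i c = f i := fun i => by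
      by_cases hi : i ∈ t.erase 0
      · obtain ⟨c, hc, hc'⟩ := hA i (Nat.pos_of_ne_zero (Finset.ne_of_mem_erase hi)) (f i)
          (hf i (Finset.mem_of_mem_erase hi))
        exact ⟨c, fun _ => ⟨hc, hc'⟩⟩
      · exact ⟨b, fun h => absurd h hi⟩
    choose g hg using hex
    have hupd : ∀ i ∈ t.erase 0, Function.update g n b i = g i := fun i hi => by
      rw [Function.update_of_ne]
      rintro rfl
      exact hnt hi
    have h1 := H (insert n (t.erase 0)) (Function.update g n b)
      (by simp [hn.ne]) (by
        intro i hi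
        rcases Finset.mem_insert.1 hi with rfl | hi
        · simpa using hb
        · rw [hupd i hi]; exact (hg i hi).1) G₀ hG₀m
    have hfA : ∀ i ∈ t.erase 0, A i (Function.update g n b i) = f i := fun i hi => by
      rw [hupd i hi, (hg i hi).2]
    rw [Finset.set_biInter_insert, Function.update_self, iInter₂_congr hfA] at h1
    have hprod : ∀ ω, ∏ i ∈ insert n (t.erase 0), q i (Function.update g n b i) ω =
        q n b ω * ∏ i ∈ t.erase 0, q i (g i) ω := fun ω => by
      rw [Finset.prod_insert hnt, Function.update_self]
      congr 1
      exact Finset.prod_congr rfl fun i hi => by rw [hupd i hi]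
    simp_rw [hprod] at h1
    have hkm : Measurable fun ω => ∏ i ∈ t.erase 0, q i (g i) ω :=
      Finset.measurable_fun_prod _ fun i hi => (hq i _ (hg i hi).1).mono hG le_rfl
    -- The formula for the earlier events alone absorbs their product of probabilities into the set
    -- of integration and leaves the single factor `q n b`.
    have h2 := setLIntegral_eq_of_forall_measure_inter hG hkm
      (H (t.erase 0) g (by simp) fun i hi => (hg i hi).1) (g := G₀.indicator (q n b))
      (hqs.indicator hG₀m)
    rw [iInter₂_congr fun i hi => (hg i hi).2] at h2
    rw [hEq]
    calc P (G₀ ∩ (⋂ i ∈ t.erase 0, f i) ∩ A n b) = P (G₀ ∩ (A n b ∩ ⋂ i ∈ t.erase 0, f i)) := by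
          rw [inter_assoc, inter_comm (A n b)]
      _ = ∫⁻ ω in G₀, q n b ω * ∏ i ∈ t.erase 0, q i (g i) ω ∂P := h1
      _ = ∫⁻ ω, (∏ i ∈ t.erase 0, q i (g i) ω) * G₀.indicator (q n b) ω ∂P := by
          rw [← lintegral_indicator (hG _ hG₀m)]
          refine lintegral_congr fun ω => ?_
          by_cases hω : ω ∈ G₀
          · simp [hω, mul_comm]
          · simp [hω]
      _ = _ := by
          rw [← h2, lintegral_indicator (hG _ hG₀m), Measure.restrict_restrict (hG _ hG₀m)]
  set s := A n b with hs
  have hsm : MeasurableSet s := hA' n b hb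
  have hfin : IsFiniteMeasure ((P.restrict s).trim hle) := isFiniteMeasure_trim hle
  -- Both sides are finite measures that agree on the generating π-system of finite intersections,
  -- hence on the whole history.
  have hmeas : (P.restrict s).trim hle = (P.withDensity (q n b)).trim hle := by
    refine @ext_of_generate_finite Ω (history C n) _ _ (piiUnionInter C (Iio n)) rfl
      (isPiSystem_piiUnionInter _ hCpi _) hfin (fun E hE => ?_) ?_
    · have hEm : MeasurableSet[history C n] E := MeasurableSpace.measurableSet_generateFrom hE
      rw [trim_measurableSet_eq hle hEm, trim_measurableSet_eq hle hEm,
        Measure.restrict_apply (hle _ hEm), withDensity_apply _ (hle _ hEm), key E hE]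
    · rw [trim_measurableSet_eq hle MeasurableSet.univ, trim_measurableSet_eq hle MeasurableSet.univ,
        Measure.restrict_apply MeasurableSet.univ, withDensity_apply _ MeasurableSet.univ]
      refine key univ ⟨∅, by simp, fun _ => univ, by simp, by simp⟩
  have h3 : (P.restrict s).trim hle E = (P.withDensity (q n b)).trim hle E := by rw [hmeas]
  rwa [trim_measurableSet_eq hle hE, trim_measurableSet_eq hle hE,
    Measure.restrict_apply (hle _ hE), withDensity_apply _ (hle _ hE)] at h3

/-- An integrated form of a formula for the conditional probability of an event. -/
theorem measure_inter_eq_of_condExp [IsProbabilityMeasure P] (hG : G ≤ mΩ)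
    {A : Set Ω} (hA : MeasurableSet A) {k : Ω → ℝ≥0∞} (hk : ∀ᵐ ω ∂P, k ω ≠ ∞)
    (h : P⟦A | G⟧ =ᵐ[P] fun ω => (k ω).toReal) {G₀ : Set Ω} (hG₀ : MeasurableSet[G] G₀) :
    P (G₀ ∩ A) = ∫⁻ ω in G₀, k ω ∂P := by
  have hi : Integrable (A.indicator fun _ => (1 : ℝ)) P := (integrable_const 1).indicator hA
  have h1 := setIntegral_condExp hG hi hG₀
  have hki : Integrable (fun ω => (k ω).toReal) P := integrable_condExp.congr h
  rw [integral_indicator hA, Measure.restrict_restrict hA, setIntegral_const, smul_eq_mul, mul_one,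
    setIntegral_congr_ae (hG _ hG₀) (h.mono fun ω hω _ => hω), inter_comm] at h1
  rw [← ENNReal.toReal_eq_toReal_iff' (measure_ne_top _ _), ← measureReal_def, ← h1,
    integral_eq_lintegral_of_nonneg_ae (ae_of_all _ fun ω => ENNReal.toReal_nonneg)
      hki.aestronglyMeasurable.restrict]
  · congr 1
    refine lintegral_congr_ae (ae_restrict_of_ae ?_)
    filter_upwards [hk] with ω hω
    exact ENNReal.ofReal_toReal hω
  · have h2 : ∫⁻ ω in G₀, k ω ∂P = ∫⁻ ω in G₀, ENNReal.ofReal (k ω).toReal ∂P := by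
      refine lintegral_congr_ae (ae_restrict_of_ae ?_)
      filter_upwards [hk] with ω hω
      exact (ENNReal.ofReal_toReal hω).symm
    rw [h2]
    exact (hki.integrableOn.lintegral_lt_top).ne

end CondIndep

/-! ### Measurability of the distribution function -/

/-- Local finiteness of a measure on the half-line. -/
def IsLocFin (m : Measure ℝ≥0) : Prop := ∀ k : ℕ, m (Icc 0 (k : ℝ≥0)) < ∞

theorem IsLocFin.ne_top {m : Measure ℝ≥0} (h : IsLocFin m) (l : ℝ≥0) : m (Icc 0 l) ≠ ∞ := by
  obtain ⟨k, hk⟩ := exists_nat_ge l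
  exact measure_ne_top_of_subset (Icc_subset_Icc_right hk) (h k).ne

theorem isLocFin_of_forall {m : Measure ℝ≥0} (h : ∀ l, m (Icc 0 l) ≠ ∞) : IsLocFin m :=
  fun k => (h k).lt_top

theorem measurableSet_isLocFin : MeasurableSet {m : Measure ℝ≥0 | IsLocFin m} := by
  have : {m : Measure ℝ≥0 | IsLocFin m} = ⋂ k : ℕ, {m | m (Icc 0 (k : ℝ≥0)) < ∞} := by
    ext; simp [IsLocFin]
  rw [this]
  exact MeasurableSet.iInter fun k =>
    measurableSet_lt (Measure.measurable_coe measurableSet_Icc) measurable_const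

-- The endpoint is approximated from the right by grid points; for each mesh these take countably
-- many values, so measurability in the measure suffices. Continuity from above is where local
-- finiteness enters.
open Classical in
theorem measurable_measure_Icc_inter {B : Set ℝ≥0} (hB : MeasurableSet B) :
    Measurable fun p : Measure ℝ≥0 × ℝ≥0 => if IsLocFin p.1 then p.1 (Icc 0 p.2 ∩ B) else 0 := by
  have hlim : ∀ p : Measure ℝ≥0 × ℝ≥0, Tendsto (fun k : ℕ => if IsLocFin p.1 then
      p.1 (Icc 0 (((⌈p.2 * k⌉₊ + 1 : ℕ) : ℝ≥0) / k) ∩ B) else 0) atTop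
      (𝓝 (if IsLocFin p.1 then p.1 (Icc 0 p.2 ∩ B) else 0)) := by
    rintro ⟨m, a⟩
    by_cases hm : IsLocFin m
    · simp only [hm, if_true]
      -- Adding `1` to the ceiling keeps the approximation strictly above `a`, as the limit from the
      -- right requires.
      have hu : Tendsto (fun k : ℕ => ((⌈a * k⌉₊ + 1 : ℕ) : ℝ≥0) / k) atTop (𝓝[>] a) := by
        refine tendsto_nhdsWithin_iff.2 ⟨?_, ?_⟩
        · have h1 := (tendsto_nat_ceil_mul_div_atTop (R := ℝ) (a := a) a.2).comp
            tendsto_natCast_atTop_atTop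
          have h2 := h1.add tendsto_one_div_atTop_nhds_zero_nat
          rw [add_zero] at h2
          rw [← NNReal.tendsto_coe]
          refine h2.congr fun k => ?_
          simp only [Function.comp_apply]
          push_cast
          rw [add_div]
          congr 3
        · filter_upwards [eventually_gt_atTop 0] with k hk
          rw [mem_Ioi, lt_div_iff₀ (by exact_mod_cast hk)]
          refine lt_of_le_of_lt (Nat.le_ceil _) ?_
          push_cast
          exact lt_add_one _
      have hfin : ∃ r > a, m.restrict B (Icc 0 r) ≠ ∞ := ⟨a + 1, lt_add_one a,
        ((Measure.restrict_apply_le _ _).trans_lt (hm.ne_top _).lt_top).ne⟩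
      have hint : ⋂ r > a, Icc 0 r = Icc 0 a := by
        ext x
        simp only [mem_iInter, mem_Icc]
        refine ⟨fun h => ⟨zero_le, le_of_forall_gt_imp_ge_of_dense fun r hr => (h r hr).2⟩,
          fun h r hr => ⟨zero_le, h.2.trans hr.le⟩⟩
      have h3 := tendsto_measure_biInter_gt (μ := m.restrict B) (s := fun r : ℝ≥0 => Icc 0 r)
        (a := a) (fun r _ => measurableSet_Icc.nullMeasurableSet)
        (fun i j _ hij => Icc_subset_Icc_right hij) hfin
      rw [hint] at h3
      have h4 := h3.comp hu
      simp only [Function.comp_def, Measure.restrict_apply measurableSet_Icc] at h4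
      exact h4
    · simp only [hm, if_false]
      exact tendsto_const_nhds
  refine measurable_of_tendsto_metrizable (fun k => ?_) (tendsto_pi_nhds.2 hlim)
  refine Measurable.ite (measurableSet_isLocFin.preimage measurable_fst) ?_ measurable_const
  have hc : Measurable fun p : Measure ℝ≥0 × ℝ≥0 => ⌈p.2 * (k : ℝ≥0)⌉₊ :=
    Nat.measurable_ceil.comp (measurable_snd.mul_const _)
  have : Measurable fun q : Measure ℝ≥0 × ℕ => q.1 (Icc 0 (((q.2 + 1 : ℕ) : ℝ≥0) / k) ∩ B) :=
    measurable_from_prod_countable_left fun j =>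
      Measure.measurable_coe (s := Icc 0 (((j + 1 : ℕ) : ℝ≥0) / k) ∩ B) (measurableSet_Icc.inter hB)
  exact this.comp (measurable_fst.prodMk hc)

end ICRT

namespace ICRT

/-! ### The conditional law of the gluing points -/

theorem measurable_massMeasure {Ω : Type*} {mΩ : MeasurableSpace Ω} (θ : ℕ → ℝ≥0)
    {X : ℕ → Ω → ℝ≥0} (hX : ∀ i, Measurable (X i)) :
    Measurable fun ω => massMeasure θ fun i => X i ω := by
  refine Measure.measurable_of_measurable_coe _ fun s hs => ?_
  simp only [massMeasure, Measure.add_apply, Measure.sum_apply _ hs, Measure.smul_apply,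
    Measure.dirac_apply' _ hs]
  refine measurable_const.add (Measurable.tsum fun i => ?_)
  exact ((measurable_one.indicator hs).comp (hX (i + 1))).const_smul (θ (i + 1))

open Classical in
/-- The kernel that maps a measure `m` and cuts `y` to the normalized restriction of `m` to
`[0, y n]`. -/
def gluingKernel (n : ℕ) : Kernel (Measure ℝ≥0 × (ℕ → ℝ≥0)) ℝ≥0 where
  toFun e := if IsLocFin e.1 then e.1[|Icc 0 (e.2 n)] else 0
  measurable' := by
    refine Measure.measurable_of_measurable_coe _ fun s hs => ?_
    have h : ∀ {B : Set ℝ≥0}, MeasurableSet B → Measurable fun e : Measure ℝ≥0 × (ℕ → ℝ≥0) =>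
        if IsLocFin e.1 then e.1 (Icc 0 (e.2 n) ∩ B) else 0 := fun hB =>
      (measurable_measure_Icc_inter hB).comp
        (measurable_fst.prodMk ((measurable_pi_apply n).comp measurable_snd))
    convert (h MeasurableSet.univ).inv.mul (h hs) using 1
    refine funext fun e => ?_
    by_cases he : IsLocFin e.1
    · simp [he, cond_apply]
    · simp [he]

theorem gluingKernel_apply {n : ℕ} {e : Measure ℝ≥0 × (ℕ → ℝ≥0)} (he : IsLocFin e.1) :
    gluingKernel n e = e.1[|Icc 0 (e.2 n)] := by
  classical
  exact if_pos he

theorem gluingKernel_apply_univ_le (n : ℕ) (e : Measure ℝ≥0 × (ℕ → ℝ≥0)) :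
    gluingKernel n e univ ≤ 1 := by
  classical
  by_cases he : IsLocFin e.1
  · rw [gluingKernel_apply he, cond_apply measurableSet_Icc, inter_univ]
    exact ENNReal.inv_mul_le_one _
  · rw [show gluingKernel n e = 0 from if_neg he]
    simp

instance (n : ℕ) : IsFiniteKernel (gluingKernel n) :=
  ⟨1, ENNReal.one_lt_top, gluingKernel_apply_univ_le n⟩

section Gluing

variable {Ω : Type*} {mΩ : MeasurableSpace Ω} {P : Measure Ω}
  {θ : ℕ → ℝ≥0} {X : ℕ → Ω → ℝ≥0} {S : Ω → Sticks}

/-- The random mass measure together with the cuts. -/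
def massCuts (θ : ℕ → ℝ≥0) (X : ℕ → Ω → ℝ≥0) (S : Ω → Sticks) (ω : Ω) :
    Measure ℝ≥0 × (ℕ → ℝ≥0) := (massMeasure θ fun i => X i ω, (S ω).y)

/-- The mass measure, the cuts, and the first gluing points. -/
def gluingState (θ : ℕ → ℝ≥0) (X : ℕ → Ω → ℝ≥0) (S : Ω → Sticks) (n : ℕ) (ω : Ω) :
    (Measure ℝ≥0 × (ℕ → ℝ≥0)) × (ℕ → ℝ≥0) :=
  (massCuts θ X S ω, fun i => if i < n then (S ω).z i else 0)

/-- The events that depend on a single gluing point; by convention, those of index `0` are the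
events that depend on the mass measure and on the cuts. -/
def gluingEvents (θ : ℕ → ℝ≥0) (X : ℕ → Ω → ℝ≥0) (S : Ω → Sticks) : ℕ → Set (Set Ω)
  | 0 => {s | MeasurableSet[sigmaMassCuts θ X S] s}
  | i + 1 => {s | ∃ B, MeasurableSet B ∧ (fun ω => (S ω).z (i + 1)) ⁻¹' B = s}

theorem measurable_massCuts : Measurable[sigmaMassCuts θ X S] (massCuts θ X S) := by
  refine Measurable.prodMk ?_ ?_
  · exact (comap_measurable _).mono le_sup_left le_rfl
  · refine @measurable_pi_lambda _ _ _ (sigmaMassCuts θ X S) _ _ fun i => ?_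
    exact (comap_measurable fun ω => (S ω).y i).mono
      ((le_iSup (fun i => MeasurableSpace.comap (fun ω => (S ω).y i) inferInstance) i).trans
        le_sup_right) le_rfl

theorem measurable_gluing_of_lt {i n : ℕ} (hi : i < n) :
    Measurable[history (gluingEvents θ X S) n] fun ω => (S ω).z i := by
  cases i with
  | zero =>
    -- The point `z 0` is constant, so index `0` of the families is free to carry the information on
    -- `(μ, Y)`.
    have : (fun ω => (S ω).z 0) = fun _ => 0 := by
      funext ω
      exact le_antisymm (((S ω).z_le 0).trans_eq (S ω).y_zero) zero_le
    rw [this]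
    exact measurable_const
  | succ i => exact fun B hB => measurableSet_history hi ⟨B, hB, rfl⟩

theorem sigmaMassCuts_le_history {n : ℕ} (hn : 0 < n) :
    sigmaMassCuts θ X S ≤ history (gluingEvents θ X S) n :=
  fun _ hs => measurableSet_history hn hs

theorem measurable_gluingState {n : ℕ} (hn : 0 < n) :
    Measurable[history (gluingEvents θ X S) n] (gluingState θ X S n) := by
  refine Measurable.prodMk (measurable_massCuts.mono (sigmaMassCuts_le_history hn) le_rfl) ?_
  refine @measurable_pi_lambda _ _ _ (history (gluingEvents θ X S) n) _ _ fun i => ?_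
  by_cases hi : i < n
  · simpa [hi] using measurable_gluing_of_lt hi
  · simp [hi]

theorem isPiSystem_gluingEvents (i : ℕ) : IsPiSystem (gluingEvents θ X S i) := by
  cases i with
  | zero => exact @MeasurableSpace.isPiSystem_measurableSet Ω (sigmaMassCuts θ X S)
  | succ i =>
    rintro _ ⟨B, hB, rfl⟩ _ ⟨B', hB', rfl⟩ -
    exact ⟨B ∩ B', hB.inter hB', rfl⟩

namespace IsICRT

theorem sigmaMass_le (hS : IsICRT P θ X S) : sigmaMass θ X ≤ mΩ :=
  (measurable_massMeasure θ hS.measurable_X).comap_le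

theorem sigmaMassCuts_le (hS : IsICRT P θ X S) : sigmaMassCuts θ X S ≤ mΩ :=
  sup_le hS.sigmaMass_le (iSup_le fun i => (hS.measurable_Y i).comap_le)

theorem measurableSet_gluingEvents (hS : IsICRT P θ X S) (i : ℕ)
    (s : Set Ω) (hs : s ∈ gluingEvents θ X S i) :
    MeasurableSet s := by
  cases i with
  | zero => exact hS.sigmaMassCuts_le _ hs
  | succ i =>
    obtain ⟨B, hB, rfl⟩ := hs
    exact hS.measurable_Z _ hB

/-- The increasing σ-algebras generated by the mass measure, the cuts and the first gluing
points. -/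
def gluingFiltration (hS : IsICRT P θ X S) (K : ℕ) : Filtration ℕ mΩ where
  seq k := history (gluingEvents θ X S) (K + k)
  mono' _ _ h := history_mono _ (Nat.add_le_add_left h K)
  le' k := history_le hS.measurableSet_gluingEvents (K + k)

/-- Take all test sets in `law_Z` equal to the whole half-line: the product of total masses is `1`,
which excludes that `μ[0, Y_n]` be `0` or infinite. Positivity and local finiteness of `μ` along the
cuts are obtained in this way. -/
theorem ae_isProbabilityMeasure_cond [IsProbabilityMeasure P] (hS : IsICRT P θ X S) :
    ∀ᵐ ω ∂P, ∀ n, 0 < n →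
    IsProbabilityMeasure ((massMeasure θ fun i => X i ω)[|Icc 0 ((S ω).y n)]) := by
  refine ae_all_iff.2 fun n => ?_
  have h := hS.law_Z n (fun _ => univ) fun _ => MeasurableSet.univ
  have h1 : {ω | ∀ i ∈ Finset.Icc 1 n, (S ω).z i ∈ (univ : Set ℝ≥0)} = univ := by simp
  rw [h1, indicator_univ, condExp_const hS.sigmaMassCuts_le] at h
  filter_upwards [h] with ω hω hn
  have h2 : ((massMeasure θ fun i => X i ω)[|Icc 0 ((S ω).y n)]).real univ ≠ 0 := fun h0 => by
    refine one_ne_zero (hω.trans (Finset.prod_eq_zero (i := n) (Finset.mem_Icc.2 ⟨hn, le_rfl⟩) h0))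
  refine ⟨?_⟩
  rw [measureReal_def, cond_apply measurableSet_Icc, inter_univ] at h2
  rw [cond_apply measurableSet_Icc, inter_univ]
  refine ENNReal.inv_mul_cancel (fun h0 => h2 ?_) fun h0 => h2 ?_
  · simp [h0]
  · simp [h0]

theorem ae_isLocFin [IsProbabilityMeasure P] (hS : IsICRT P θ X S) :
    ∀ᵐ ω ∂P, IsLocFin (massMeasure θ fun i => X i ω) := by
  filter_upwards [hS.ae_isProbabilityMeasure_cond] with ω hω k
  obtain ⟨n, hn, -⟩ := (S ω).exists_le_y k k
  have hn' : (k : ℝ≥0) ≤ (S ω).y (n + 1) := hn.trans ((S ω).strictMono_y.monotone (Nat.le_succ n))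
  refine (measure_mono (Icc_subset_Icc_right hn')).trans_lt (lt_top_iff_ne_top.2 fun h0 => ?_)
  have := (hω (n + 1) (Nat.succ_pos n)).measure_univ
  rw [cond_apply measurableSet_Icc, inter_univ, h0] at this
  simp at this

theorem measure_inter_biInter_gluing [IsProbabilityMeasure P] (hS : IsICRT P θ X S)
    {t : Finset ℕ} {f : ℕ → Set ℝ≥0} (h0 : 0 ∉ t)
    (hf : ∀ i ∈ t, MeasurableSet (f i)) {G₀ : Set Ω}
    (hG₀ : MeasurableSet[sigmaMassCuts θ X S] G₀) :
    P (G₀ ∩ ⋂ i ∈ t, (fun ω => (S ω).z i) ⁻¹' f i) =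
      ∫⁻ ω in G₀, ∏ i ∈ t, gluingKernel i (massCuts θ X S ω) (f i) ∂P := by
  classical
  have hm : MeasurableSet (⋂ i ∈ t, (fun ω => (S ω).z i) ⁻¹' f i) :=
    t.measurableSet_biInter fun i hi => hS.measurable_Z i (hf i hi)
  have hone : ∀ ω i, gluingKernel i (massCuts θ X S ω) (f i) ≠ ∞ := fun ω i => measure_ne_top _ _
  refine measure_inter_eq_of_condExp hS.sigmaMassCuts_le hm
    (ae_of_all _ fun ω => ENNReal.prod_ne_top fun i _ => hone ω i) ?_ hG₀
  -- `law_Z` concerns all indices from `1` to `n`; those outside `t` receive the whole half-line and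
  -- contribute factors `1`.
  have h := hS.law_Z (t.sup id) (fun i => if i ∈ t then f i else univ) fun i => by
    split_ifs with hi
    · exact hf i hi
    · exact MeasurableSet.univ
  have hsub : t ⊆ Finset.Icc 1 (t.sup id) := fun i hi => Finset.mem_Icc.2
    ⟨Nat.pos_of_ne_zero fun h => h0 (h ▸ hi), Finset.le_sup (f := id) hi⟩
  have hset : {ω | ∀ i ∈ Finset.Icc 1 (t.sup id), (S ω).z i ∈ if i ∈ t then f i else univ} =
      ⋂ i ∈ t, (fun ω => (S ω).z i) ⁻¹' f i := by
    ext ω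
    simp only [mem_ofPred_eq, mem_iInter, mem_preimage]
    refine ⟨fun h i hi => by simpa [hi] using h i (hsub hi), fun h i _ => ?_⟩
    split_ifs with hi
    · exact h i hi
    · exact mem_univ _
  rw [hset] at h
  filter_upwards [h, hS.ae_isProbabilityMeasure_cond, hS.ae_isLocFin] with ω h1 h2 h3
  rw [h1, ENNReal.toReal_prod, ← Finset.prod_subset hsub fun i hi hit => ?_]
  · refine Finset.prod_congr rfl fun i hi => ?_
    rw [gluingKernel_apply h3, if_pos hi]
    rfl
  · have := h2 i (Finset.mem_Icc.1 hi).1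
    rw [if_neg hit, probReal_univ]

/-- Conditional independence: knowing the previous gluing points, besides the mass and the cuts,
does not alter the law of `Z_n`. -/
theorem measure_inter_gluing [IsProbabilityMeasure P] (hS : IsICRT P θ X S)
    {n : ℕ} (hn : 0 < n) {B : Set ℝ≥0} (hB : MeasurableSet B) {E : Set Ω}
    (hE : MeasurableSet[history (gluingEvents θ X S) n] E) :
    P (E ∩ (fun ω => (S ω).z n) ⁻¹' B) =
      ∫⁻ ω in E, gluingKernel n (massCuts θ X S ω) B ∂P := by
  refine measure_inter_eq_setLIntegral_of_history hS.sigmaMassCuts_le rfl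
    isPiSystem_gluingEvents hS.measurableSet_gluingEvents (𝓑 := fun _ => {B | MeasurableSet B})
    (A := fun i B => (fun ω => (S ω).z i) ⁻¹' B)
    (q := fun i B ω => gluingKernel i (massCuts θ X S ω) B)
    (fun i hi s hs => ?_) (fun i B hB => hS.measurable_Z i hB) (fun i B hB => ?_)
    (fun t f h0 hf G₀ hG₀ => hS.measure_inter_biInter_gluing h0 hf hG₀) hn hB hE
  · obtain ⟨i, rfl⟩ := Nat.exists_eq_succ_of_ne_zero hi.ne'
    exact hs
  · have hB' : MeasurableSet B := hB
    exact (Kernel.measurable_coe _ hB').comp measurable_massCuts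

/-- The joint law of the state and the next gluing point is a composition product with the gluing
kernel; it is enough to check this on rectangles. -/
theorem setLIntegral_gluing [IsProbabilityMeasure P] (hS : IsICRT P θ X S) {n : ℕ} (hn : 0 < n)
    {φ : ((Measure ℝ≥0 × (ℕ → ℝ≥0)) × (ℕ → ℝ≥0)) × ℝ≥0 → ℝ≥0∞} (hφ : Measurable φ) {D : Set Ω}
    (hD : MeasurableSet[history (gluingEvents θ X S) n] D) :
    ∫⁻ ω in D, φ (gluingState θ X S n ω, (S ω).z n) ∂P =
      ∫⁻ ω in D, ∫⁻ x, φ (gluingState θ X S n ω, x)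
        ∂(gluingKernel n (massCuts θ X S ω)) ∂P := by
  have hle := history_le hS.measurableSet_gluingEvents n
  have hV := measurable_gluingState (θ := θ) (X := X) (S := S) hn
  have hV' : Measurable (gluingState θ X S n) := hV.mono hle le_rfl
  set κ := (gluingKernel n).comap Prod.fst
    (measurable_fst (α := Measure ℝ≥0 × (ℕ → ℝ≥0)) (β := ℕ → ℝ≥0)) with hκ
  have hmap : (P.restrict D).map (fun ω => (gluingState θ X S n ω, (S ω).z n)) =
      ((P.restrict D).map (gluingState θ X S n)).compProd κ := by
    refine Measure.ext_prod fun {s t} hs ht => ?_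
    rw [Measure.map_apply (hV'.prodMk (hS.measurable_Z n)) (hs.prod ht),
      Measure.compProd_apply_prod hs ht, setLIntegral_map hs (Kernel.measurable_coe _ ht) hV',
      Measure.restrict_apply (hV'.prodMk (hS.measurable_Z n) (hs.prod ht)),
      Measure.restrict_restrict (hV' hs)]
    have h1 := hS.measure_inter_gluing hn ht ((hV hs).inter hD)
    refine Eq.trans ?_ h1
    congr 1
    ext ω
    simp only [mem_inter_iff, mem_preimage, mem_prod]
    tauto
  have h2 : ∫⁻ p, φ p ∂((P.restrict D).map (fun ω => (gluingState θ X S n ω, (S ω).z n))) =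
      ∫⁻ p, φ p ∂(((P.restrict D).map (gluingState θ X S n)).compProd κ) := by rw [hmap]
  rw [lintegral_map hφ (hV'.prodMk (hS.measurable_Z n)), Measure.lintegral_compProd hφ,
    lintegral_map hφ.lintegral_kernel_prod_right' hV'] at h2
  exact h2

end IsICRT

end Gluing

end ICRT

namespace ICRT

/-! ### Martingales along the construction of the tree -/

/-- The points whose ancestor in `[0, y K]`, and height above `[0, y K]`, satisfy some condition
that depends on the cuts. -/
def Sticks.ancestorSet (S : Sticks) (K : ℕ) (U : Set ((ℕ → ℝ≥0) × (ℝ≥0 × ℝ≥0))) : Set ℝ≥0 :=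
  {x | (S.y, S.ancestor K x) ∈ U}

theorem Sticks.measurableSet_ancestorSet (S : Sticks) (K : ℕ)
    {U : Set ((ℕ → ℝ≥0) × (ℝ≥0 × ℝ≥0))} (hU : MeasurableSet U) :
    MeasurableSet (S.ancestorSet K U) :=
  (measurable_const.prodMk (S.measurable_ancestor K)) hU

/-- The counterpart of `Sticks.ancestorSet` in terms of the gluing state. -/
def stateSet (K k : ℕ) (U : Set ((ℕ → ℝ≥0) × (ℝ≥0 × ℝ≥0))) :
    Set (((Measure ℝ≥0 × (ℕ → ℝ≥0)) × (ℕ → ℝ≥0)) × ℝ≥0) :=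
  {p | (p.1.1.2, stepAncestor p.1.1.2 p.1.2 K k p.2) ∈ U}

theorem measurable_stepAncestor_state (K k : ℕ) :
    Measurable fun p : ((Measure ℝ≥0 × (ℕ → ℝ≥0)) × (ℕ → ℝ≥0)) × ℝ≥0 =>
      stepAncestor p.1.1.2 p.1.2 K k p.2 :=
  (measurable_stepAncestor K k).comp (((measurable_snd.comp (measurable_fst.comp
    measurable_fst)).prodMk (measurable_snd.comp measurable_fst)).prodMk measurable_snd)

theorem measurableSet_stateSet (K k : ℕ) {U : Set ((ℕ → ℝ≥0) × (ℝ≥0 × ℝ≥0))}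
    (hU : MeasurableSet U) : MeasurableSet (stateSet K k U) :=
  ((measurable_snd.comp (measurable_fst.comp measurable_fst)).prodMk
    (measurable_stepAncestor_state K k)) hU

theorem cond_Icc_restrict {μ : Measure ℝ≥0} {a b : ℝ≥0} (hab : a ≤ b) (h0 : μ (Icc 0 a) ≠ 0)
    (ha : μ (Icc 0 a) ≠ ∞) : (μ[|Icc 0 b]).restrict (Icc 0 a) =
      (μ[|Icc 0 b]) (Icc 0 a) • μ[|Icc 0 a] := by
  have hsub : Icc 0 a ∩ Icc 0 b = Icc 0 a := inter_eq_left.2 (Icc_subset_Icc_right hab)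
  rw [cond_apply measurableSet_Icc, inter_comm, hsub]
  simp only [ProbabilityTheory.cond]
  rw [Measure.restrict_smul, Measure.restrict_restrict measurableSet_Icc, hsub, smul_smul,
    mul_assoc, ENNReal.mul_inv_cancel h0 ha, mul_one]

section

variable {Ω : Type*} {mΩ : MeasurableSpace Ω} {P : Measure Ω}
  {θ : ℕ → ℝ≥0} {X : ℕ → Ω → ℝ≥0} {S : Ω → Sticks}

theorem stepAncestor_gluingState {K k : ℕ} {ω : Ω} {x : ℝ≥0} (hx : x ≤ (S ω).y (K + k)) :
    stepAncestor (gluingState θ X S (K + k) ω).1.2 (gluingState θ X S (K + k) ω).2 K k x =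
      (S ω).ancestor K x := by
  rw [(S ω).ancestor_eq hx]
  refine stepAncestor_congr (fun i hi => ?_) x
  simp [gluingState, hi]

theorem mem_stateSet_iff {K k : ℕ} {ω : Ω} {x : ℝ≥0} (hx : x ≤ (S ω).y (K + k))
    {U : Set ((ℕ → ℝ≥0) × (ℝ≥0 × ℝ≥0))} :
    (gluingState θ X S (K + k) ω, x) ∈ stateSet K k U ↔ x ∈ (S ω).ancestorSet K U := by
  rw [stateSet, mem_ofPred_eq, stepAncestor_gluingState hx]
  rfl

/-- The mass proportion of `Sticks.ancestorSet` within `[0, Y (K + k)]`. -/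
def proportion (θ : ℕ → ℝ≥0) (X : ℕ → Ω → ℝ≥0) (S : Ω → Sticks) (K : ℕ)
    (U : Set ((ℕ → ℝ≥0) × (ℝ≥0 × ℝ≥0))) (k : ℕ) (ω : Ω) : ℝ :=
  (gluingKernel (K + k) (massCuts θ X S ω)).real
    (Prod.mk (gluingState θ X S (K + k) ω) ⁻¹' stateSet K k U)

/-- The indicator of the event that the gluing point of index `K + k` falls in
`Sticks.ancestorSet`. -/
def gluedIn (S : Ω → Sticks) (K : ℕ)
    (U : Set ((ℕ → ℝ≥0) × (ℝ≥0 × ℝ≥0))) (k : ℕ) (ω : Ω) : ℝ :=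
  ((S ω).ancestorSet K U).indicator 1 ((S ω).z (K + k))

/-- The kernel form of the proportion is adapted to the filtration; this form, valid when `μ` is
locally finite, serves the pathwise computations. -/
theorem proportion_eq {K k : ℕ} {ω : Ω} (h : IsLocFin (massMeasure θ fun i => X i ω))
    (U : Set ((ℕ → ℝ≥0) × (ℝ≥0 × ℝ≥0))) : proportion θ X S K U k ω =
      ((massMeasure θ fun i => X i ω)[|Icc 0 ((S ω).y (K + k))]).real
        ((S ω).ancestorSet K U) := by
  rw [proportion, gluingKernel_apply h, Sticks.cond_real, Sticks.cond_real]
  change (massMeasure θ fun i => X i ω).real (Icc 0 ((S ω).y (K + k)) ∩ _) / _ = _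
  congr 2
  ext x
  simp only [mem_inter_iff, mem_preimage]
  exact and_congr_right fun hx => mem_stateSet_iff hx.2

theorem gluedIn_eq (K k : ℕ) (U : Set ((ℕ → ℝ≥0) × (ℝ≥0 × ℝ≥0))) (ω : Ω) : gluedIn S K U k ω =
    (stateSet K k U).indicator 1 (gluingState θ X S (K + k) ω, (S ω).z (K + k)) := by
  by_cases h : (S ω).z (K + k) ∈ (S ω).ancestorSet K U
  · rw [gluedIn, indicator_of_mem h, indicator_of_mem ((mem_stateSet_iff ((S ω).z_le _)).2 h)]
    rfl
  · rw [gluedIn, indicator_of_notMem h,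
      indicator_of_notMem fun h' => h ((mem_stateSet_iff ((S ω).z_le _)).1 h')]

theorem proportion_nonneg {K k : ℕ} {U : Set ((ℕ → ℝ≥0) × (ℝ≥0 × ℝ≥0))} {ω : Ω} :
    0 ≤ proportion θ X S K U k ω := measureReal_nonneg

theorem gluingKernel_real_le_one (n : ℕ) (e : Measure ℝ≥0 × (ℕ → ℝ≥0)) (s : Set ℝ≥0) :
    (gluingKernel n e).real s ≤ 1 :=
  ENNReal.toReal_le_of_le_ofReal zero_le_one (by
    rw [ENNReal.ofReal_one]
    exact (measure_mono (subset_univ _)).trans (gluingKernel_apply_univ_le _ _))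

theorem proportion_le_one {K k : ℕ} {U : Set ((ℕ → ℝ≥0) × (ℝ≥0 × ℝ≥0))} {ω : Ω} :
    proportion θ X S K U k ω ≤ 1 := gluingKernel_real_le_one _ _ _

theorem gluedIn_mem_Icc {K k : ℕ} {U : Set ((ℕ → ℝ≥0) × (ℝ≥0 × ℝ≥0))} {ω : Ω} :
    gluedIn S K U k ω ∈ Icc (0 : ℝ) 1 := by
  by_cases h : (S ω).z (K + k) ∈ (S ω).ancestorSet K U
  · simp [gluedIn, h]
  · simp [gluedIn, h]

theorem measurable_gluingKernel_section {n : ℕ} (hn : 0 < n) {n' : ℕ}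
    {s : Set (((Measure ℝ≥0 × (ℕ → ℝ≥0)) × (ℕ → ℝ≥0)) × ℝ≥0)} (hs : MeasurableSet s) :
    Measurable[history (gluingEvents θ X S) n] fun ω =>
      gluingKernel n' (massCuts θ X S ω) (Prod.mk (gluingState θ X S n ω) ⁻¹' s) := by
  have h := Kernel.measurable_kernel_prodMk_left (κ := (gluingKernel n').comap Prod.fst
    (measurable_fst (α := Measure ℝ≥0 × (ℕ → ℝ≥0)) (β := ℕ → ℝ≥0))) hs
  exact h.comp (measurable_gluingState hn)

theorem measurable_proportion {K : ℕ} (hK : 0 < K) (k : ℕ)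
    {U : Set ((ℕ → ℝ≥0) × (ℝ≥0 × ℝ≥0))} (hU : MeasurableSet U) :
    Measurable[history (gluingEvents θ X S) (K + k)] (proportion θ X S K U k) :=
  (measurable_gluingKernel_section (Nat.add_pos_left hK k)
    (measurableSet_stateSet K k hU)).ennreal_toReal

theorem measurable_gluedIn {K : ℕ} (hK : 0 < K) (k : ℕ)
    {U : Set ((ℕ → ℝ≥0) × (ℝ≥0 × ℝ≥0))} (hU : MeasurableSet U) :
    Measurable[history (gluingEvents θ X S) (K + (k + 1))] (gluedIn S K U k) := by
  have h1 : Measurable[history (gluingEvents θ X S) (K + (k + 1))] fun ω =>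
      (gluingState θ X S (K + k) ω, (S ω).z (K + k)) :=
    ((measurable_gluingState (Nat.add_pos_left hK k)).mono
      (history_mono _ (by omega)) le_rfl).prodMk (measurable_gluing_of_lt (by omega))
  have h2 : gluedIn S K U k = ((stateSet K k U).indicator 1) ∘ fun ω =>
      (gluingState θ X S (K + k) ω, (S ω).z (K + k)) := funext fun ω => gluedIn_eq K k U ω
  rw [h2]
  exact (measurable_one.indicator (measurableSet_stateSet K k hU)).comp h1

/-- The proportion, within the mass of `[0, Y (n + 1)]`, of the last stick. -/
def stickRatio (θ : ℕ → ℝ≥0) (X : ℕ → Ω → ℝ≥0) (S : Ω → Sticks) (n : ℕ) (ω : Ω) : ℝ≥0∞ :=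
  gluingKernel (n + 1) (massCuts θ X S ω) (Ioc ((S ω).y n) ((S ω).y (n + 1)))

theorem measurable_stickRatio {K : ℕ} (hK : 0 < K) (n : ℕ) :
    Measurable[history (gluingEvents θ X S) K] (stickRatio θ X S n) := by
  have hs : MeasurableSet {p : ((Measure ℝ≥0 × (ℕ → ℝ≥0)) × (ℕ → ℝ≥0)) × ℝ≥0 |
      p.2 ∈ Ioc (p.1.1.2 n) (p.1.1.2 (n + 1))} := by
    have h : ∀ n, Measurable fun p : ((Measure ℝ≥0 × (ℕ → ℝ≥0)) × (ℕ → ℝ≥0)) × ℝ≥0 =>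
        p.1.1.2 n := fun n => (measurable_pi_apply n).comp
      (measurable_snd.comp (measurable_fst.comp measurable_fst))
    have h1 := measurableSet_lt (h n) measurable_snd
    have h2 := measurableSet_le measurable_snd (h (n + 1))
    exact h1.inter h2
  exact measurable_gluingKernel_section hK hs

/-! ### Conditional expectations along the gluing filtration. -/

namespace IsICRT

variable [IsProbabilityMeasure P]

theorem condExp_gluedIn (hS : IsICRT P θ X S) {K : ℕ} (hK : 0 < K) (k : ℕ)
    {U : Set ((ℕ → ℝ≥0) × (ℝ≥0 × ℝ≥0))} (hU : MeasurableSet U) :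
    P[gluedIn S K U k | hS.gluingFiltration K k] =ᵐ[P] proportion θ X S K U k := by
  have hle := (hS.gluingFiltration K).le
  have hpm : Measurable[hS.gluingFiltration K k] (proportion θ X S K U k) :=
    measurable_proportion hK k hU
  have hgm : Measurable (gluedIn S K U k) :=
    (measurable_gluedIn (θ := θ) (X := X) hK k hU).mono (hle (k + 1)) le_rfl
  have hpi : Integrable (proportion θ X S K U k) P :=
    Integrable.of_bound (hpm.mono (hle k) le_rfl).aestronglyMeasurable 1
      (ae_of_all _ fun ω => by
        rw [Real.norm_of_nonneg proportion_nonneg]; exact proportion_le_one)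
  have hgi : Integrable (gluedIn S K U k) P :=
    Integrable.of_bound hgm.aestronglyMeasurable 1
      (ae_of_all _ fun ω => by
        rw [Real.norm_of_nonneg gluedIn_mem_Icc.1]; exact gluedIn_mem_Icc.2)
  refine (ae_eq_condExp_of_forall_setIntegral_eq (hle k) hgi (fun D _ _ => hpi.integrableOn)
    (fun D hD _ => ?_) hpm.stronglyMeasurable.aestronglyMeasurable).symm
  rw [integral_eq_lintegral_of_nonneg_ae (ae_of_all _ fun ω => proportion_nonneg)
      hpi.aestronglyMeasurable.restrict,
    integral_eq_lintegral_of_nonneg_ae (ae_of_all _ fun ω => gluedIn_mem_Icc.1)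
      hgi.aestronglyMeasurable.restrict]
  congr 1
  have h := hS.setLIntegral_gluing (n := K + k) (Nat.add_pos_left hK k)
    (φ := (stateSet K k U).indicator 1)
    (measurable_one.indicator (measurableSet_stateSet K k hU)) hD
  convert h.symm using 1
  · refine lintegral_congr fun ω => ?_
    have h1 : (fun x => (stateSet K k U).indicator (1 : ((Measure ℝ≥0 × (ℕ → ℝ≥0)) × (ℕ → ℝ≥0)) × ℝ≥0 → ℝ≥0∞)
        (gluingState θ X S (K + k) ω, x)) =
        (Prod.mk (gluingState θ X S (K + k) ω) ⁻¹' stateSet K k U).indicator 1 := rfl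
    rw [h1, lintegral_indicator_one ((measurable_prodMk_left) (measurableSet_stateSet K k hU)),
      proportion, ofReal_measureReal]
  · refine lintegral_congr fun ω => ?_
    rw [gluedIn_eq (θ := θ) (X := X)]
    by_cases hm : (gluingState θ X S (K + k) ω, (S ω).z (K + k)) ∈ stateSet K k U
    · simp [hm]
    · simp [hm]

theorem integrable_gluedIn (hS : IsICRT P θ X S) {K : ℕ} (hK : 0 < K) (k : ℕ)
    {U : Set ((ℕ → ℝ≥0) × (ℝ≥0 × ℝ≥0))} (hU : MeasurableSet U) :
    Integrable (gluedIn S K U k) P :=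
  Integrable.of_bound ((measurable_gluedIn (θ := θ) (X := X) hK k hU).mono
    ((hS.gluingFiltration K).le (k + 1)) le_rfl).aestronglyMeasurable 1
      (ae_of_all _ fun ω => by
        rw [Real.norm_of_nonneg gluedIn_mem_Icc.1]; exact gluedIn_mem_Icc.2)

theorem integrable_proportion (hS : IsICRT P θ X S) {K : ℕ} (hK : 0 < K) (k : ℕ)
    {U : Set ((ℕ → ℝ≥0) × (ℝ≥0 × ℝ≥0))} (hU : MeasurableSet U) :
    Integrable (proportion θ X S K U k) P :=
  Integrable.of_bound ((measurable_proportion hK k hU).mono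
    ((hS.gluingFiltration K).le k) le_rfl).aestronglyMeasurable 1
      (ae_of_all _ fun ω => by
        rw [Real.norm_of_nonneg proportion_nonneg]; exact proportion_le_one)

theorem condExp_gluedIn_sub (hS : IsICRT P θ X S) {K : ℕ} (hK : 0 < K) (k : ℕ)
    {U : Set ((ℕ → ℝ≥0) × (ℝ≥0 × ℝ≥0))} (hU : MeasurableSet U) :
    P[fun ω => gluedIn S K U k ω - proportion θ X S K U k ω | hS.gluingFiltration K k] =ᵐ[P]
      0 := by
  have hpm : Measurable[hS.gluingFiltration K k] (proportion θ X S K U k) :=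
    measurable_proportion hK k hU
  have h1 := condExp_sub (hS.integrable_gluedIn hK k hU) (hS.integrable_proportion hK k hU)
    (hS.gluingFiltration K k)
  have h2 := condExp_of_stronglyMeasurable ((hS.gluingFiltration K).le k) hpm.stronglyMeasurable
    (hS.integrable_proportion hK k hU)
  refine h1.trans ?_
  rw [h2]
  filter_upwards [hS.condExp_gluedIn hK k hU] with ω hω
  simp [hω]

/-- Given `(μ, Y)` the weights of `ν` are fixed, hence predictable, and the centred indicators are
bounded martingale differences. Condition (ii) makes the squared relative weights summable, so the
transform converges and Kronecker's lemma concludes. -/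
theorem ae_gluingLLN (hS : IsICRT P θ X S) {ν : Ω → Measure ℝ≥0}
    (hν : Measurable[sigmaMassCuts θ X S] ν)
    (hνg : ∀ᵐ ω ∂P, GrowthConditions (S ω) (ν ω)) {K : ℕ} (hK : 0 < K)
    {U : Set ((ℕ → ℝ≥0) × (ℝ≥0 × ℝ≥0))} (hU : MeasurableSet U) :
    ∀ᵐ ω ∂P, (S ω).GluingLLN (massMeasure θ fun i => X i ω) (ν ω) K
      ((S ω).ancestorSet K U) := by
  classical
  -- This version is defined for every `ω` and measurable; it agrees with the `ν`-mass whenever the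
  -- growth conditions hold.
  set W : ℕ → Ω → ℝ := fun n ω =>
    (if IsLocFin (ν ω) then ν ω (Icc 0 ((S ω).y n) ∩ univ) else 0).toReal with hW
  have hWm : ∀ n, Measurable[sigmaMassCuts θ X S] (W n) := fun n =>
    ((measurable_measure_Icc_inter MeasurableSet.univ).comp
      (hν.prodMk ((measurable_pi_apply n).comp (measurable_snd.comp
        measurable_massCuts)))).ennreal_toReal
  have hWm' : ∀ n k, Measurable[hS.gluingFiltration K k] (W n) := fun n k =>
    (hWm n).mono (sigmaMassCuts_le_history (Nat.add_pos_left hK k)) le_rfl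
  have hWeq : ∀ ω, GrowthConditions (S ω) (ν ω) → ∀ n, W n ω = (ν ω).real (Icc 0 ((S ω).y n)) := by
    intro ω h n
    simp [hW, isLocFin_of_forall h.ne_top, measureReal_def]
  have hlim := ae_exists_tendsto_sum_mul (P := P) (𝓕 := hS.gluingFiltration K)
    (a := fun k ω => (W (K + k + 1) ω - W (K + k) ω) / W (K + k + 1) ω)
    (d := fun k ω => gluedIn S K U k ω - proportion θ X S K U k ω)
    (fun k => (measurable_gluedIn hK k hU).sub ((measurable_proportion hK k hU).mono
      (history_mono _ (by omega)) le_rfl))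
    (fun k ω => by
      have h1 := gluedIn_mem_Icc (S := S) (K := K) (k := k) (U := U) (ω := ω)
      have h2 := proportion_nonneg (θ := θ) (X := X) (S := S) (K := K) (k := k) (U := U) (ω := ω)
      have h3 := proportion_le_one (θ := θ) (X := X) (S := S) (K := K) (k := k) (U := U) (ω := ω)
      rw [abs_le]
      exact ⟨by linarith [h1.1], by linarith [h1.2]⟩)
    (fun k => hS.condExp_gluedIn_sub hK k hU)
    (fun k => ((hWm' _ k).sub (hWm' _ k)).div (hWm' _ k)) (by
      filter_upwards [hνg] with ω hω
      obtain ⟨ε, hε, ho⟩ := hω.stick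
      have h1 := summable_sq_div_of_le_rpow (w := fun n => (ν ω).real (Ioc ((S ω).y n)
        ((S ω).y (n + 1)))) (W := fun n => (ν ω).real (Icc 0 ((S ω).y n))) hε
        (fun _ => measureReal_nonneg) (Sticks.real_Icc_succ hω.ne_top)
        (Sticks.tendsto_real_Icc hω.ne_top hω.infinite) (by
          filter_upwards [ho.bound one_pos] with n hn
          rw [one_mul, Real.norm_of_nonneg measureReal_nonneg,
            Real.norm_of_nonneg (Real.rpow_nonneg measureReal_nonneg _)] at hn
          exact hn)
      refine ((summable_nat_add_iff K).2 h1).congr fun n => ?_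
      rw [add_comm n K]
      simp only [hWeq ω hω, Sticks.real_Icc_succ hω.ne_top (K + n), add_sub_cancel_left])
  filter_upwards [hlim, hνg, hS.ae_isLocFin] with ω ⟨s, hs⟩ hω hfin
  have h := tendsto_kronecker (w := fun n => (ν ω).real (Ioc ((S ω).y (K + n))
    ((S ω).y (K + n + 1)))) (W := fun n => (ν ω).real (Icc 0 ((S ω).y (K + n))))
    (fun _ => measureReal_nonneg) (fun n => Sticks.real_Icc_succ hω.ne_top (K + n))
    ((Sticks.tendsto_real_Icc hω.ne_top hω.infinite).comp
      (tendsto_atTop_mono (fun n => Nat.le_add_left n K) tendsto_id)) hs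
  refine h.congr fun n => ?_
  congr 1
  refine Finset.sum_congr rfl fun i _ => ?_
  rw [hWeq ω hω, hWeq ω hω, ← mul_assoc, proportion_eq hfin]
  change (ν ω).real (Icc 0 ((S ω).y (K + i + 1))) * _ * _ = _
  -- The cancellation also holds when the total mass is `0`, because the increment is then `0` too.
  rw [mul_div_cancel_of_imp', Sticks.real_Icc_succ hω.ne_top (K + i), add_sub_cancel_left]
  · rfl
  · intro h0
    have := Sticks.real_Icc_succ (S := S ω) hω.ne_top (K + i)
    have h1 : 0 ≤ (ν ω).real (Icc 0 ((S ω).y (K + i))) := measureReal_nonneg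
    have h2 : 0 ≤ (ν ω).real (Ioc ((S ω).y (K + i)) ((S ω).y (K + i + 1))) := measureReal_nonneg
    linarith

/-- If `Sticks.ancestorSet` contains the sticks that are glued at its points, then its proportion
converges. -/
theorem ae_exists_tendsto_proportion (hS : IsICRT P θ X S) {K : ℕ} (hK : 0 < K)
    {U : Set ((ℕ → ℝ≥0) × (ℝ≥0 × ℝ≥0))} (hU : MeasurableSet U)
    (hup : ∀ ω n, K ≤ n → (S ω).z n ∈ (S ω).ancestorSet K U →
      Ioc ((S ω).y n) ((S ω).y (n + 1)) ⊆ (S ω).ancestorSet K U) :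
    ∀ᵐ ω ∂P, ∃ a, Tendsto (fun n => ((massMeasure θ fun i => X i ω)[|Icc 0 ((S ω).y n)]).real
      ((S ω).ancestorSet K U)) atTop (𝓝 a) := by
  have hpm : ∀ k, Measurable[hS.gluingFiltration K k] (proportion θ X S K U k) := fun k =>
    measurable_proportion hK k hU
  have hβm : ∀ k, Measurable[hS.gluingFiltration K k] fun ω =>
      (stickRatio θ X S (K + k) ω).toReal := fun k =>
    (measurable_stickRatio (Nat.add_pos_left hK k) _).ennreal_toReal
  have hβ1 : ∀ k ω, (stickRatio θ X S (K + k) ω).toReal ≤ 1 := fun k ω =>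
    gluingKernel_real_le_one _ _ _
  have hdi : ∀ k, Integrable (fun ω => gluedIn S K U k ω - proportion θ X S K U k ω) P := fun k =>
    (hS.integrable_gluedIn hK k hU).sub (hS.integrable_proportion hK k hU)
  have hβi : ∀ k, Integrable (fun ω => (stickRatio θ X S (K + k) ω).toReal *
      (gluedIn S K U k ω - proportion θ X S K U k ω)) P := fun k =>
    (hdi k).bdd_mul ((hβm k).mono ((hS.gluingFiltration K).le k) le_rfl).aestronglyMeasurable
      (c := 1) (ae_of_all _ fun ω => by
        rw [Real.norm_of_nonneg ENNReal.toReal_nonneg]; exact hβ1 k ω)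
  have hsub : Submartingale (proportion θ X S K U) (hS.gluingFiltration K) P := by
    refine submartingale_of_condExp_sub_nonneg_nat (fun k => (hpm k).stronglyMeasurable)
      (fun k => hS.integrable_proportion hK k hU) fun k => ?_
    -- The right side dominates a predictable factor times a martingale difference, which gives the
    -- submartingale property. The inequality holds because a stick glued in the set lies entirely
    -- in it.
    have hmono : (fun ω => (stickRatio θ X S (K + k) ω).toReal *
        (gluedIn S K U k ω - proportion θ X S K U k ω)) ≤ᵐ[P]
        (proportion θ X S K U (k + 1) - proportion θ X S K U k) := by
      filter_upwards [hS.ae_isLocFin, hS.ae_isProbabilityMeasure_cond] with ω hfin hprob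
      set μ := massMeasure θ fun i => X i ω
      have hpos : ∀ n, 0 < n → 0 < μ.real (Icc 0 ((S ω).y n)) := fun n hn => by
        refine lt_of_le_of_ne measureReal_nonneg fun h0 => ?_
        have h1 := (hprob n hn)
        have h2 : (μ[|Icc 0 ((S ω).y n)]).real univ = 1 := probReal_univ
        rw [Sticks.cond_real, ← h0, div_zero] at h2
        exact zero_ne_one h2
      have hF := hpos (K + k) (Nat.add_pos_left hK k)
      have hF' := hpos (K + k + 1) (Nat.succ_pos _)
      have hβ : (stickRatio θ X S (K + k) ω).toReal =
          μ.real (Ioc ((S ω).y (K + k)) ((S ω).y (K + k + 1))) /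
            μ.real (Icc 0 ((S ω).y (K + k + 1))) := by
        rw [stickRatio, gluingKernel_apply hfin, ← measureReal_def]
        change (μ[|Icc 0 ((S ω).y (K + k + 1))]).real _ = _
        rw [Sticks.cond_real, inter_eq_right.2
          (Ioc_subset_Icc_self.trans (Icc_subset_Icc_left zero_le))]
      rw [Pi.sub_apply, hβ, proportion_eq hfin, proportion_eq hfin, Sticks.cond_real,
        Sticks.cond_real, ← add_assoc,
        Sticks.real_Icc_inter_succ hfin.ne_top _ ((S ω).measurableSet_ancestorSet K hU)]
      have hs := Sticks.real_Icc_succ (S := S ω) hfin.ne_top (K + k)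
      set w := μ.real (Ioc ((S ω).y (K + k)) ((S ω).y (K + k + 1)))
      set A := μ.real (Icc 0 ((S ω).y (K + k)) ∩ (S ω).ancestorSet K U)
      set F := μ.real (Icc 0 ((S ω).y (K + k)))
      have hge : w * gluedIn S K U k ω ≤
          μ.real (Ioc ((S ω).y (K + k)) ((S ω).y (K + k + 1)) ∩ (S ω).ancestorSet K U) := by
        by_cases hz : (S ω).z (K + k) ∈ (S ω).ancestorSet K U
        · rw [inter_eq_left.2 (hup ω (K + k) (Nat.le_add_right _ _) hz), gluedIn,
            indicator_of_mem hz]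
          simp [w]
        · rw [gluedIn, indicator_of_notMem hz, mul_zero]
          exact measureReal_nonneg
      rw [hs] at hF' ⊢
      calc w / (F + w) * (gluedIn S K U k ω - A / F)
          = (A + w * gluedIn S K U k ω) / (F + w) - A / F := by
            field_simp
            ring
        _ ≤ _ := by gcongr
    have h1 := condExp_mono (m := hS.gluingFiltration K k) (hβi k)
      ((hS.integrable_proportion hK (k + 1) hU).sub (hS.integrable_proportion hK k hU)) hmono
    have h2 := condExp_mul_of_stronglyMeasurable_left (m := hS.gluingFiltration K k) (μ := P)
      (hβm k).stronglyMeasurable (hβi k) (hdi k)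
    filter_upwards [h1, h2, hS.condExp_gluedIn_sub hK k hU] with ω h1 h2 h3
    refine le_trans (le_of_eq ?_) h1
    have h4 := h2
    rw [Pi.mul_apply, h3, Pi.zero_apply, mul_zero] at h4
    exact h4.symm
  have hconv := hsub.exists_ae_tendsto_of_bdd (R := 1) fun k => by
    rw [eLpNorm_one_eq_lintegral_enorm]
    calc ∫⁻ ω, ‖proportion θ X S K U k ω‖ₑ ∂P ≤ ∫⁻ _, 1 ∂P := lintegral_mono fun ω => by
          rw [← ofReal_norm, Real.norm_of_nonneg proportion_nonneg, ← ENNReal.ofReal_one]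
          exact ENNReal.ofReal_le_ofReal proportion_le_one
      _ = _ := by simp
  filter_upwards [hconv, hS.ae_isLocFin] with ω ⟨a, ha⟩ hfin
  refine ⟨a, ?_⟩
  rw [← tendsto_add_atTop_iff_nat K]
  refine ha.congr fun k => ?_
  rw [proportion_eq hfin, add_comm k K]

end IsICRT

end

end ICRT

namespace ICRT

/-! ### Heights -/

theorem measurable_tsum_nat {α : Type*} {m : MeasurableSpace α} {f : ℕ → α → ℝ≥0∞}
    (h : ∀ n, Measurable (f n)) : Measurable fun ω => ∑' n, f n ω := Measurable.tsum h

section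

variable {Ω : Type*} {mΩ : MeasurableSpace Ω} {P : Measure Ω}
  {θ : ℕ → ℝ≥0} {X : ℕ → Ω → ℝ≥0} {S : Ω → Sticks}

/-- The contribution of the stick of index `n` to the mean height. -/
def stickHeight (θ : ℕ → ℝ≥0) (X : ℕ → Ω → ℝ≥0) (S : Ω → Sticks) (n : ℕ) (ω : Ω) : ℝ≥0∞ :=
  ∫⁻ x in Ioc ((S ω).y n) ((S ω).y (n + 1)), ((x - (S ω).y n : ℝ≥0) : ℝ≥0∞)
    ∂(gluingKernel (n + 1) (massCuts θ X S ω))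

/-- The mean height above `[0, Y K]` of the points of `[0, Y (K + k)]`. -/
def meanHeight (θ : ℕ → ℝ≥0) (X : ℕ → Ω → ℝ≥0) (S : Ω → Sticks) (K k : ℕ) (ω : Ω) : ℝ≥0∞ :=
  ∫⁻ x, ((stepAncestor (gluingState θ X S (K + k) ω).1.2 (gluingState θ X S (K + k) ω).2 K k x).2 :
    ℝ≥0∞) ∂(gluingKernel (K + k) (massCuts θ X S ω))

theorem measurable_stickHeight (n : ℕ) :
    Measurable[sigmaMassCuts θ X S] (stickHeight θ X S n) := by
  have h : ∀ n, Measurable fun p : (Measure ℝ≥0 × (ℕ → ℝ≥0)) × ℝ≥0 => p.1.2 n := fun n =>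
    (measurable_pi_apply n).comp (measurable_snd.comp measurable_fst)
  have hs : MeasurableSet {p : (Measure ℝ≥0 × (ℕ → ℝ≥0)) × ℝ≥0 |
      p.2 ∈ Ioc (p.1.2 n) (p.1.2 (n + 1))} := by
    have h1 := measurableSet_lt (h n) measurable_snd
    have h2 := measurableSet_le measurable_snd (h (n + 1))
    exact h1.inter h2
  have hf : Measurable ({p : (Measure ℝ≥0 × (ℕ → ℝ≥0)) × ℝ≥0 |
      p.2 ∈ Ioc (p.1.2 n) (p.1.2 (n + 1))}.indicator fun p => ((p.2 - p.1.2 n : ℝ≥0) : ℝ≥0∞)) :=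
    (measurable_snd.sub (h n)).coe_nnreal_ennreal.indicator hs
  have h3 := (hf.lintegral_kernel_prod_right' (κ := gluingKernel (n + 1))).comp
    (measurable_massCuts (θ := θ) (X := X) (S := S))
  convert h3 using 1
  funext ω
  rw [stickHeight, ← lintegral_indicator measurableSet_Ioc]
  rfl

theorem measurable_height_state (K k : ℕ) :
    Measurable fun p : ((Measure ℝ≥0 × (ℕ → ℝ≥0)) × (ℕ → ℝ≥0)) × ℝ≥0 =>
      ((stepAncestor p.1.1.2 p.1.2 K k p.2).2 : ℝ≥0∞) :=
  (measurable_stepAncestor_state K k).snd.coe_nnreal_ennreal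

theorem measurable_meanHeight {K : ℕ} (hK : 0 < K) (k : ℕ) :
    Measurable[history (gluingEvents θ X S) (K + k)] (meanHeight θ X S K k) := by
  have h := (measurable_height_state K k).lintegral_kernel_prod_right'
    (κ := (gluingKernel (K + k)).comap Prod.fst
    (measurable_fst (α := Measure ℝ≥0 × (ℕ → ℝ≥0)) (β := ℕ → ℝ≥0)))
  exact h.comp (measurable_gluingState (Nat.add_pos_left hK k))

theorem cond_Icc_restrict_self (μ : Measure ℝ≥0) (a : ℝ≥0) :
    (μ[|Icc 0 a]).restrict (Icc 0 a) = μ[|Icc 0 a] := by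
  simp only [ProbabilityTheory.cond]
  rw [Measure.restrict_smul, Measure.restrict_restrict measurableSet_Icc, inter_self]

theorem meanHeight_eq {K k : ℕ} {ω : Ω} (h : IsLocFin (massMeasure θ fun i => X i ω)) :
    meanHeight θ X S K k ω = ∫⁻ x, (((S ω).ancestor K x).2 : ℝ≥0∞)
      ∂((massMeasure θ fun i => X i ω)[|Icc 0 ((S ω).y (K + k))]) := by
  rw [meanHeight, gluingKernel_apply h]
  change ∫⁻ x, _ ∂((massMeasure θ fun i => X i ω)[|Icc 0 ((S ω).y (K + k))]) = _
  rw [← cond_Icc_restrict_self]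
  refine setLIntegral_congr_fun measurableSet_Icc fun x hx => ?_
  simp only [stepAncestor_gluingState hx.2]

theorem meanHeight_zero {K : ℕ} {ω : Ω} (h : IsLocFin (massMeasure θ fun i => X i ω)) :
    meanHeight θ X S K 0 ω = 0 := by
  rw [meanHeight_eq h, ← cond_Icc_restrict_self]
  rw [setLIntegral_congr_fun (g := fun _ => 0) measurableSet_Icc fun x hx => ?_]
  · simp
  · have hx' : x ≤ (S ω).y K := hx.2
    simp only [(S ω).ancestor_of_le hx', ENNReal.coe_zero]

/-- The mass splits into the old part and the last stick; on the stick, the height is that of the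
gluing point plus the distance run along the stick. -/
theorem meanHeight_succ {K k : ℕ} {ω : Ω} (h : IsLocFin (massMeasure θ fun i => X i ω))
    (h0 : massMeasure θ (fun i => X i ω) (Icc 0 ((S ω).y (K + k))) ≠ 0)
    (h1 : IsProbabilityMeasure
      ((massMeasure θ fun i => X i ω)[|Icc 0 ((S ω).y (K + k + 1))])) :
    meanHeight θ X S K (k + 1) ω = (1 - stickRatio θ X S (K + k) ω) * meanHeight θ X S K k ω +
      stickRatio θ X S (K + k) ω * (((S ω).ancestor K ((S ω).z (K + k))).2 : ℝ≥0∞) +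
      stickHeight θ X S (K + k) ω := by
  set n := K + k
  set μ := massMeasure θ fun i => X i ω
  have hm := (S ω).strictMono_y.monotone (Nat.le_succ n)
  have hd : Disjoint (Icc 0 ((S ω).y n)) (Ioc ((S ω).y n) ((S ω).y (n + 1))) :=
    disjoint_left.2 fun x hx hx' => hx'.1.not_ge hx.2
  have hU : Icc 0 ((S ω).y n) ∪ Ioc ((S ω).y n) ((S ω).y (n + 1)) = Icc 0 ((S ω).y (n + 1)) :=
    Icc_union_Ioc_eq_Icc zero_le hm
  have hκ : gluingKernel (n + 1) (massCuts θ X S ω) = μ[|Icc 0 ((S ω).y (n + 1))] :=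
    gluingKernel_apply h
  have hone : (μ[|Icc 0 ((S ω).y (n + 1))]) (Icc 0 ((S ω).y n)) =
      1 - stickRatio θ X S n ω := by
    have h2 : (μ[|Icc 0 ((S ω).y (n + 1))]) (Icc 0 ((S ω).y (n + 1))) = 1 := by
      rw [← Measure.restrict_apply_univ, cond_Icc_restrict_self, measure_univ]
    rw [← hU, measure_union hd measurableSet_Ioc, hU] at h2
    rw [stickRatio, hκ]
    exact ENNReal.eq_sub_of_add_eq (measure_ne_top _ _) h2
  rw [meanHeight_eq h, meanHeight_eq h, ← add_assoc]
  change ∫⁻ x, _ ∂(μ[|Icc 0 ((S ω).y (n + 1))]) = _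
  conv_lhs => rw [← cond_Icc_restrict_self, ← hU]
  rw [lintegral_union measurableSet_Ioc hd]
  rw [hU, cond_Icc_restrict hm h0 (h.ne_top _), lintegral_smul_measure, hone, smul_eq_mul,
    add_assoc (_ : ℝ≥0∞)]
  congr 1
  rw [stickRatio, stickHeight, hκ, mul_comm, ← setLIntegral_const,
    ← lintegral_add_left measurable_const]
  refine setLIntegral_congr_fun measurableSet_Ioc fun x hx => ?_
  simp only [(S ω).ancestor_of_mem_Ioc (Nat.le_add_right K k) hx, ENNReal.coe_add]
  rfl

namespace IsICRT

variable [IsProbabilityMeasure P]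

/-- Averaging over the gluing point turns its height into the current mean height. The two terms
with `stickRatio` then recombine, and only the contribution of the new stick is added. -/
theorem setLIntegral_meanHeight_succ (hS : IsICRT P θ X S) {K : ℕ} (hK : 0 < K) (k : ℕ)
    {D : Set Ω} (hD : MeasurableSet[sigmaMassCuts θ X S] D) :
    ∫⁻ ω in D, meanHeight θ X S K (k + 1) ω ∂P =
      ∫⁻ ω in D, meanHeight θ X S K k ω ∂P + ∫⁻ ω in D, stickHeight θ X S (K + k) ω ∂P := by
  have hn : 0 < K + k := Nat.add_pos_left hK k
  have hD' := sigmaMassCuts_le_history hn _ hD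
  have hle := history_le hS.measurableSet_gluingEvents (K + k)
  have hβ : Measurable (stickRatio θ X S (K + k)) := (measurable_stickRatio hn _).mono hle le_rfl
  have hM : Measurable (meanHeight θ X S K k) := (measurable_meanHeight hK k).mono hle le_rfl
  have hc : Measurable (stickHeight θ X S (K + k)) :=
    (measurable_stickHeight _).mono hS.sigmaMassCuts_le le_rfl
  have hβs : Measurable fun p : ((Measure ℝ≥0 × (ℕ → ℝ≥0)) × (ℕ → ℝ≥0)) × ℝ≥0 =>
      gluingKernel (K + k + 1) p.1.1 (Ioc (p.1.1.2 (K + k)) (p.1.1.2 (K + k + 1))) := by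
    have h : ∀ n, Measurable fun p : (Measure ℝ≥0 × (ℕ → ℝ≥0)) × ℝ≥0 => p.1.2 n := fun n =>
      (measurable_pi_apply n).comp (measurable_snd.comp measurable_fst)
    have hs : MeasurableSet {p : (Measure ℝ≥0 × (ℕ → ℝ≥0)) × ℝ≥0 |
        p.2 ∈ Ioc (p.1.2 (K + k)) (p.1.2 (K + k + 1))} := by
      have h1 := measurableSet_lt (h (K + k)) measurable_snd
      have h2 := measurableSet_le measurable_snd (h (K + k + 1))
      exact h1.inter h2
    exact (Kernel.measurable_kernel_prodMk_left hs).comp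
      (measurable_fst.comp measurable_fst)
  have hz := hS.setLIntegral_gluing hn (hβs.mul (measurable_height_state K k)) hD'
  have hz1 : ∫⁻ ω in D, stickRatio θ X S (K + k) ω *
      (((S ω).ancestor K ((S ω).z (K + k))).2 : ℝ≥0∞) ∂P =
      ∫⁻ ω in D, stickRatio θ X S (K + k) ω * meanHeight θ X S K k ω ∂P := by
    convert hz using 1
    · refine lintegral_congr fun ω => ?_
      simp only [Pi.mul_apply]
      rw [stepAncestor_gluingState ((S ω).z_le _)]
      rfl
    · refine lintegral_congr fun ω => ?_
      simp only [Pi.mul_apply]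
      rw [lintegral_const_mul]
      · rfl
      · exact (measurable_height_state K k).comp measurable_prodMk_left
  have hrec : ∀ᵐ ω ∂P, meanHeight θ X S K (k + 1) ω =
      (1 - stickRatio θ X S (K + k) ω) * meanHeight θ X S K k ω +
      stickRatio θ X S (K + k) ω * (((S ω).ancestor K ((S ω).z (K + k))).2 : ℝ≥0∞) +
      stickHeight θ X S (K + k) ω := by
    filter_upwards [hS.ae_isLocFin, hS.ae_isProbabilityMeasure_cond] with ω hfin hprob
    refine meanHeight_succ hfin (fun h0 => ?_) (hprob _ (Nat.succ_pos _))
    have := (hprob _ hn).measure_univ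
    rw [cond_apply measurableSet_Icc, inter_univ, h0, mul_zero] at this
    exact zero_ne_one this
  have h1 : Measurable fun ω => (1 - stickRatio θ X S (K + k) ω) * meanHeight θ X S K k ω :=
    (measurable_const.sub hβ).mul hM
  rw [lintegral_congr_ae (ae_restrict_of_ae hrec), lintegral_add_right _ hc,
    lintegral_add_left h1, hz1, ← lintegral_add_left h1]
  congr 1
  refine lintegral_congr fun ω => ?_
  rw [← add_mul, tsub_add_cancel_of_le, one_mul]
  exact (measure_mono (subset_univ _)).trans (gluingKernel_apply_univ_le _ _)

theorem setLIntegral_meanHeight_le (hS : IsICRT P θ X S) {K : ℕ} (hK : 0 < K) (k : ℕ)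
    {D : Set Ω} (hD : MeasurableSet[sigmaMassCuts θ X S] D) :
    ∫⁻ ω in D, meanHeight θ X S K k ω ∂P ≤
      ∑' n, ∫⁻ ω in D, stickHeight θ X S (n + K) ω ∂P := by
  refine le_trans (le_of_eq ?_) (ENNReal.sum_le_tsum (Finset.range k))
  induction k with
  | zero =>
    have h : ∀ᵐ ω ∂P, meanHeight θ X S K 0 ω = 0 := by
      filter_upwards [hS.ae_isLocFin] with ω hfin
      exact meanHeight_zero hfin
    rw [lintegral_congr_ae (ae_restrict_of_ae h)]
    simp
  | succ k ih =>
    rw [hS.setLIntegral_meanHeight_succ hK k hD, ih, Finset.sum_range_succ, add_comm k K]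

/-- The condition that defines `Sticks.heightSet`. -/
def highSet (ε : ℝ≥0) : Set ((ℕ → ℝ≥0) × (ℝ≥0 × ℝ≥0)) := {p | ε < p.2.2}

theorem measurableSet_highSet (ε : ℝ≥0) : MeasurableSet (highSet ε) :=
  measurableSet_lt measurable_const (measurable_snd.comp measurable_snd)

theorem ancestorSet_highSet (S : Sticks) (K : ℕ) (ε : ℝ≥0) :
    S.ancestorSet K (highSet ε) = S.heightSet K ε := rfl

theorem ae_exists_tendsto_heightSet (hS : IsICRT P θ X S) {K : ℕ} (hK : 0 < K) (ε : ℝ≥0) :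
    ∀ᵐ ω ∂P, ∃ a, Tendsto (fun n => ((massMeasure θ fun i => X i ω)[|Icc 0 ((S ω).y n)]).real
      ((S ω).heightSet K ε)) atTop (𝓝 a) := by
  have h := hS.ae_exists_tendsto_proportion hK (measurableSet_highSet ε)
  simp only [ancestorSet_highSet] at h
  refine h fun ω n hn hz x hx => ?_
  change ε < ((S ω).ancestor K x).2
  rw [(S ω).ancestor_of_mem_Ioc hn hx]
  exact lt_of_lt_of_le (show ε < ((S ω).ancestor K ((S ω).z n)).2 from hz) le_self_add

/-- On the event that the total stick height is at most `C`, the integrated mean height above `[0,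
Y_K]` is bounded by the tail of a convergent series. Markov's inequality transfers this to the
proportion of high points. -/
theorem ae_exists_heightSet_lt_of_mem (hS : IsICRT P θ X S) (C : ℝ≥0) (q : ℕ) :
    ∀ᵐ ω ∂P, ∑' n, stickHeight θ X S n ω ≤ C → ∀ δ : ℝ, 0 < δ → ∃ K, 0 < K ∧ ∃ a < δ,
      Tendsto (fun n => ((massMeasure θ fun i => X i ω)[|Icc 0 ((S ω).y n)]).real
        ((S ω).heightSet K (1 / (q + 1)))) atTop (𝓝 a) := by
  set D : Set Ω := {ω | ∑' n, stickHeight θ X S n ω ≤ C} with hDdef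
  have hDm : MeasurableSet[sigmaMassCuts θ X S] D :=
    measurableSet_le (measurable_tsum_nat fun n => measurable_stickHeight n) measurable_const
  set T : ℕ → ℝ≥0∞ := fun K => ∑' n, ∫⁻ ω in D, stickHeight θ X S (n + K) ω ∂P with hT
  have hTlim : Tendsto T atTop (𝓝 0) := by
    refine ENNReal.tendsto_sum_nat_add (fun n => ∫⁻ ω in D, stickHeight θ X S n ω ∂P) ?_
    rw [← lintegral_tsum fun n =>
      ((measurable_stickHeight n).mono hS.sigmaMassCuts_le le_rfl).aemeasurable]
    refine ne_top_of_le_ne_top (b := (C : ℝ≥0∞) * P D) (by finiteness) ?_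
    rw [← setLIntegral_const]
    exact setLIntegral_mono' (hS.sigmaMassCuts_le _ hDm) fun ω hω => hω
  set M : ℕ → ℕ → Ω → ℝ≥0∞ := fun K k ω => gluingKernel (K + k) (massCuts θ X S ω)
    (Prod.mk (gluingState θ X S (K + k) ω) ⁻¹' stateSet K k (highSet (1 / (q + 1)))) with hM
  have hMm : ∀ K, 0 < K → ∀ k, Measurable (M K k) := fun K hK k =>
    (measurable_gluingKernel_section (Nat.add_pos_left hK k)
      (measurableSet_stateSet K k (measurableSet_highSet _))).mono
      (history_le hS.measurableSet_gluingEvents (K + k)) le_rfl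
  have hmarkov : ∀ K k ω, M K k ω ≤ (q + 1) * meanHeight θ X S K k ω := by
    intro K k ω
    have hm : Measurable fun x => ((stepAncestor (gluingState θ X S (K + k) ω).1.2
        (gluingState θ X S (K + k) ω).2 K k x).2 : ℝ≥0∞) :=
      (measurable_height_state K k).comp measurable_prodMk_left
    rw [meanHeight, ← lintegral_const_mul _ hm]
    change gluingKernel (K + k) (massCuts θ X S ω) _ ≤ _
    rw [← lintegral_indicator_one (measurable_prodMk_left
      (measurableSet_stateSet K k (measurableSet_highSet _)))]
    refine lintegral_mono fun x => ?_
    by_cases hx : x ∈ Prod.mk (gluingState θ X S (K + k) ω) ⁻¹'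
      stateSet K k (highSet (1 / (q + 1)))
    swap
    · rw [indicator_of_notMem hx]
      exact zero_le
    rw [indicator_of_mem hx, Pi.one_apply]
    have hx' : (1 / (q + 1) : ℝ≥0) < (stepAncestor (gluingState θ X S (K + k) ω).1.2
      (gluingState θ X S (K + k) ω).2 K k x).2 := hx
    rw [div_lt_iff₀' (by positivity)] at hx'
    have h2 : ((1 : ℝ≥0) : ℝ≥0∞) ≤ (((q : ℝ≥0) + 1) * (stepAncestor (gluingState θ X S (K + k) ω).1.2
      (gluingState θ X S (K + k) ω).2 K k x).2 : ℝ≥0) := ENNReal.coe_le_coe.2 hx'.le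
    push_cast at h2
    exact h2
  -- Fatou's lemma is used twice, in the time and in the level `K`; a zero iterated lower limit is
  -- enough, since a single good `K` is required.
  have hzero : ∫⁻ ω in D, liminf (fun K => liminf (fun k => M (K + 1) k ω) atTop) atTop ∂P = 0 := by
    refine le_antisymm ?_ zero_le
    refine (lintegral_liminf_le fun K => Measurable.liminf (hMm (K + 1) K.succ_pos)).trans ?_
    have hb : ∀ K, ∫⁻ ω in D, liminf (fun k => M (K + 1) k ω) atTop ∂P ≤ (q + 1) * T (K + 1) := by
      intro K
      refine (lintegral_liminf_le (hMm (K + 1) K.succ_pos)).trans ?_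
      refine liminf_le_of_le (by isBoundedDefault) fun b hb => ?_
      obtain ⟨k, hk⟩ := hb.exists
      refine hk.trans ?_
      calc ∫⁻ ω in D, M (K + 1) k ω ∂P
          ≤ ∫⁻ ω in D, (q + 1) * meanHeight θ X S (K + 1) k ω ∂P := lintegral_mono fun ω =>
            hmarkov _ _ _
        _ = (q + 1) * ∫⁻ ω in D, meanHeight θ X S (K + 1) k ω ∂P :=
          lintegral_const_mul _ ((measurable_meanHeight K.succ_pos k).mono
            (history_le hS.measurableSet_gluingEvents _) le_rfl)
        _ ≤ _ := by
          gcongr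
          exact hS.setLIntegral_meanHeight_le K.succ_pos k hDm
    have hlim : Tendsto (fun K => ((q : ℝ≥0∞) + 1) * T (K + 1)) atTop (𝓝 0) := by
      have := ENNReal.Tendsto.const_mul (a := (q : ℝ≥0∞) + 1)
        ((tendsto_add_atTop_iff_nat 1).2 hTlim) (Or.inr (by finiteness))
      rwa [mul_zero] at this
    rw [← hlim.liminf_eq]
    exact liminf_le_liminf (Eventually.of_forall hb)
  rw [lintegral_eq_zero_iff (Measurable.liminf fun K =>
    Measurable.liminf (hMm (K + 1) K.succ_pos)),
    Filter.EventuallyEq, ae_restrict_iff' (hS.sigmaMassCuts_le _ hDm)] at hzero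
  have hlim : ∀ᵐ ω ∂P, ∀ K, 0 < K → ∃ a, Tendsto (fun n =>
      ((massMeasure θ fun i => X i ω)[|Icc 0 ((S ω).y n)]).real
        ((S ω).heightSet K (1 / (q + 1)))) atTop (𝓝 a) :=
    ae_all_iff.2 fun K => by
      by_cases hK : 0 < K
      · filter_upwards [hS.ae_exists_tendsto_heightSet hK (1 / (q + 1))] with ω hω _ using hω
      · exact ae_of_all _ fun ω h => absurd h hK
  filter_upwards [hzero, hlim, hS.ae_isLocFin] with ω h0 hlim hfin hω δ hδ
  have h1 : liminf (fun K => liminf (fun k => M (K + 1) k ω) atTop) atTop < ENNReal.ofReal δ := by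
    rw [h0 hω]
    simpa using hδ
  obtain ⟨K, hK⟩ := (frequently_lt_of_liminf_lt (by isBoundedDefault) h1).exists
  obtain ⟨a, ha⟩ := hlim (K + 1) K.succ_pos
  refine ⟨K + 1, K.succ_pos, a, ?_, ha⟩
  -- The proportion converges by the submartingale property, so the inner lower limit is its limit.
  have h2 : Tendsto (fun k => M (K + 1) k ω) atTop (𝓝 (ENNReal.ofReal a)) := by
    have h3 := (ENNReal.continuous_ofReal.tendsto a).comp
      ((tendsto_add_atTop_iff_nat (K + 1)).2 ha)
    refine h3.congr fun k => ?_
    have h4 := proportion_eq (θ := θ) (X := X) (S := S) (K := K + 1) (k := k) hfin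
      (highSet (1 / (q + 1)))
    rw [Function.comp_apply, add_comm k, ← ancestorSet_highSet, ← h4, proportion, ofReal_measureReal]
  rw [h2.liminf_eq] at hK
  exact (ENNReal.ofReal_lt_ofReal_iff hδ).1 hK

theorem ae_exists_heightSet_lt (hS : IsICRT P θ X S)
    (hc : ∀ᵐ ω ∂P, ∑' n, stickHeight θ X S n ω ≠ ∞) :
    ∀ᵐ ω ∂P, ∀ q : ℕ, ∀ δ : ℝ, 0 < δ → ∃ K, 0 < K ∧ ∃ a < δ,
      Tendsto (fun n => ((massMeasure θ fun i => X i ω)[|Icc 0 ((S ω).y n)]).real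
        ((S ω).heightSet K (1 / (q + 1)))) atTop (𝓝 a) := by
  have h : ∀ᵐ ω ∂P, ∀ C q : ℕ, ∑' n, stickHeight θ X S n ω ≤ (C : ℝ≥0) →
      ∀ δ : ℝ, 0 < δ → ∃ K, 0 < K ∧ ∃ a < δ,
      Tendsto (fun n => ((massMeasure θ fun i => X i ω)[|Icc 0 ((S ω).y n)]).real
        ((S ω).heightSet K (1 / (q + 1)))) atTop (𝓝 a) :=
    ae_all_iff.2 fun C => ae_all_iff.2 fun q => hS.ae_exists_heightSet_lt_of_mem C q
  filter_upwards [h, hc] with ω h hc q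
  obtain ⟨C, hC⟩ := ENNReal.exists_nat_gt hc
  exact h C q (by exact_mod_cast hC.le)

end IsICRT

end

end ICRT

namespace ICRT

/-! ### Lebesgue measure on the half-line -/

theorem measurableEmbedding_coe_nnreal : MeasurableEmbedding ((↑) : ℝ≥0 → ℝ) :=
  MeasurableEmbedding.subtype_coe measurableSet_Ici

theorem lebesgue_Ioc (a b : ℝ≥0) : lebesgue (Ioc a b) = ((b - a : ℝ≥0) : ℝ≥0∞) := by
  have h : ((↑) : ℝ≥0 → ℝ) '' Ioc a b = Ioc (a : ℝ) b := by
    ext x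
    constructor
    · rintro ⟨u, ⟨h1, h2⟩, rfl⟩
      exact ⟨NNReal.coe_lt_coe.2 h1, NNReal.coe_le_coe.2 h2⟩
    · rintro ⟨h1, h2⟩
      exact ⟨⟨x, a.2.trans h1.le⟩, ⟨NNReal.coe_lt_coe.1 h1, NNReal.coe_le_coe.1 h2⟩, rfl⟩
  rw [lebesgue, measurableEmbedding_coe_nnreal.comap_apply, h, Real.volume_Ioc,
    NNReal.sub_def]
  rfl

theorem lebesgue_singleton (a : ℝ≥0) : lebesgue {a} = 0 := by
  rw [lebesgue, measurableEmbedding_coe_nnreal.comap_apply, image_singleton, Real.volume_singleton]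

theorem lebesgue_Icc_zero (b : ℝ≥0) : lebesgue (Icc 0 b) = b := by
  have h : Icc 0 b = {0} ∪ Ioc 0 b := by
    ext x
    simp only [mem_Icc, mem_union, mem_singleton_iff, mem_Ioc]
    rcases eq_or_ne x 0 with rfl | h
    · simp
    · simp [h, pos_iff_ne_zero]
  refine le_antisymm ?_ ?_
  · rw [h]
    refine (measure_union_le _ _).trans ?_
    rw [lebesgue_singleton, lebesgue_Ioc, zero_add, tsub_zero]
  · refine le_trans ?_ (measure_mono Ioc_subset_Icc_self)
    rw [lebesgue_Ioc, tsub_zero]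

theorem lebesgue_univ : lebesgue univ = ∞ := by
  refine ENNReal.eq_top_of_forall_nnreal_le fun r => ?_
  rw [← lebesgue_Icc_zero r]
  exact measure_mono (subset_univ _)

instance : SigmaFinite lebesgue := by
  refine ⟨⟨⟨fun n : ℕ => Icc 0 (n : ℝ≥0), fun _ => trivial, fun n => ?_, ?_⟩⟩⟩
  · rw [lebesgue_Icc_zero]
    exact ENNReal.coe_lt_top
  · refine eq_univ_of_forall fun x => ?_
    obtain ⟨n, hn⟩ := exists_nat_ge x
    exact mem_iUnion.2 ⟨n, zero_le, hn⟩

/-! ### The cuts as a point configuration -/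

namespace Sticks

variable (S : Sticks)

theorem cutMeasure_eq_zero_iff {A : Set ℝ≥0} (hA : MeasurableSet A) :
    S.cutMeasure A = 0 ↔ ∀ i, S.y (i + 1) ∉ A := by
  rw [cutMeasure, Measure.sum_apply _ hA, ENNReal.tsum_eq_zero]
  refine forall_congr' fun i => ?_
  rw [Measure.dirac_apply' _ hA]
  by_cases h : S.y (i + 1) ∈ A
  · simp [h]
  · simp [h]

theorem cutMeasure_Ioc (n : ℕ) : S.cutMeasure (Ioc (S.y n) (S.y (n + 1))) = 1 := by
  rw [cutMeasure, Measure.sum_apply _ measurableSet_Ioc, tsum_eq_single n]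
  · rw [Measure.dirac_apply' _ measurableSet_Ioc, indicator_of_mem]
    · rfl
    · exact ⟨S.strictMono_y (Nat.lt_succ_self n), le_rfl⟩
  · intro i hi
    rw [Measure.dirac_apply' _ measurableSet_Ioc, indicator_of_notMem]
    rintro ⟨h1, h2⟩
    have h3 := S.strictMono_y.lt_iff_lt.1 h1
    have h4 := S.strictMono_y.le_iff_le.1 h2
    omega

theorem cutMeasure_Icc (n : ℕ) : S.cutMeasure (Icc 0 (S.y n)) = n := by
  induction n with
  | zero =>
    rw [S.y_zero, S.cutMeasure_eq_zero_iff measurableSet_Icc |>.2]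
    · simp
    · rintro i ⟨-, h⟩
      have := S.strictMono_y (Nat.succ_pos i)
      rw [S.y_zero] at this
      exact this.not_ge h
  | succ n ih =>
    have hm := S.strictMono_y.monotone (Nat.le_succ n)
    have hd : Disjoint (Icc 0 (S.y n)) (Ioc (S.y n) (S.y (n + 1))) :=
      disjoint_left.2 fun x hx hx' => hx'.1.not_ge hx.2
    rw [← Icc_union_Ioc_eq_Icc zero_le hm, measure_union hd measurableSet_Ioc, ih,
      S.cutMeasure_Ioc]
    simp

/-- The cell of mesh `1 / m` and index `j` contains no cut. -/
def EmptyCell (m j : ℕ) : Prop := ∀ n, ⌈S.y (n + 1) * m⌉₊ ≠ j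

open Classical in
/-- The indicator of `EmptyCell m (j + 1)`. -/
def emptyInd (m j : ℕ) : ℝ := if S.EmptyCell m (j + 1) then 1 else 0

/-- The number of empty cells is given, up to an error of smaller order than `J ^ (3 / 4)`, by the
sum of weights that tend to `0`. -/
def SparseEmptyCells (m : ℕ) : Prop :=
  ∃ q : ℕ → ℝ, Tendsto q atTop (𝓝 0) ∧ Tendsto (fun J : ℕ =>
    (∑ j ∈ Finset.range J, (S.emptyInd m j - q j)) / (J : ℝ) ^ (3 / 4 : ℝ)) atTop (𝓝 0)

/-- The index of the cell of mesh `1 / m` that contains `y n`. -/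
def cellIndex (m n : ℕ) : ℕ := ⌈S.y n * m⌉₊

variable {S}

theorem emptyInd_nonneg (m j : ℕ) : 0 ≤ S.emptyInd m j := by
  rw [emptyInd]; split_ifs <;> norm_num

theorem cellIndex_mono (m : ℕ) : Monotone (S.cellIndex m) := fun a b h => by
  have := S.strictMono_y.monotone h
  exact Nat.ceil_mono (by gcongr)

theorem le_cellIndex (m n : ℕ) : (S.y n : ℝ) * m ≤ S.cellIndex m n := by
  exact_mod_cast Nat.le_ceil (S.y n * m : ℝ≥0)

theorem cellIndex_lt (m n : ℕ) : (S.cellIndex m n : ℝ) < S.y n * m + 1 := by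
  exact_mod_cast Nat.ceil_lt_add_one (zero_le (a := S.y n * m))

theorem tendsto_cellIndex {m : ℕ} (hm : 0 < m) : Tendsto (S.cellIndex m) atTop atTop := by
  refine tendsto_nat_ceil_atTop.comp ?_
  exact S.tendsto_y.atTop_mul_const (by exact_mod_cast hm)

/-- `emptyInd m j` refers to the cell `j + 1`, so the hypotheses place that cell strictly between
those of two consecutive cuts. -/
theorem emptyInd_eq_one {m i j : ℕ} (h1 : S.cellIndex m i ≤ j)
    (h2 : j + 1 < S.cellIndex m (i + 1)) : S.emptyInd m j = 1 := by
  rw [emptyInd, if_pos]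
  intro n hn
  change S.cellIndex m (n + 1) = j + 1 at hn
  rcases le_or_gt (n + 1) i with h | h
  · have := cellIndex_mono (S := S) m h
    omega
  · have := cellIndex_mono (S := S) m (show i + 1 ≤ n + 1 by omega)
    omega

/-- Every cell strictly between those of consecutive cuts is empty; the `1` accounts for the cell of
the later cut. -/
theorem sub_one_le_sum_Ico (m i : ℕ) :
    (S.cellIndex m (i + 1) : ℝ) - S.cellIndex m i - 1 ≤
      ∑ j ∈ Finset.Ico (S.cellIndex m i) (S.cellIndex m (i + 1)), S.emptyInd m j := by
  have hmono := cellIndex_mono (S := S) m (Nat.le_succ i)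
  rcases hmono.eq_or_lt with h | h
  · rw [Nat.succ_eq_add_one] at h
    simp [h]
  · obtain ⟨b, hb⟩ : ∃ b, S.cellIndex m (i + 1) = b + 1 :=
      Nat.exists_eq_succ_of_ne_zero (by rw [← Nat.succ_eq_add_one]; omega)
    rw [Nat.succ_eq_add_one, hb] at h
    rw [hb, Finset.sum_Ico_succ_top (by omega)]
    have h1 : ∑ j ∈ Finset.Ico (S.cellIndex m i) b, S.emptyInd m j =
        (b : ℝ) - S.cellIndex m i := by
      rw [Finset.sum_congr rfl fun j hj => emptyInd_eq_one (i := i) (Finset.mem_Ico.1 hj).1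
        (by have := (Finset.mem_Ico.1 hj).2; omega)]
      simp [Nat.cast_sub (show S.cellIndex m i ≤ b by omega)]
    have := emptyInd_nonneg (S := S) m b
    push_cast
    linarith

/-- The number of empty cells up to the one that contains `y n`. -/
def emptyCount (S : Sticks) (m n : ℕ) : ℝ :=
  ∑ j ∈ Finset.range (S.cellIndex m n), S.emptyInd m j

theorem emptyCount_succ (m n : ℕ) : S.emptyCount m (n + 1) = S.emptyCount m n +
    ∑ j ∈ Finset.Ico (S.cellIndex m n) (S.cellIndex m (n + 1)), S.emptyInd m j :=
  (Finset.sum_range_add_sum_Ico _ (cellIndex_mono m (Nat.le_succ n))).symm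

/-- The weights have Cesàro means tending to `0`, and the error is of smaller order than `J ^ (3 /
4)`. -/
theorem SparseEmptyCells.tendsto_emptyCount {m : ℕ} (hm : 0 < m) (h : S.SparseEmptyCells m) :
    Tendsto (fun n => S.emptyCount m n / S.cellIndex m n) atTop (𝓝 0) := by
  obtain ⟨q, hq, hD⟩ := h
  have h1 : Tendsto (fun J : ℕ => (∑ j ∈ Finset.range J, S.emptyInd m j) / (J : ℝ)) atTop
      (𝓝 0) := by
    have h2 := hq.cesaro
    have h3 : Tendsto (fun J : ℕ => (J : ℝ) ^ (-(1 / 4) : ℝ)) atTop (𝓝 0) :=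
      (tendsto_rpow_neg_atTop (by norm_num)).comp tendsto_natCast_atTop_atTop
    have h4 := (hD.mul h3).add h2
    rw [mul_zero, add_zero] at h4
    refine h4.congr' ?_
    filter_upwards [eventually_gt_atTop 0] with J hJ
    have hJ' : (0 : ℝ) < J := by exact_mod_cast hJ
    have h5 : (J : ℝ) ^ (3 / 4 : ℝ) ≠ 0 := (Real.rpow_pos_of_pos hJ' _).ne'
    have h6 : (J : ℝ) ^ (-(1 / 4) : ℝ) = (J : ℝ) ^ (3 / 4 : ℝ) / J := by
      rw [eq_div_iff hJ'.ne', ← Real.rpow_add_one hJ'.ne']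
      norm_num
    rw [h6, div_mul_div_cancel₀ h5, Finset.sum_sub_distrib]
    field_simp
    ring
  exact h1.comp (tendsto_cellIndex hm)

theorem sum_gap_le {m : ℕ} (n : ℕ) :
    ∑ i ∈ Finset.range n, max 0 ((S.cellIndex m (i + 1) : ℝ) - S.cellIndex m i - 1) ≤
      S.emptyCount m n := by
  induction n with
  | zero => exact Finset.sum_nonneg fun j _ => emptyInd_nonneg _ _
  | succ n ih =>
    rw [Finset.sum_range_succ, emptyCount_succ]
    refine add_le_add ih (max_le (Finset.sum_nonneg fun j _ => emptyInd_nonneg _ _)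
      (sub_one_le_sum_Ico m n))

/-- Among the cells up to that of `y n`, each one is empty or contains one of the first `n` cuts. -/
theorem cellIndex_le (m n : ℕ) : (S.cellIndex m n : ℝ) ≤ n + S.emptyCount m n := by
  induction n with
  | zero => simp [cellIndex, S.y_zero, emptyCount]
  | succ n ih =>
    have := sub_one_le_sum_Ico (S := S) m n
    rw [emptyCount_succ]
    push_cast
    linarith

theorem SparseEmptyCells.eventually_le {m : ℕ} (hm : 0 < m) (h : S.SparseEmptyCells m) :
    ∀ᶠ n in atTop, (S.cellIndex m n : ℝ) ≤ 2 * n := by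
  filter_upwards [(h.tendsto_emptyCount hm).eventually_lt_const (show (0 : ℝ) < 1 / 2 by norm_num),
    (tendsto_cellIndex (S := S) hm).eventually_gt_atTop 0] with n hn hpos
  have := cellIndex_le (S := S) m n
  rw [div_lt_iff₀ (by exact_mod_cast hpos)] at hn
  linarith

theorem three_lt_of_gap {m i : ℕ} (hm : 0 < m) {ε : ℝ} (hmε : 3 / (m : ℝ) < ε)
    (h : ε < (S.y (i + 1) : ℝ) - S.y i) : 3 < ((S.y (i + 1) : ℝ) - S.y i) * m := by
  have hm' : (0 : ℝ) < m := by exact_mod_cast hm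
  rw [div_lt_iff₀ hm'] at hmε
  nlinarith

theorem SparseEmptyCells.isLittleO_sum {m : ℕ} (hm : 0 < m) (h : S.SparseEmptyCells m) :
    (fun n => S.emptyCount m n) =o[atTop] fun n => (S.cellIndex m n : ℝ) := by
  refine (Asymptotics.isLittleO_iff_tendsto' ?_).2 (h.tendsto_emptyCount hm)
  filter_upwards [(tendsto_cellIndex (S := S) hm).eventually_gt_atTop 0] with n hn h0
  have : S.cellIndex m n = 0 := by exact_mod_cast h0
  omega

theorem cellIndex_isBigO (m : ℕ) :
    (fun n => (S.cellIndex m n : ℝ)) =O[atTop] fun n => (S.y n : ℝ) := by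
  refine Asymptotics.IsBigO.of_bound (m + 1) ?_
  filter_upwards [S.tendsto_y.eventually_ge_atTop 1] with n hn
  have hn' : (1 : ℝ) ≤ S.y n := by exact_mod_cast hn
  rw [Real.norm_of_nonneg (by positivity), Real.norm_of_nonneg (by positivity)]
  have := cellIndex_lt (S := S) m n
  nlinarith

/-- A gap is a run of empty cells. Over it the weights amount to at most half of the cells, so about
half of its length must come from fluctuations, which are at most of order `b ^ (3 / 4)`. -/
theorem SparseEmptyCells.gap_isBigO (h : S.SparseEmptyCells 1) :
    (fun n => (S.y (n + 1) : ℝ) - S.y n) =O[atTop] fun n => (S.y (n + 1) : ℝ) ^ (3 / 4 : ℝ) := by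
  obtain ⟨q, hq, hD⟩ := h
  set D : ℕ → ℝ := fun J => ∑ j ∈ Finset.range J, (S.emptyInd 1 j - q j) with hDdef
  have hDb : ∀ᶠ J : ℕ in atTop, |D J| ≤ (J : ℝ) ^ (3 / 4 : ℝ) := by
    filter_upwards [hD.abs.eventually_lt_const (show |(0 : ℝ)| < 1 by norm_num),
      eventually_gt_atTop 0] with J hJ hJ0
    have : (0 : ℝ) < (J : ℝ) ^ (3 / 4 : ℝ) := Real.rpow_pos_of_pos (by exact_mod_cast hJ0) _
    rw [abs_div, abs_of_pos this, div_lt_one this] at hJ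
    exact hJ.le
  obtain ⟨N, hN⟩ := eventually_atTop.1
    (hDb.and (hq.eventually_lt_const (show (0 : ℝ) < 1 / 2 by norm_num)))
  refine Asymptotics.IsBigO.of_bound 12 ?_
  filter_upwards [(tendsto_cellIndex (S := S) one_pos).eventually_ge_atTop (max N 1),
    S.tendsto_y.eventually_ge_atTop 1] with n hn hy1
  set a := S.cellIndex 1 n
  set b := S.cellIndex 1 (n + 1)
  have hab : a ≤ b := cellIndex_mono 1 (Nat.le_succ n)
  have haN : N ≤ a := (le_max_left _ _).trans hn
  have ha1 : 1 ≤ a := (le_max_right _ _).trans hn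
  have hb1 : (1 : ℝ) ≤ b := by exact_mod_cast ha1.trans hab
  set p : ℝ := (b : ℝ) ^ (3 / 4 : ℝ)
  have hp1 : 1 ≤ p := Real.one_le_rpow hb1 (by norm_num)
  have hDb' : |D b| ≤ p := (hN b (haN.trans hab)).1
  have hDa' : |D a| ≤ p := (hN a haN).1.trans
    (Real.rpow_le_rpow (by positivity) (by exact_mod_cast hab) (by norm_num))
  have h1 := sub_one_le_sum_Ico (S := S) 1 n
  have h2 : ∑ j ∈ Finset.Ico a b, S.emptyInd 1 j = D b - D a + ∑ j ∈ Finset.Ico a b, q j := by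
    have h3 : D b = D a + ∑ j ∈ Finset.Ico a b, (S.emptyInd 1 j - q j) :=
      (Finset.sum_range_add_sum_Ico _ hab).symm
    rw [h3, Finset.sum_sub_distrib]
    ring
  have h4 : ∑ j ∈ Finset.Ico a b, q j ≤ ((b : ℝ) - a) * (1 / 2) := by
    have := Finset.sum_le_card_nsmul (Finset.Ico a b) q (1 / 2) fun j hj =>
      (hN j (haN.trans (Finset.mem_Ico.1 hj).1)).2.le
    rwa [Nat.card_Ico, nsmul_eq_mul, Nat.cast_sub hab] at this
  have h5 := abs_le.1 hDb'
  have h6 := abs_le.1 hDa'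
  -- The relation is `b - a - 1 ≤ 2 * p + (b - a) / 2`, together with `1 ≤ p`.
  have h7 : (b : ℝ) - a ≤ 6 * p := by
    change (b : ℝ) - a - 1 ≤ _ at h1
    rw [h2] at h1
    linarith
  have hmy : (1 : ℝ) ≤ S.y (n + 1) := by
    have := S.strictMono_y.monotone (Nat.le_succ n)
    exact_mod_cast hy1.trans this
  have h8 : p ≤ (2 * S.y (n + 1) : ℝ) ^ (3 / 4 : ℝ) := by
    refine Real.rpow_le_rpow (by positivity) ?_ (by norm_num)
    have := cellIndex_lt (S := S) 1 (n + 1)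
    simp only [Nat.cast_one, mul_one] at this
    linarith
  -- The gap is at most `b - a + 1 ≤ 7 * p`, and `2 ^ (3 / 4) ≤ 12 / 7` yields the final constant
  -- `12`.
  have h9 : (2 * S.y (n + 1) : ℝ) ^ (3 / 4 : ℝ) ≤ (12 / 7) * (S.y (n + 1) : ℝ) ^ (3 / 4 : ℝ) := by
    rw [Real.mul_rpow (by norm_num) (by positivity)]
    refine mul_le_mul_of_nonneg_right ?_ (by positivity)
    have : (2 : ℝ) ^ (3 / 4 : ℝ) = (8 : ℝ) ^ (1 / 4 : ℝ) := by
      rw [show (8 : ℝ) = 2 ^ (3 : ℝ) by norm_num, ← Real.rpow_mul (by norm_num)]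
      norm_num
    rw [this]
    have h10 : (8 : ℝ) ≤ (12 / 7) ^ (4 : ℝ) := by norm_num
    calc (8 : ℝ) ^ (1 / 4 : ℝ) ≤ ((12 / 7) ^ (4 : ℝ)) ^ (1 / 4 : ℝ) :=
          Real.rpow_le_rpow (by norm_num) h10 (by norm_num)
      _ = 12 / 7 := by rw [← Real.rpow_mul (by norm_num)]; norm_num
  have hg : (0 : ℝ) ≤ (S.y (n + 1) : ℝ) - S.y n :=
    sub_nonneg.2 (NNReal.coe_le_coe.2 (S.strictMono_y.monotone (Nat.le_succ n)))
  rw [Real.norm_of_nonneg hg, Real.norm_of_nonneg (by positivity)]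
  have h11 := le_cellIndex (S := S) 1 (n + 1)
  have h12 := cellIndex_lt (S := S) 1 n
  simp only [Nat.cast_one, mul_one] at h11 h12
  change (S.y (n + 1) : ℝ) ≤ b at h11
  change (a : ℝ) < _ at h12
  linarith

theorem lebesgue_real_Ioc (n : ℕ) : lebesgue.real (Ioc (S.y n) (S.y (n + 1))) =
    (S.y (n + 1) : ℝ) - S.y n := by
  rw [measureReal_def, lebesgue_Ioc, ENNReal.coe_toReal,
    NNReal.coe_sub (S.strictMono_y.monotone (Nat.le_succ n))]

theorem lebesgue_real_Icc (l : ℝ≥0) : lebesgue.real (Icc 0 l) = l := by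
  rw [measureReal_def, lebesgue_Icc_zero, ENNReal.coe_toReal]

theorem growthConditions_lebesgue (h : ∀ m, 0 < m → S.SparseEmptyCells m) :
    GrowthConditions S lebesgue where
  finite l _ := by rw [lebesgue_Icc_zero]; exact ENNReal.coe_lt_top
  infinite := lebesgue_univ
  stick := by
    -- The gaps are of order `y ^ (3 / 4)`, and `3 / 4 < 1 - 1 / 8`.
    refine ⟨1 / 8, by norm_num, ?_⟩
    simp only [lebesgue_real_Ioc, lebesgue_real_Icc]
    refine (h 1 one_pos).gap_isBigO.trans_isLittleO ?_
    have hy : Tendsto (fun n => (S.y (n + 1) : ℝ)) atTop atTop :=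
      (NNReal.tendsto_coe_atTop.2 S.tendsto_y).comp (tendsto_add_atTop_nat 1)
    have hr : (fun x : ℝ => x ^ (3 / 4 : ℝ)) =o[atTop] fun x : ℝ => x ^ (1 - 1 / 8 : ℝ) := by
      refine (Asymptotics.isLittleO_iff_tendsto' ?_).2 ?_
      · filter_upwards [eventually_gt_atTop 0] with x hx h0
        exact absurd h0 (Real.rpow_pos_of_pos hx _).ne'
      · refine (tendsto_rpow_neg_atTop (show (0 : ℝ) < 1 / 8 by norm_num)).congr' ?_
        filter_upwards [eventually_gt_atTop 0] with x hx
        rw [← Real.rpow_sub hx]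
        norm_num
    exact hr.comp_tendsto hy
  long_sticks ε hε := by
    simp only [lebesgue_real_Ioc, lebesgue_real_Icc]
    obtain ⟨m, hm⟩ := exists_nat_gt (3 / ε)
    have hm0 : 0 < m := by
      have : (0 : ℝ) < m := (by positivity : (0 : ℝ) < 3 / ε).trans hm
      exact_mod_cast this
    have hm' : (0 : ℝ) < m := by exact_mod_cast hm0
    have hmε : 3 / (m : ℝ) < ε := by
      rw [div_lt_iff₀ hε] at hm
      rw [div_lt_iff₀ hm']
      linarith
    -- A stick longer than `ε` has scaled length `g > 3` in units of cells, so it covers more than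
    -- `g - 2 > g / 3` empty cells. The total length of long sticks is thus controlled by the empty
    -- cells.
    have hb : (fun n => ∑ i ∈ Finset.range n, if ε < (S.y (i + 1) : ℝ) - S.y i then
        (S.y (i + 1) : ℝ) - S.y i else 0) =O[atTop] fun n => S.emptyCount m n := by
      refine Asymptotics.IsBigO.of_bound 3 (Eventually.of_forall fun n => ?_)
      have hsum := sum_gap_le (S := S) (m := m) n
      have hnn : 0 ≤ S.emptyCount m n := Finset.sum_nonneg fun j _ => emptyInd_nonneg _ _
      have hterm : ∀ i, (if ε < (S.y (i + 1) : ℝ) - S.y i then (S.y (i + 1) : ℝ) - S.y i else 0) ≤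
          3 * max 0 ((S.cellIndex m (i + 1) : ℝ) - S.cellIndex m i - 1) := by
        intro i
        split_ifs with hi
        · have h3 := three_lt_of_gap hm0 hmε hi
          have h11 := le_cellIndex (S := S) m (i + 1)
          have h12 := cellIndex_lt (S := S) m i
          have h13 := le_max_right 0 ((S.cellIndex m (i + 1) : ℝ) - S.cellIndex m i - 1)
          have hm1 : (1 : ℝ) ≤ m := by exact_mod_cast hm0
          have h14 : (S.y (i + 1) : ℝ) - S.y i ≤ ((S.y (i + 1) : ℝ) - S.y i) * m := by
            nlinarith
          linarith
        · positivity
      rw [Real.norm_of_nonneg (Finset.sum_nonneg fun i _ => ?_), Real.norm_of_nonneg hnn]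
      · refine (Finset.sum_le_sum fun i _ => hterm i).trans ?_
        rw [← Finset.mul_sum]
        linarith
      · split_ifs with hi
        · linarith
        · exact le_rfl
    exact (hb.trans_isLittleO ((h m hm0).isLittleO_sum hm0)).trans_isBigO (cellIndex_isBigO m)

theorem growthConditions_cutMeasure (h : ∀ m, 0 < m → S.SparseEmptyCells m) :
    GrowthConditions S S.cutMeasure where
  finite l _ := by
    obtain ⟨n, hn, -⟩ := S.exists_le_y l l
    refine (measure_mono (Icc_subset_Icc_right hn)).trans_lt ?_
    rw [S.cutMeasure_Icc]
    exact ENNReal.natCast_lt_top n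
  infinite := by
    refine ENNReal.eq_top_of_forall_nnreal_le fun r => ?_
    obtain ⟨n, hn⟩ := exists_nat_ge r
    refine le_trans ?_ (measure_mono (subset_univ (Icc 0 (S.y n))))
    rw [S.cutMeasure_Icc]
    exact_mod_cast hn
  stick := by
    refine ⟨1 / 2, by norm_num, ?_⟩
    simp only [measureReal_def, cutMeasure_Ioc, cutMeasure_Icc, ENNReal.toReal_one,
      ENNReal.toReal_natCast]
    refine (Asymptotics.isLittleO_const_left.2 (Or.inr ?_))
    refine tendsto_norm_atTop_atTop.comp ?_
    refine (tendsto_rpow_atTop (by norm_num)).comp ?_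
    exact tendsto_natCast_atTop_atTop.comp (tendsto_add_atTop_nat 1)
  long_sticks ε hε := by
    simp only [measureReal_def, cutMeasure_Ioc, cutMeasure_Icc, ENNReal.toReal_one,
      ENNReal.toReal_natCast]
    obtain ⟨m, hm⟩ := exists_nat_gt (3 / ε)
    have hm0 : 0 < m := by
      have : (0 : ℝ) < m := (by positivity : (0 : ℝ) < 3 / ε).trans hm
      exact_mod_cast this
    have hm' : (0 : ℝ) < m := by exact_mod_cast hm0
    have hmε : 3 / (m : ℝ) < ε := by
      rw [div_lt_iff₀ hε] at hm
      rw [div_lt_iff₀ hm']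
      linarith
    -- Each long stick crosses at least one empty cell, and distinct sticks cross distinct ones.
    have hb : (fun n => ∑ i ∈ Finset.range n, if ε < (S.y (i + 1) : ℝ) - S.y i then
        (1 : ℝ) else 0) =O[atTop] fun n => S.emptyCount m n := by
      refine Asymptotics.IsBigO.of_bound 1 (Eventually.of_forall fun n => ?_)
      have hsum := sum_gap_le (S := S) (m := m) n
      have hnn : 0 ≤ S.emptyCount m n := Finset.sum_nonneg fun j _ => emptyInd_nonneg _ _
      have hterm : ∀ i, (if ε < (S.y (i + 1) : ℝ) - S.y i then (1 : ℝ) else 0) ≤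
          max 0 ((S.cellIndex m (i + 1) : ℝ) - S.cellIndex m i - 1) := by
        intro i
        split_ifs with hi
        · have h3 := three_lt_of_gap hm0 hmε hi
          have h11 := le_cellIndex (S := S) m (i + 1)
          have h12 := cellIndex_lt (S := S) m i
          have h13 := le_max_right 0 ((S.cellIndex m (i + 1) : ℝ) - S.cellIndex m i - 1)
          linarith
        · exact le_max_left _ _
      rw [Real.norm_of_nonneg (Finset.sum_nonneg fun i _ => ?_), Real.norm_of_nonneg hnn, one_mul]
      · exact (Finset.sum_le_sum fun i _ => hterm i).trans hsum
      · split_ifs <;> norm_num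
    refine (hb.trans_isLittleO ((h m hm0).isLittleO_sum hm0)).trans_isBigO ?_
    refine Asymptotics.IsBigO.of_bound 2 ?_
    filter_upwards [(h m hm0).eventually_le hm0] with n hn
    rwa [Real.norm_of_nonneg (by positivity), Real.norm_of_nonneg (by positivity)]

end Sticks

end ICRT

namespace ICRT

/-! ### Void probabilities -/

theorem tendsto_real_Icc_atTop {ν : Measure ℝ≥0} (hfin : ∀ l, ν (Icc 0 l) ≠ ∞)
    (hinf : ν univ = ∞) : Tendsto (fun l : ℝ≥0 => ν.real (Icc 0 l)) atTop atTop := by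
  have hU : ⋃ l : ℝ≥0, Icc 0 l = univ := eq_univ_of_forall fun x =>
    mem_iUnion.2 ⟨x, zero_le, le_rfl⟩
  have hmono : Monotone fun l : ℝ≥0 => Icc 0 l := fun a b hab => Icc_subset_Icc_right hab
  have h := tendsto_measure_iUnion_atTop (μ := ν) hmono
  rw [hU, hinf] at h
  rw [tendsto_atTop]
  intro c
  filter_upwards [h.eventually_const_lt (ENNReal.ofReal_lt_top (r := c))] with n hn
  exact (ENNReal.ofReal_le_iff_le_toReal (hfin _)).1 hn.le

theorem massMeasure_univ {θ : ℕ → ℝ≥0} (hθ : IsParameter θ) (x : ℕ → ℝ≥0) :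
    massMeasure θ x univ = ∞ := by
  rw [massMeasure, Measure.add_apply, Measure.sum_apply _ MeasurableSet.univ]
  rcases hθ.ne_zero_or with h | h
  · rw [Measure.smul_apply, lebesgue_univ, ENNReal.smul_top, if_neg (pow_ne_zero 2 h), top_add]
  · have : ∑' i, (θ (i + 1) • Measure.dirac (x (i + 1)) : Measure ℝ≥0) univ = ∞ := by
      simp only [Measure.smul_apply, measure_univ]
      rw [← not_ne_iff]
      intro h'
      refine h (ENNReal.tsum_coe_ne_top_iff_summable.1 ?_)
      convert h' using 3 with i
      exact (mul_one _).symm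
    rw [this, add_top]

open Classical in
/-- The intensity measure of the cuts, given the mass measure. -/
def intensity (m : Measure ℝ≥0) (A : Set ℝ≥0) : ℝ≥0∞ :=
  ∫⁻ l in A, (if IsLocFin m then m (Icc 0 l ∩ univ) else 0) ∂lebesgue

theorem measurable_intensity (A : Set ℝ≥0) : Measurable fun m => intensity m A :=
  (measurable_measure_Icc_inter MeasurableSet.univ).lintegral_prod_right'

theorem intensity_eq {m : Measure ℝ≥0} (hm : IsLocFin m) (A : Set ℝ≥0) :
    intensity m A = ∫⁻ l in A, m (Icc 0 l) ∂lebesgue := by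
  simp [intensity, hm]

theorem intensity_ne_top {m : Measure ℝ≥0} (hm : IsLocFin m) (a b : ℝ≥0) :
    intensity m (Ioc a b) ≠ ∞ := by
  rw [intensity_eq hm]
  refine ne_top_of_le_ne_top (b := m (Icc 0 b) * lebesgue (Ioc a b)) ?_ ?_
  · rw [lebesgue_Ioc]
    exact ENNReal.mul_ne_top (hm.ne_top b) ENNReal.coe_ne_top
  · rw [← setLIntegral_const]
    exact setLIntegral_mono' measurableSet_Ioc fun l hl =>
      measure_mono (Icc_subset_Icc_right hl.2)

/-- On `(a, b]` the rate of the cuts is at least `m[0, a]`; this is the source of all exponential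
bounds on void probabilities. -/
theorem le_intensity {m : Measure ℝ≥0} (hm : IsLocFin m) (a b : ℝ≥0) :
    m (Icc 0 a) * (b - a : ℝ≥0) ≤ intensity m (Ioc a b) := by
  rw [intensity_eq hm, ← lebesgue_Ioc, ← setLIntegral_const]
  exact setLIntegral_mono' measurableSet_Ioc fun l hl =>
    measure_mono (Icc_subset_Icc_right hl.1.le)

/-- The conditional probability that `A` contains no cut, given the mass measure. -/
def voidProb (m : Measure ℝ≥0) (A : Set ℝ≥0) : ℝ≥0∞ :=
  ENNReal.ofReal (Real.exp (-(intensity m A).toReal))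

theorem measurable_voidProb (A : Set ℝ≥0) : Measurable fun m => voidProb m A :=
  (Real.measurable_exp.comp (measurable_intensity A).ennreal_toReal.neg).ennreal_ofReal

theorem voidProb_le_one (m : Measure ℝ≥0) (A : Set ℝ≥0) : voidProb m A ≤ 1 := by
  rw [voidProb, ENNReal.ofReal_le_one, Real.exp_le_one_iff]
  simp

theorem voidProb_le {m : Measure ℝ≥0} (hm : IsLocFin m) (a b : ℝ≥0) :
    voidProb m (Ioc a b) ≤
      ENNReal.ofReal (Real.exp (-(m.real (Icc 0 a) * (b - a : ℝ≥0)))) := by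
  refine ENNReal.ofReal_le_ofReal (Real.exp_le_exp.2 (neg_le_neg ?_))
  have := ENNReal.toReal_mono (intensity_ne_top hm a b) (le_intensity hm a b)
  rwa [ENNReal.toReal_mul, ENNReal.coe_toReal] at this

section

variable {Ω : Type*}

theorem measurable_indicator_sub_toReal {G : MeasurableSpace Ω} {A : Set Ω}
    (hA : MeasurableSet A) {q : Ω → ℝ≥0∞} (hq : Measurable q) :
    Measurable fun ω => A.indicator (1 : Ω → ℝ) ω - (q ω).toReal :=
  (measurable_one.indicator hA).sub hq.ennreal_toReal

theorem condExp_indicator_sub_eq_zero {G mΩ : MeasurableSpace Ω} {P : Measure Ω}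
    [IsProbabilityMeasure P] (hG : G ≤ mΩ) {A : Set Ω}
    (hA : MeasurableSet A) {q : Ω → ℝ≥0∞} (hq : Measurable[G] q) (hq1 : ∀ ω, q ω ≤ 1)
    (h : ∀ D, MeasurableSet[G] D → P (D ∩ A) = ∫⁻ ω in D, q ω ∂P) :
    P[fun ω => A.indicator 1 ω - (q ω).toReal | G] =ᵐ[P] 0 := by
  have hqi : Integrable (fun ω => (q ω).toReal) P :=
    Integrable.of_bound (hq.ennreal_toReal.mono hG le_rfl).aestronglyMeasurable 1
      (ae_of_all _ fun ω => by
        rw [Real.norm_of_nonneg ENNReal.toReal_nonneg]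
        exact ENNReal.toReal_le_of_le_ofReal zero_le_one (by simpa using hq1 ω))
  have hAi : Integrable (A.indicator (1 : Ω → ℝ)) P := (integrable_const 1).indicator hA
  refine (ae_eq_condExp_of_forall_setIntegral_eq hG (hAi.sub hqi) (fun D _ _ =>
    (integrable_zero Ω ℝ P).integrableOn) (fun D hD _ => ?_)
    stronglyMeasurable_zero.aestronglyMeasurable).symm
  have h1 : ∫ ω in D, A.indicator (1 : Ω → ℝ) ω ∂P = P.real (D ∩ A) := by
    rw [integral_indicator_one hA, measureReal_restrict_apply hA, inter_comm]
  have h2 : ∫ ω in D, (q ω).toReal ∂P = P.real (D ∩ A) := by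
    rw [integral_toReal (hq.mono hG le_rfl).aemeasurable.restrict
      (ae_of_all _ fun ω => (hq1 ω).trans_lt ENNReal.one_lt_top), ← h D hD]
    rfl
  rw [integral_sub' hAi.integrableOn hqi.integrableOn, h1, h2]
  simp

variable {mΩ : MeasurableSpace Ω} {P : Measure Ω}
  {θ : ℕ → ℝ≥0} {X : ℕ → Ω → ℝ≥0} {S : Ω → Sticks}

theorem IsICRT.measurableSet_noCut (hS : IsICRT P θ X S) {A : Set ℝ≥0} (hA : MeasurableSet A) :
    MeasurableSet {ω | (S ω).cutMeasure A = 0} := by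
  have : {ω | (S ω).cutMeasure A = 0} = ⋂ i, {ω | (S ω).y (i + 1) ∉ A} := by
    ext ω
    simp [(S ω).cutMeasure_eq_zero_iff hA]
  rw [this]
  exact MeasurableSet.iInter fun i => (hS.measurable_Y (i + 1) hA).compl

/-- This is `law_Y` with all counts equal to `0`, integrated against events that depend on the mass
measure. -/
theorem IsICRT.measure_inter_noCut [IsProbabilityMeasure P] (hS : IsICRT P θ X S) {t : Finset ℕ}
    {A : ℕ → Set ℝ≥0} (hA : ∀ i, MeasurableSet (A i)) (hb : ∀ i, Bornology.IsBounded (A i))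
    (hd : ∀ i ∈ t, ∀ j ∈ t, i ≠ j → Disjoint (A i) (A j)) {G₀ : Set Ω}
    (hG₀ : MeasurableSet[sigmaMass θ X] G₀) :
    P (G₀ ∩ ⋂ i ∈ t, {ω | (S ω).cutMeasure (A i) = 0}) =
      ∫⁻ ω in G₀, ∏ i ∈ t, voidProb (massMeasure θ fun i => X i ω) (A i) ∂P := by
  refine measure_inter_eq_of_condExp hS.sigmaMass_le
    (t.measurableSet_biInter fun i _ => hS.measurableSet_noCut (hA i))
    (ae_of_all _ fun ω => ENNReal.prod_ne_top fun i _ =>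
      ((voidProb_le_one _ _).trans_lt ENNReal.one_lt_top).ne) ?_ hG₀
  have h := hS.law_Y t.card (fun j => A (t.equivFin.symm j)) (fun _ => 0) (fun j => hA _)
    (fun j => hb _) fun j j' hj => hd _ (t.equivFin.symm j).2 _ (t.equivFin.symm j').2 fun h' =>
      hj (t.equivFin.symm.injective (Subtype.ext h'))
  have hset : {ω | ∀ j : Fin t.card, (S ω).cutMeasure (A (t.equivFin.symm j)) = ((0 : ℕ) : ℝ≥0∞)} =
      ⋂ i ∈ t, {ω | (S ω).cutMeasure (A i) = 0} := by
    ext ω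
    simp only [mem_ofPred_eq, mem_iInter, Nat.cast_zero]
    refine ⟨fun h i hi => ?_, fun h j => h _ (t.equivFin.symm j).2⟩
    have := h (t.equivFin ⟨i, hi⟩)
    rwa [Equiv.symm_apply_apply] at this
  rw [hset] at h
  filter_upwards [h, hS.ae_isLocFin] with ω h1 h2
  rw [h1, ENNReal.toReal_prod, ← Finset.prod_coe_sort t,
    ← t.equivFin.symm.prod_comp]
  refine Finset.prod_congr rfl fun j _ => ?_
  rw [poissonMeasure_real_singleton, voidProb, ENNReal.toReal_ofReal (Real.exp_pos _).le,
    intensity_eq h2]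
  simp [ENNReal.coe_toNNReal_eq_toReal]

/-- Pulling out a functional of the mass measure. -/
theorem IsICRT.setLIntegral_noCut [IsProbabilityMeasure P] (hS : IsICRT P θ X S) {A : Set ℝ≥0}
    (hA : MeasurableSet A) (hb : Bornology.IsBounded A) {g : Ω → ℝ≥0∞}
    (hg : Measurable[sigmaMass θ X] g) : ∫⁻ ω in {ω | (S ω).cutMeasure A = 0}, g ω ∂P =
      ∫⁻ ω, voidProb (massMeasure θ fun i => X i ω) A * g ω ∂P := by
  refine setLIntegral_eq_of_forall_measure_inter hS.sigmaMass_le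
    ((measurable_voidProb A).comp (measurable_massMeasure θ hS.measurable_X)) (fun G₀ hG₀ => ?_) hg
  have := hS.measure_inter_noCut (t := {0}) (A := fun _ => A) (fun _ => hA) (fun _ => hb)
    (by simp) hG₀
  simpa using this

/-! ### Independent empty cells of the grid. -/

/-- The cell of mesh `1 / m` and index `i`. -/
def gridCell (m i : ℕ) : Set ℝ≥0 := Ioc (((i - 1 : ℕ) : ℝ≥0) / m) ((i : ℝ≥0) / m)

theorem mem_gridCell_iff {m i : ℕ} (hm : 0 < m) (hi : i ≠ 0) {x : ℝ≥0} :
    x ∈ gridCell m i ↔ ⌈x * m⌉₊ = i := by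
  have hm' : (0 : ℝ≥0) < m := by exact_mod_cast hm
  rw [Nat.ceil_eq_iff hi, gridCell, mem_Ioc, div_lt_iff₀ hm', le_div_iff₀ hm']

theorem cutMeasure_gridCell_eq_zero_iff (S : Sticks) {m i : ℕ} (hm : 0 < m) (hi : i ≠ 0) :
    S.cutMeasure (gridCell m i) = 0 ↔ S.EmptyCell m i := by
  rw [S.cutMeasure_eq_zero_iff (A := gridCell m i) measurableSet_Ioc]
  exact forall_congr' fun n => not_congr (mem_gridCell_iff hm hi)

/-- The events that a given cell contains no cut; by convention, those of index `0` are the events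
that depend on the mass measure. -/
def emptyEvents (θ : ℕ → ℝ≥0) (X : ℕ → Ω → ℝ≥0) (S : Ω → Sticks) (m : ℕ) : ℕ → Set (Set Ω)
  | 0 => {s | MeasurableSet[sigmaMass θ X] s}
  | i + 1 => {{ω | (S ω).cutMeasure (gridCell m (i + 1)) = 0}}

theorem isPiSystem_emptyEvents (m i : ℕ) : IsPiSystem (emptyEvents θ X S m i) := by
  cases i with
  | zero => exact @MeasurableSpace.isPiSystem_measurableSet Ω (sigmaMass θ X)
  | succ i => exact IsPiSystem.singleton _

namespace IsICRT

theorem measurableSet_emptyEvents (hS : IsICRT P θ X S) (m i : ℕ) (s : Set Ω)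
    (hs : s ∈ emptyEvents θ X S m i) : MeasurableSet s := by
  cases i with
  | zero => exact hS.sigmaMass_le _ hs
  | succ i =>
    rw [mem_singleton_iff.1 hs]
    exact hS.measurableSet_noCut measurableSet_Ioc

variable [IsProbabilityMeasure P]

theorem measure_inter_emptyCell (hS : IsICRT P θ X S) {m : ℕ} (hm : 0 < m) {n : ℕ} (hn : 0 < n)
    {E : Set Ω} (hE : MeasurableSet[history (emptyEvents θ X S m) n] E) :
    P (E ∩ {ω | (S ω).cutMeasure (gridCell m n) = 0}) =
      ∫⁻ ω in E, voidProb (massMeasure θ fun i => X i ω) (gridCell m n) ∂P := by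
  refine measure_inter_eq_setLIntegral_of_history hS.sigmaMass_le rfl (isPiSystem_emptyEvents m)
    (hS.measurableSet_emptyEvents m) (𝓑 := fun _ => (univ : Set Unit))
    (A := fun i _ => {ω | (S ω).cutMeasure (gridCell m i) = 0})
    (q := fun i _ ω => voidProb (massMeasure θ fun i => X i ω) (gridCell m i))
    (fun i hi s hs => ?_) (fun i _ _ => hS.measurableSet_noCut measurableSet_Ioc)
    (fun i _ _ => ?_) (fun t f h0 _ G₀ hG₀ => ?_) hn (mem_univ ()) hE
  · obtain ⟨i, rfl⟩ := Nat.exists_eq_succ_of_ne_zero hi.ne'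
    exact ⟨(), mem_univ _, (mem_singleton_iff.1 hs).symm⟩
  · exact (measurable_voidProb _).comp (comap_measurable _)
  · refine hS.measure_inter_noCut (fun i => measurableSet_Ioc) (fun i => Metric.isBounded_Ioc _ _)
      (fun i hi j hj hij => ?_) hG₀
    have hi0 : i ≠ 0 := fun h => h0 (h ▸ hi)
    have hj0 : j ≠ 0 := fun h => h0 (h ▸ hj)
    refine disjoint_left.2 fun x hx hx' => hij ?_
    rw [← (mem_gridCell_iff hm hi0).1 hx, (mem_gridCell_iff hm hj0).1 hx']

/-- Given `μ`, the indicators of empty cells are independent. Martingale convergence with weights `j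
^ (-3 / 4)` and Kronecker's lemma bound their fluctuations, and the void probabilities tend to `0`
because `μ` has infinite mass. -/
theorem ae_sparseEmptyCells (hS : IsICRT P θ X S) (hθ : IsParameter θ) {m : ℕ} (hm : 0 < m) :
    ∀ᵐ ω ∂P, (S ω).SparseEmptyCells m := by
  classical
  set q : ℕ → Ω → ℝ≥0∞ := fun j ω =>
    voidProb (massMeasure θ fun i => X i ω) (gridCell m (j + 1)) with hq
  set E : ℕ → Set Ω := fun j => {ω | (S ω).cutMeasure (gridCell m (j + 1)) = 0} with hE
  let 𝓕 : Filtration ℕ mΩ :=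
    { seq := fun k => history (emptyEvents θ X S m) (k + 1)
      mono' := fun _ _ h => history_mono _ (Nat.add_le_add_right h 1)
      le' := fun k => history_le (hS.measurableSet_emptyEvents m) (k + 1) }
  have hqm : ∀ j k, Measurable[𝓕 k] (q j) := fun j k => by
    have h1 : Measurable[sigmaMass θ X] (q j) :=
      (measurable_voidProb _).comp (comap_measurable _)
    exact h1.mono (fun s hs => measurableSet_history (Nat.succ_pos k) hs) le_rfl
  have hq1 : ∀ j ω, q j ω ≤ 1 := fun j ω => voidProb_le_one _ _
  have hq1' : ∀ j ω, (q j ω).toReal ≤ 1 := fun j ω =>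
    ENNReal.toReal_le_of_le_ofReal zero_le_one (by simpa using hq1 j ω)
  -- The exponent `3 / 4` exceeds `1 / 2`, as summability of the squares requires, and is below `1`,
  -- so the error is sublinear.
  have hsum : Summable fun k : ℕ => (((k + 1 : ℕ) : ℝ) ^ (3 / 4 : ℝ))⁻¹ ^ 2 := by
    have h1 : Summable fun n : ℕ => ((n : ℝ) ^ (3 / 2 : ℝ))⁻¹ :=
      Real.summable_nat_rpow_inv.2 (by norm_num)
    refine ((summable_nat_add_iff 1).2 h1).congr fun k => ?_
    rw [inv_pow, ← Real.rpow_natCast, ← Real.rpow_mul (by positivity)]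
    norm_num
  have hlim := ae_exists_tendsto_sum_mul (P := P) (𝓕 := 𝓕)
    (a := fun k _ => (((k + 1 : ℕ) : ℝ) ^ (3 / 4 : ℝ))⁻¹)
    (d := fun k ω => (E k).indicator 1 ω - (q k ω).toReal)
    (fun k => by
      have hEm : MeasurableSet[𝓕 (k + 1)] (E k) :=
        measurableSet_history (i := k + 1) (by omega) (mem_singleton _)
      exact measurable_indicator_sub_toReal hEm (hqm k (k + 1)))
    (fun k ω => by
      have h1 := hq1' k ω
      have h2 : 0 ≤ (q k ω).toReal := ENNReal.toReal_nonneg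
      by_cases hω : ω ∈ E k
      · rw [indicator_of_mem hω, Pi.one_apply, abs_le]
        constructor <;> linarith
      · rw [indicator_of_notMem hω, abs_le]
        constructor <;> linarith)
    (fun k => condExp_indicator_sub_eq_zero (𝓕.le k) (hS.measurableSet_noCut measurableSet_Ioc)
      (hqm k k) (hq1 k) fun D hD => hS.measure_inter_emptyCell hm (Nat.succ_pos k) hD)
    (fun k => measurable_const) (ae_of_all _ fun ω => hsum)
  filter_upwards [hlim, hS.ae_isLocFin] with ω ⟨s, hs⟩ hfin
  refine ⟨fun j => (q j ω).toReal, ?_, ?_⟩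
  · have hm' : (0 : ℝ) < m := by exact_mod_cast hm
    have h1 : Tendsto (fun j : ℕ => (massMeasure θ fun i => X i ω).real
        (Icc 0 ((j : ℝ≥0) / m)) * (1 / m : ℝ)) atTop atTop := by
      refine Tendsto.atTop_mul_const (by positivity) ?_
      refine (tendsto_real_Icc_atTop hfin.ne_top (massMeasure_univ hθ _)).comp ?_
      exact tendsto_natCast_atTop_atTop.atTop_div_const (by exact_mod_cast hm)
    have h2 := Real.tendsto_exp_atBot.comp (tendsto_neg_atTop_atBot.comp h1)
    refine squeeze_zero (fun j => ENNReal.toReal_nonneg) (fun j => ?_) h2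
    refine ENNReal.toReal_le_of_le_ofReal (Real.exp_pos _).le ?_
    refine (voidProb_le hfin _ _).trans (le_of_eq ?_)
    have h3 : ((j + 1 : ℕ) : ℝ≥0) / m - (j : ℝ≥0) / m = 1 / m := by
      rw [← tsub_div]
      push_cast
      rw [add_tsub_cancel_left]
    simp only [Nat.add_sub_cancel, h3, Function.comp_apply]
    push_cast
    rfl
  · have h := tendsto_kronecker (W := fun n : ℕ => (n : ℝ) ^ (3 / 4 : ℝ))
      (w := fun n : ℕ => ((n + 1 : ℕ) : ℝ) ^ (3 / 4 : ℝ) - (n : ℝ) ^ (3 / 4 : ℝ))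
      (fun n => sub_nonneg.2 (Real.rpow_le_rpow (by positivity) (by push_cast; linarith)
        (by norm_num)))
      (fun n => by ring)
      ((tendsto_rpow_atTop (by norm_num)).comp tendsto_natCast_atTop_atTop) hs
    refine h.congr fun n => ?_
    congr 1
    refine Finset.sum_congr rfl fun j _ => ?_
    have hpos : (((j + 1 : ℕ) : ℝ) ^ (3 / 4 : ℝ)) ≠ 0 :=
      (Real.rpow_pos_of_pos (by positivity) _).ne'
    rw [← mul_assoc, mul_inv_cancel₀ hpos, one_mul]
    congr 1
    by_cases hω : ω ∈ E j
    · rw [indicator_of_mem hω, Sticks.emptyInd,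
        if_pos ((cutMeasure_gridCell_eq_zero_iff _ hm (Nat.succ_ne_zero j)).1 hω)]
      rfl
    · rw [indicator_of_notMem hω, Sticks.emptyInd, if_neg fun h' =>
        hω ((cutMeasure_gridCell_eq_zero_iff _ hm (Nat.succ_ne_zero j)).2 h')]

theorem ae_forall_sparseEmptyCells (hS : IsICRT P θ X S) (hθ : IsParameter θ) :
    ∀ᵐ ω ∂P, ∀ m, 0 < m → (S ω).SparseEmptyCells m :=
  ae_all_iff.2 fun m => by
    by_cases hm : 0 < m
    · filter_upwards [hS.ae_sparseEmptyCells hθ hm] with ω hω _ using hω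
    · exact ae_of_all _ fun ω h => absurd h hm

theorem measurable_cutMeasure : Measurable[sigmaMassCuts θ X S] fun ω => (S ω).cutMeasure := by
  have hy : ∀ n, Measurable[sigmaMassCuts θ X S] fun ω => (S ω).y n := fun n =>
    (measurable_pi_apply n).comp (measurable_snd.comp measurable_massCuts)
  refine @Measure.measurable_of_measurable_coe _ _ _ (sigmaMassCuts θ X S) _ fun s hs => ?_
  simp only [Sticks.cutMeasure, Measure.sum_apply _ hs, Measure.dirac_apply' _ hs]
  exact measurable_tsum_nat fun i => (measurable_one.indicator hs).comp (hy (i + 1))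

end IsICRT

end

end ICRT

namespace ICRT

/-! ### The mean of the mass measure and its concentration -/

/-- The mean mass of `[0, l]`. -/
def meanMass (θ : ℕ → ℝ≥0) (l : ℝ≥0) : ℝ≥0∞ :=
  θ 0 ^ 2 * l + ∑' i, θ (i + 1) * ENNReal.ofReal (1 - Real.exp (-(θ (i + 1) * l)))

theorem massMeasure_Icc (θ x : ℕ → ℝ≥0) (l : ℝ≥0) : massMeasure θ x (Icc 0 l) =
    θ 0 ^ 2 * l + ∑' i, (θ (i + 1) : ℝ≥0∞) * (Icc 0 l).indicator 1 (x (i + 1)) := by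
  rw [massMeasure, Measure.add_apply, Measure.sum_apply _ measurableSet_Icc, Measure.smul_apply,
    lebesgue_Icc_zero]
  simp only [Measure.smul_apply, Measure.dirac_apply' _ measurableSet_Icc]
  rfl

theorem meanMass_mono (θ : ℕ → ℝ≥0) : Monotone (meanMass θ) := fun a b hab => by
  unfold meanMass
  gcongr

/-- Each term is concave in `l` and vanishes at `0`; concretely, `1 - u ^ 2 ≤ 2 * (1 - u)` with `u`
the exponential. -/
theorem meanMass_two_mul_le (θ : ℕ → ℝ≥0) (l : ℝ≥0) :
    meanMass θ (2 * l) ≤ 2 * meanMass θ l := by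
  rw [meanMass, meanMass, mul_add, ← ENNReal.tsum_mul_left]
  refine add_le_add (le_of_eq ?_) (ENNReal.tsum_le_tsum fun i => ?_)
  · push_cast
    rw [mul_left_comm]
  · rw [mul_left_comm]
    gcongr
    rw [← ENNReal.ofReal_ofNat, ← ENNReal.ofReal_mul (by norm_num)]
    refine ENNReal.ofReal_le_ofReal ?_
    have h1 : Real.exp (-(θ (i + 1) * (2 * l : ℝ≥0))) = Real.exp (-(θ (i + 1) * l)) ^ 2 := by
      rw [← Real.exp_nat_mul]
      push_cast
      ring_nf
    rw [h1]
    nlinarith [sq_nonneg (Real.exp (-((θ (i + 1) : ℝ) * l)) - 1)]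

/-- From `1 - exp (-t) ≤ t`, the mean mass of `[0, 1]` is at most the sum of the `θ i ^ 2`. -/
theorem meanMass_one_le {θ : ℕ → ℝ≥0} (hθ : IsParameter θ) : meanMass θ 1 ≤ 1 := by
  have h1 : ∑' i, ((θ i ^ 2 : ℝ≥0) : ℝ≥0∞) = 1 := by
    rw [← ENNReal.coe_tsum hθ.hasSum_sq.summable, hθ.hasSum_sq.tsum_eq, ENNReal.coe_one]
  rw [tsum_eq_zero_add' ENNReal.summable] at h1
  rw [← h1, meanMass]
  gcongr with i
  · simp
  · rw [ENNReal.coe_pow, sq]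
    gcongr
    rw [← ENNReal.ofReal_coe_nnreal]
    refine ENNReal.ofReal_le_ofReal ?_
    have := Real.add_one_le_exp (-((θ (i + 1) : ℝ) * (1 : ℝ≥0)))
    simp only [NNReal.coe_one, mul_one] at this ⊢
    linarith

section

variable {Ω : Type*} {mΩ : MeasurableSpace Ω} {P : Measure Ω}
  {θ : ℕ → ℝ≥0} {X : ℕ → Ω → ℝ≥0} {S : Ω → Sticks}

namespace IsICRT

theorem measure_X_le (hS : IsICRT P θ X S) {i : ℕ} (hi : 1 ≤ i) (hθi : 0 < θ i) (l : ℝ≥0) :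
    P (X i ⁻¹' Icc 0 l) = ENNReal.ofReal (1 - Real.exp (-(θ i * l))) := by
  have h1 : X i ⁻¹' Icc 0 l = (fun ω => (X i ω : ℝ)) ⁻¹' Iic (l : ℝ) := by
    ext ω
    simp
  have hm : Measurable fun ω => (X i ω : ℝ) := (hS.measurable_X i).coe_nnreal_real
  have hprob : IsProbabilityMeasure (expMeasure (θ i)) :=
    isProbabilityMeasure_expMeasure (by exact_mod_cast hθi)
  rw [h1, ← Measure.map_apply hm measurableSet_Iic, hS.law_X i hi hθi,
    ← ENNReal.ofReal_toReal (measure_ne_top _ _), ← measureReal_def, ← cdf_eq_real,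
    cdf_expMeasure_eq (by exact_mod_cast hθi), if_pos (NNReal.coe_nonneg l)]

variable [IsProbabilityMeasure P]

theorem lintegral_massMeasure_Icc (hS : IsICRT P θ X S) (l : ℝ≥0) :
    ∫⁻ ω, massMeasure θ (fun i => X i ω) (Icc 0 l) ∂P = meanMass θ l := by
  simp only [massMeasure_Icc]
  have hm : ∀ i, Measurable fun ω => (Icc 0 l).indicator (1 : ℝ≥0 → ℝ≥0∞) (X (i + 1) ω) :=
    fun i => (measurable_one.indicator measurableSet_Icc).comp (hS.measurable_X (i + 1))
  rw [lintegral_add_left measurable_const, lintegral_const, measure_univ, mul_one, meanMass,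
    lintegral_tsum fun i => ((hm i).const_mul _).aemeasurable]
  congr 1
  refine tsum_congr fun i => ?_
  rw [lintegral_const_mul _ (hm i)]
  rcases eq_or_ne (θ (i + 1)) 0 with h0 | h0
  · simp [h0]
  · rw [← hS.measure_X_le (Nat.le_add_left 1 i) (pos_iff_ne_zero.2 h0) l,
      ← lintegral_indicator_one (hS.measurable_X (i + 1) measurableSet_Icc)]
    rfl

theorem tendsto_meanMass (hS : IsICRT P θ X S) (hθ : IsParameter θ) :
    Tendsto (fun j : ℕ => meanMass θ (2 ^ j)) atTop (𝓝 ∞) := by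
  have hmono : Monotone fun j : ℕ => (2 : ℝ≥0) ^ j := fun a b hab =>
    pow_le_pow_right₀ one_le_two hab
  have hm : ∀ j : ℕ, Measurable fun ω => massMeasure θ (fun i => X i ω) (Icc 0 (2 ^ j)) := fun j =>
    (Measure.measurable_coe measurableSet_Icc).comp (measurable_massMeasure θ hS.measurable_X)
  have h := lintegral_tendsto_of_tendsto_of_monotone (μ := P)
    (f := fun (j : ℕ) ω => massMeasure θ (fun i => X i ω) (Icc 0 (2 ^ j))) (F := fun _ => ∞)
    (fun j => (hm j).aemeasurable)
    (ae_of_all _ fun ω a b hab => measure_mono (Icc_subset_Icc_right (hmono hab)))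
    (ae_of_all _ fun ω => by
      have hU : ⋃ j : ℕ, Icc (0 : ℝ≥0) (2 ^ j) = univ := eq_univ_of_forall fun x => by
        obtain ⟨j, hj⟩ := pow_unbounded_of_one_lt x (one_lt_two (α := ℝ≥0))
        exact mem_iUnion.2 ⟨j, zero_le, hj.le⟩
      have := tendsto_measure_iUnion_atTop (μ := massMeasure θ fun i => X i ω)
        (s := fun j : ℕ => Icc (0 : ℝ≥0) (2 ^ j)) fun a b hab => Icc_subset_Icc_right (hmono hab)
      rwa [hU, massMeasure_univ hθ] at this)
  simpa [hS.lintegral_massMeasure_Icc] using h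

/-- Times at which the mean mass is of order `2 ^ k`. -/
theorem exists_scales (hS : IsICRT P θ X S) (hθ : IsParameter θ) :
    ∃ j : ℕ → ℕ, StrictMono j ∧
      ∀ k, 2 ^ k ≤ meanMass θ (2 ^ j k) ∧ meanMass θ (2 ^ j k) ≤ 2 ^ (k + 1) := by
  classical
  have hex : ∀ k : ℕ, ∃ j : ℕ, (2 : ℝ≥0∞) ^ k ≤ meanMass θ (2 ^ j) := fun k =>
    ((hS.tendsto_meanMass hθ).eventually_const_le (show (2 : ℝ≥0∞) ^ k < ∞ by finiteness)).exists
  -- Doubling the time at most doubles the mean mass, so the first dyadic time at which `2 ^ k` is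
  -- reached cannot overshoot `2 ^ (k + 1)`.
  have hlt : ∀ k, meanMass θ (2 ^ Nat.find (hex k)) < 2 ^ (k + 1) := by
    intro k
    rcases Nat.eq_zero_or_eq_succ_pred (Nat.find (hex k)) with h | h
    · rw [h, pow_zero]
      refine (meanMass_one_le hθ).trans_lt ?_
      exact ENNReal.one_lt_two.trans_le (le_self_pow₀ ENNReal.one_lt_two.le (Nat.succ_ne_zero k))
    · have h1 := Nat.find_min (hex k) (m := Nat.pred (Nat.find (hex k))) (by omega)
      rw [h, pow_succ', pow_succ']
      refine (meanMass_two_mul_le θ _).trans_lt ?_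
      rw [not_le] at h1
      rw [ENNReal.mul_lt_mul_iff_right (by norm_num) (by norm_num)]
      exact h1
  refine ⟨fun k => Nat.find (hex k), strictMono_nat_of_lt_succ fun k => ?_,
    fun k => ⟨Nat.find_spec (hex k), (hlt k).le⟩⟩
  by_contra h
  push Not at h
  have h1 := meanMass_mono θ (pow_le_pow_right₀ (one_le_two (α := ℝ≥0)) h)
  exact ((hlt k).trans_le ((Nat.find_spec (hex (k + 1))).trans h1)).false

/-- Chebyshev's inequality: the atoms in `[0, l]` give independent summands bounded by `θ i`, so the
variance is at most the sum of the `θ i ^ 2`, hence at most `1`, whatever `l`. -/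
theorem measure_massMeasure_lt_le (hS : IsICRT P θ X S) (hθ : IsParameter θ) {l : ℝ≥0} {r : ℝ}
    (hr : 0 < r) (h : ENNReal.ofReal r ≤ meanMass θ l) :
    P {ω | massMeasure θ (fun i => X i ω) (Icc 0 l) < ENNReal.ofReal (r / 2)} ≤
      ENNReal.ofReal (16 / r ^ 2) := by
  set c : ℝ := (θ 0 : ℝ) ^ 2 * l with hc
  have hc0 : 0 ≤ c := by positivity
  set ξ : ℕ → Ω → ℝ := fun i ω => θ (i + 1) * (Icc 0 l).indicator 1 (X (i + 1) ω) with hξ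
  have hind : ∀ i ω, (Icc 0 l).indicator (1 : ℝ≥0 → ℝ) (X (i + 1) ω) ∈ Icc (0 : ℝ) 1 := by
    intro i ω
    by_cases hx : X (i + 1) ω ∈ Icc 0 l
    · simp only [indicator_of_mem hx, Pi.one_apply]; norm_num
    · simp only [indicator_of_notMem hx]; norm_num
  have hξ0 : ∀ i ω, 0 ≤ ξ i ω := fun i ω => mul_nonneg (θ _).2 (hind i ω).1
  have hξ1 : ∀ i ω, ξ i ω ≤ θ (i + 1) := fun i ω =>
    mul_le_of_le_one_right (θ _).2 (hind i ω).2
  have hξm : ∀ i, Measurable (ξ i) := fun i =>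
    ((measurable_one.indicator measurableSet_Icc).comp (hS.measurable_X (i + 1))).const_mul _
  have hξL : ∀ i, MemLp (ξ i) 2 P := fun i =>
    MemLp.of_bound (hξm i).aestronglyMeasurable (θ (i + 1)) (ae_of_all _ fun ω => by
      rw [Real.norm_of_nonneg (hξ0 i ω)]; exact hξ1 i ω)
  have hξe : ∀ i ω, ENNReal.ofReal (ξ i ω) =
      (θ (i + 1) : ℝ≥0∞) * (Icc 0 l).indicator 1 (X (i + 1) ω) := by
    intro i ω
    by_cases hx : X (i + 1) ω ∈ Icc 0 l
    · simp [hξ, indicator_of_mem hx]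
    · simp [hξ, indicator_of_notMem hx]
  have hξE : ∀ i, ENNReal.ofReal (∫ ω, ξ i ω ∂P) =
      θ (i + 1) * ENNReal.ofReal (1 - Real.exp (-(θ (i + 1) * l))) := by
    intro i
    rw [ofReal_integral_eq_lintegral_ofReal ((hξL i).integrable one_le_two)
      (ae_of_all _ (hξ0 i))]
    simp only [hξe]
    have hm : Measurable fun ω => (Icc 0 l).indicator (1 : ℝ≥0 → ℝ≥0∞) (X (i + 1) ω) :=
      (measurable_one.indicator measurableSet_Icc).comp (hS.measurable_X (i + 1))
    rw [lintegral_const_mul _ hm]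
    rcases eq_or_ne (θ (i + 1)) 0 with h0 | h0
    · simp [h0]
    · rw [← hS.measure_X_le (Nat.le_add_left 1 i) (pos_iff_ne_zero.2 h0) l,
        ← lintegral_indicator_one (hS.measurable_X (i + 1) measurableSet_Icc)]
      rfl
  have hE0 : ∀ i, 0 ≤ ∫ ω, ξ i ω ∂P := fun i => integral_nonneg (hξ0 i)
  -- A finite subfamily suffices for a lower bound. Its mean exceeds `3 / 4 * r`, so falling below
  -- `r / 2` is a deviation of at least `r / 4`.
  obtain ⟨s, hs⟩ : ∃ s : Finset ℕ, 3 / 4 * r < c + ∑ i ∈ s, ∫ ω, ξ i ω ∂P := by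
    have h1 : ENNReal.ofReal (3 / 4 * r) < meanMass θ l :=
      lt_of_lt_of_le ((ENNReal.ofReal_lt_ofReal_iff hr).2 (by linarith)) h
    rw [meanMass, ENNReal.tsum_eq_iSup_sum, ENNReal.add_iSup, lt_iSup_iff] at h1
    obtain ⟨s, hs⟩ := h1
    refine ⟨s, ?_⟩
    simp only [← hξE] at hs
    have h2 : ((θ 0 : ℝ≥0∞) ^ 2 * l) = ENNReal.ofReal c := by
      rw [hc, ENNReal.ofReal_mul (by positivity), ENNReal.ofReal_pow (by positivity)]
      simp
    rw [h2, ← ENNReal.ofReal_sum_of_nonneg fun i _ => hE0 i,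
      ← ENNReal.ofReal_add hc0 (Finset.sum_nonneg fun i _ => hE0 i)] at hs
    exact (ENNReal.ofReal_lt_ofReal_iff_of_nonneg (by positivity)).1 hs
  have hindep : Set.Pairwise (↑s) fun i j => IndepFun (ξ i) (ξ j) P := by
    intro i _ j _ hij
    rcases eq_or_ne (θ (i + 1)) 0 with h0 | h0
    · have : ξ i = fun _ => 0 := funext fun ω => by simp [hξ, h0]
      rw [this]
      exact indepFun_const_left 0 _
    rcases eq_or_ne (θ (j + 1)) 0 with h0' | h0'
    · have : ξ j = fun _ => 0 := funext fun ω => by simp [hξ, h0']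
      rw [this]
      exact indepFun_const_right _ 0
    have h1 := hS.indep_X.indepFun
      (i := ⟨i + 1, Nat.le_add_left 1 i, pos_iff_ne_zero.2 h0⟩)
      (j := ⟨j + 1, Nat.le_add_left 1 j, pos_iff_ne_zero.2 h0'⟩)
      (fun h' => hij (Nat.succ_injective (congrArg Subtype.val h')))
    exact h1.comp (φ := fun x => (θ (i + 1) : ℝ) * (Icc 0 l).indicator (1 : ℝ≥0 → ℝ) x)
      (ψ := fun x => (θ (j + 1) : ℝ) * (Icc 0 l).indicator (1 : ℝ≥0 → ℝ) x)
      ((measurable_one.indicator measurableSet_Icc).const_mul _)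
      ((measurable_one.indicator measurableSet_Icc).const_mul _)
  have hvar : variance (∑ i ∈ s, ξ i) P ≤ 1 := by
    rw [IndepFun.variance_sum (fun i _ => hξL i) hindep]
    have h1 : ∀ i, variance (ξ i) P ≤ (θ (i + 1) : ℝ) ^ 2 := fun i => by
      refine (variance_le_expectation_sq (hξm i).aestronglyMeasurable).trans ?_
      have := integral_mono_of_nonneg (μ := P) (f := (ξ i) ^ 2)
        (g := fun _ => (θ (i + 1) : ℝ) ^ 2) (ae_of_all _ fun ω => sq_nonneg _)
        (integrable_const _) (ae_of_all _ fun ω => by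
          simp only [Pi.pow_apply]
          exact pow_le_pow_left₀ (hξ0 i ω) (hξ1 i ω) 2)
      simpa using this
    refine (Finset.sum_le_sum fun i _ => h1 i).trans ?_
    have h2 : HasSum (fun i => (θ i : ℝ) ^ 2) 1 := by
      simpa using NNReal.hasSum_coe.2 hθ.hasSum_sq
    have h3 : Summable fun i => (θ (i + 1) : ℝ) ^ 2 := (summable_nat_add_iff 1).2 h2.summable
    refine (h3.sum_le_tsum s fun i _ => sq_nonneg _).trans ?_
    have h4 := h2.summable.tsum_eq_zero_add
    rw [h2.tsum_eq] at h4
    have := sq_nonneg (θ 0 : ℝ)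
    linarith
  have hL : MemLp (∑ i ∈ s, ξ i) 2 P := memLp_finsetSum' s fun i _ => hξL i
  have hmean : ∫ ω, (∑ i ∈ s, ξ i) ω ∂P = ∑ i ∈ s, ∫ ω, ξ i ω ∂P := by
    simp only [Finset.sum_apply]
    exact integral_finsetSum s fun i _ => (hξL i).integrable one_le_two
  have hcheb := meas_ge_le_variance_div_sq hL (show 0 < r / 4 by positivity)
  rw [hmean] at hcheb
  refine (measure_mono fun ω hω => ?_).trans (hcheb.trans (ENNReal.ofReal_le_ofReal ?_))
  · have h1 : c + ∑ i ∈ s, ξ i ω < r / 2 := by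
      have h2 : ENNReal.ofReal (c + ∑ i ∈ s, ξ i ω) ≤
          massMeasure θ (fun i => X i ω) (Icc 0 l) := by
        rw [massMeasure_Icc, ENNReal.ofReal_add hc0 (Finset.sum_nonneg fun i _ => hξ0 i ω),
          ENNReal.ofReal_sum_of_nonneg fun i _ => hξ0 i ω]
        refine add_le_add (le_of_eq ?_) ?_
        · rw [hc, ENNReal.ofReal_mul (by positivity), ENNReal.ofReal_pow (by positivity)]
          simp
        · simp only [hξe]
          exact ENNReal.sum_le_tsum s
      exact (ENNReal.ofReal_lt_ofReal_iff (by positivity)).1 (h2.trans_lt hω)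
    rw [mem_ofPred_eq, Finset.sum_apply, abs_sub_comm]
    exact le_trans (by linarith) (le_abs_self _)
  · calc variance (∑ i ∈ s, ξ i) P / (r / 4) ^ 2 ≤ 1 / (r / 4) ^ 2 := by gcongr
      _ = 16 / r ^ 2 := by field_simp; norm_num

/-- Borel-Cantelli, with the summable bounds `16 / 4 ^ k`. -/
theorem ae_eventually_le_massMeasure (hS : IsICRT P θ X S) (hθ : IsParameter θ) {j : ℕ → ℕ}
    (hj : ∀ k, 2 ^ k ≤ meanMass θ (2 ^ j k)) :
    ∀ᵐ ω ∂P, ∀ᶠ k in atTop, ENNReal.ofReal (2 ^ k / 2) ≤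
      massMeasure θ (fun i => X i ω) (Icc 0 (2 ^ j k)) := by
  have h1 : ∀ k, P {ω | massMeasure θ (fun i => X i ω) (Icc 0 (2 ^ j k)) <
      ENNReal.ofReal ((2 : ℝ) ^ k / 2)} ≤ ENNReal.ofReal (16 * (1 / 4) ^ k) := fun k => by
    refine (hS.measure_massMeasure_lt_le hθ (r := (2 : ℝ) ^ k) (by positivity) ?_).trans
      (ENNReal.ofReal_le_ofReal (le_of_eq ?_))
    · refine le_of_eq_of_le ?_ (hj k)
      rw [ENNReal.ofReal_pow (by norm_num)]
      simp
    · rw [← pow_mul, mul_comm k 2, pow_mul, one_div_pow]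
      norm_num
      rfl
  have h2 : ∑' k, P {ω | massMeasure θ (fun i => X i ω) (Icc 0 (2 ^ j k)) <
      ENNReal.ofReal ((2 : ℝ) ^ k / 2)} ≠ ∞ := by
    refine ne_top_of_le_ne_top ?_ (ENNReal.tsum_le_tsum h1)
    have hs : Summable fun k : ℕ => 16 * (1 / 4 : ℝ) ^ k :=
      (summable_geometric_of_lt_one (by norm_num) (by norm_num)).mul_left 16
    exact hs.tsum_ofReal_ne_top
  filter_upwards [ae_eventually_notMem h2] with ω hω
  filter_upwards [hω] with k hk
  exact not_lt.1 hk

end IsICRT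

end

end ICRT

namespace ICRT

/-! ### Summability of the stick heights -/

/-- The dyadic cell of mesh `2 ^ (-k)` and index `a`. -/
def dyadicCell (k a : ℕ) : Set ℝ≥0 := Ioc ((a : ℝ≥0) / 2 ^ k) (((a + 1 : ℕ) : ℝ≥0) / 2 ^ k)

theorem sum_measure_dyadicCell_le (μ : Measure ℝ≥0) (k a n : ℕ) :
    ∑ i ∈ Finset.Ico a (2 ^ (n + k)), μ (dyadicCell k i) ≤ μ (Icc 0 (2 ^ n)) := by
  have hd : ((Finset.Ico a (2 ^ (n + k)) : Finset ℕ) : Set ℕ).PairwiseDisjoint (dyadicCell k) := by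
    have key : ∀ i i', i < i' → Disjoint (dyadicCell k i) (dyadicCell k i') := fun i i' h =>
      disjoint_left.2 fun x hx hx' => by
        have h1 : ((i + 1 : ℕ) : ℝ≥0) / 2 ^ k ≤ (i' : ℝ≥0) / 2 ^ k := by gcongr; exact h
        exact (hx.2.trans h1).not_gt hx'.1
    intro i _ i' _ hne
    rcases lt_or_gt_of_ne hne with h | h
    · exact key i i' h
    · exact (key i' i h).symm
  rw [← measure_biUnion_finset hd fun i _ => measurableSet_Ioc]
  refine measure_mono (iUnion₂_subset fun i hi x hx => ⟨zero_le, hx.2.trans ?_⟩)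
  rw [div_le_iff₀ (by positivity), ← pow_add]
  exact_mod_cast (Finset.mem_Ico.1 hi).2

open Classical in
/-- The number of dyadic cells, between the times `2 ^ (j k)` and `a / 2 ^ k`, from which there is
no cut up to time `a / 2 ^ k`. -/
def runLength (S : Sticks) (j : ℕ → ℕ) (k a : ℕ) : ℝ≥0∞ :=
  ∑ c ∈ Finset.Ico (2 ^ (j k + k)) a,
    if S.cutMeasure (Ioc ((c : ℝ≥0) / 2 ^ k) ((a : ℝ≥0) / 2 ^ k)) = 0 then 1 else 0

/-- The indices of the dyadic cells between `2 ^ j (k + 1)` and `2 ^ j (k + 2)`. -/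
def dyadicBlock (j : ℕ → ℕ) (k : ℕ) : Finset ℕ :=
  Finset.Ico (2 ^ (j (k + 1) + k)) (2 ^ (j (k + 2) + k))

open Classical in
/-- An upper bound on the contribution to the stick heights of the cells of index `a`. -/
def cellWeight (μ : Measure ℝ≥0) (S : Sticks) (j : ℕ → ℕ) (k a : ℕ) : ℝ≥0∞ :=
  if ENNReal.ofReal (2 ^ k / 2) ≤ μ (Icc 0 (2 ^ j k)) then
    2 * (4 ^ k)⁻¹ * (2 + runLength S j k a) else 0

theorem sum_pow_sub_le {r : ℝ≥0∞} (hr : r ≤ 1) (b a : ℕ) :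
    ∑ c ∈ Finset.Ico b a, r ^ (a - c) ≤ (1 - r)⁻¹ := by
  rw [← ENNReal.tsum_geometric]
  calc ∑ c ∈ Finset.Ico b a, r ^ (a - c) ≤ ∑ c ∈ Finset.range a, r ^ (a - c) :=
        Finset.sum_le_sum_of_subset fun c hc => Finset.mem_range.2 (Finset.mem_Ico.1 hc).2
    _ ≤ ∑ c ∈ Finset.range a, r ^ (a - 1 - c) :=
        Finset.sum_le_sum fun c _ => pow_le_pow_right_of_le_one' hr (by omega)
    _ = ∑ c ∈ Finset.range a, r ^ c := Finset.sum_range_reflect _ _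
    _ ≤ _ := ENNReal.sum_le_tsum _

/-! ### Control of stick heights by runs of cells without cuts. -/

section Deterministic

variable {μ : Measure ℝ≥0} {S : Sticks} {j : ℕ → ℕ}

/-- Every cell index from the ceiling of `y n * 2 ^ k` up to `a` is counted: the next cut lies
beyond `a / 2 ^ k`. -/
theorem le_runLength {k a n : ℕ} (hy : 2 ^ j k ≤ S.y n) (ha : (a : ℝ≥0) / 2 ^ k < S.y (n + 1)) :
    ((a - ⌈S.y n * 2 ^ k⌉₊ : ℕ) : ℝ≥0∞) ≤ runLength S j k a := by
  classical
  have h1 : ((a - ⌈S.y n * 2 ^ k⌉₊ : ℕ) : ℝ≥0∞) =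
      ∑ c ∈ Finset.Ico ⌈S.y n * 2 ^ k⌉₊ a, 1 := by simp
  have hlo : 2 ^ (j k + k) ≤ ⌈S.y n * 2 ^ k⌉₊ := by
    have h2 : ((2 ^ (j k + k) : ℕ) : ℝ≥0) ≤ ⌈S.y n * 2 ^ k⌉₊ := by
      refine le_trans ?_ (Nat.le_ceil _)
      push_cast
      rw [pow_add]
      gcongr
    exact_mod_cast h2
  rw [h1, runLength]
  refine (Finset.sum_le_sum fun c hc => ?_).trans
    (Finset.sum_le_sum_of_subset (Finset.Ico_subset_Ico_left hlo))
  rw [if_pos]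
  rw [S.cutMeasure_eq_zero_iff measurableSet_Ioc]
  rintro i ⟨h3, h4⟩
  have h5 : S.y n ≤ (c : ℝ≥0) / 2 ^ k := by
    rw [le_div_iff₀ (by positivity)]
    exact Nat.ceil_le.1 (Finset.mem_Ico.1 hc).1
  have h6 := S.strictMono_y.lt_iff_lt.1 (h5.trans_lt h3)
  have h7 := S.strictMono_y.lt_iff_lt.1 (h4.trans_lt ha)
  omega

/-- The distance from the cut to `x` is at most the run of complete cells plus two partial ones, of
length `2 ^ (-k)` each, while the mass in the denominator is at least `2 ^ k / 2`. -/
theorem sub_mul_inv_le_cellWeight {k a n : ℕ} {x : ℝ≥0}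
    (hgood : ENNReal.ofReal (2 ^ k / 2) ≤ μ (Icc 0 (2 ^ j k))) (hy : 2 ^ j k ≤ S.y n)
    (hx : x ∈ Ioc (S.y n) (S.y (n + 1))) (hxa : x ∈ dyadicCell k a) :
    ((x - S.y n : ℝ≥0) : ℝ≥0∞) * (μ (Icc 0 (S.y (n + 1))))⁻¹ ≤ cellWeight μ S j k a := by
  rw [cellWeight, if_pos hgood]
  have h1 := le_runLength (j := j) hy (hxa.1.trans_le hx.2)
  have h2 : (μ (Icc 0 (S.y (n + 1))))⁻¹ ≤ 2 * (2 ^ k)⁻¹ := by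
    have h3 : (2 : ℝ≥0∞) * (2 ^ k)⁻¹ = (ENNReal.ofReal (2 ^ k / 2))⁻¹ := by
      rw [ENNReal.ofReal_div_of_pos two_pos, ENNReal.inv_div (by simp) (by simp),
        ENNReal.ofReal_pow two_pos.le, ENNReal.ofReal_ofNat, ENNReal.div_eq_inv_mul, mul_comm]
    rw [h3, ENNReal.inv_le_inv]
    exact hgood.trans (measure_mono (Icc_subset_Icc_right
      (hy.trans (S.strictMono_y.monotone (Nat.le_succ n)))))
  have h4 : x - S.y n ≤ (((a - ⌈S.y n * 2 ^ k⌉₊ : ℕ) : ℝ≥0) + 2) * (2 ^ k)⁻¹ := by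
    rw [← div_eq_mul_inv, le_div_iff₀ (by positivity), tsub_mul, tsub_le_iff_right]
    have h5 : x * 2 ^ k ≤ ((a + 1 : ℕ) : ℝ≥0) := by
      have := hxa.2
      rwa [le_div_iff₀ (by positivity)] at this
    have h6 : (⌈S.y n * 2 ^ k⌉₊ : ℝ≥0) ≤ S.y n * 2 ^ k + 1 :=
      (Nat.ceil_lt_add_one zero_le).le
    have h7 : ((a + 1 : ℕ) : ℝ≥0) ≤ ((a - ⌈S.y n * 2 ^ k⌉₊ : ℕ) : ℝ≥0) + ⌈S.y n * 2 ^ k⌉₊ + 1 := by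
      exact_mod_cast (by omega)
    calc x * 2 ^ k ≤ ((a - ⌈S.y n * 2 ^ k⌉₊ : ℕ) : ℝ≥0) + ⌈S.y n * 2 ^ k⌉₊ + 1 := h5.trans h7
      _ ≤ ((a - ⌈S.y n * 2 ^ k⌉₊ : ℕ) : ℝ≥0) + (S.y n * 2 ^ k + 1) + 1 := by gcongr
      _ = _ := by ring
  have h8 : ((x - S.y n : ℝ≥0) : ℝ≥0∞) ≤ (runLength S j k a + 2) * (2 ^ k)⁻¹ := by
    refine (ENNReal.coe_le_coe.2 h4).trans ?_
    rw [ENNReal.coe_mul, ENNReal.coe_inv (by positivity)]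
    push_cast
    gcongr
    exact_mod_cast h1
  calc _ ≤ (runLength S j k a + 2) * (2 ^ k)⁻¹ * (2 * (2 ^ k)⁻¹) := mul_le_mul' h8 h2
    _ = 2 * ((2 ^ k)⁻¹ * (2 ^ k)⁻¹) * (2 + runLength S j k a) := by ring
    _ = _ := by
      rw [← ENNReal.mul_inv (by simp) (by simp), ← mul_pow]
      norm_num

theorem exists_block (hj : StrictMono j) {k₀ : ℕ} {x : ℝ≥0} (hx : 2 ^ j (k₀ + 1) < x) :
    ∃ k, k₀ ≤ k ∧ 2 ^ j (k + 1) < x ∧ x ≤ 2 ^ j (k + 2) := by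
  classical
  have hex : ∃ k, x ≤ 2 ^ j (k₀ + k + 2) := by
    obtain ⟨m, hm⟩ := pow_unbounded_of_one_lt x (one_lt_two (α := ℝ≥0))
    refine ⟨m, hm.le.trans (pow_le_pow_right₀ one_le_two ?_)⟩
    have := hj.id_le (k₀ + m + 2)
    simp only [id] at this
    omega
  refine ⟨k₀ + Nat.find hex, Nat.le_add_right _ _, ?_, Nat.find_spec hex⟩
  rcases Nat.eq_zero_or_eq_succ_pred (Nat.find hex) with h | h
  · rw [h]
    exact hx
  · have h1 := Nat.find_min hex (m := (Nat.find hex).pred) (by omega)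
    rw [not_le] at h1
    have h2 : k₀ + Nat.find hex + 1 = k₀ + (Nat.find hex).pred + 2 := by omega
    rwa [h2]

theorem exists_mem_dyadicCell {k m m' : ℕ} {x : ℝ≥0} (h : 2 ^ m < x) (h' : x ≤ 2 ^ m') :
    ∃ a ∈ Finset.Ico (2 ^ (m + k)) (2 ^ (m' + k)), x ∈ dyadicCell k a := by
  have hk : (0 : ℝ≥0) < 2 ^ k := by positivity
  have hpos : 0 < ⌈x * 2 ^ k⌉₊ := Nat.ceil_pos.2 (mul_pos (lt_of_le_of_lt zero_le h) hk)
  obtain ⟨a, ha⟩ := Nat.exists_eq_succ_of_ne_zero hpos.ne'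
  rw [Nat.succ_eq_add_one] at ha
  have h1 : (a : ℝ≥0) < x * 2 ^ k := Nat.lt_ceil.1 (by omega)
  have h2 : x * 2 ^ k ≤ (a + 1 : ℕ) := by
    rw [← ha]
    exact Nat.le_ceil _
  refine ⟨a, Finset.mem_Ico.2 ⟨?_, ?_⟩, ?_, ?_⟩
  · have h3 : ((2 ^ (m + k) : ℕ) : ℝ≥0) < ((a + 1 : ℕ) : ℝ≥0) := by
      refine lt_of_lt_of_le ?_ h2
      push_cast
      rw [pow_add]
      gcongr
    have h4 : 2 ^ (m + k) < a + 1 := by exact_mod_cast h3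
    omega
  · have h3 : (a : ℝ≥0) < ((2 ^ (m' + k) : ℕ) : ℝ≥0) := by
      refine lt_of_lt_of_le h1 ?_
      push_cast
      rw [pow_add]
      gcongr
    exact_mod_cast h3
  · rwa [div_lt_iff₀ hk]
  · rwa [le_div_iff₀ hk]

/-- A deterministic criterion for the summability of the stick heights. -/
theorem tsum_stickHeight_ne_top (hj : StrictMono j)
    (hgood : ∀ᶠ k in atTop, ENNReal.ofReal (2 ^ k / 2) ≤ μ (Icc 0 (2 ^ j k)))
    (hgap : ∀ᶠ n in atTop, S.y (n + 1) ≤ 2 * S.y n)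
    (hsum : ∑' k, ∑ a ∈ dyadicBlock j k, cellWeight μ S j k a * μ (dyadicCell k a) ≠ ∞) :
    ∑' n, ∫⁻ x in Ioc (S.y n) (S.y (n + 1)), ((x - S.y n : ℝ≥0) : ℝ≥0∞)
      ∂(μ[|Icc 0 (S.y (n + 1))]) ≠ ∞ := by
  -- A single function dominates the integrand on all late sticks; its integral is the assumed
  -- finite sum.
  set h : ℝ≥0 → ℝ≥0∞ := fun x => ∑' k, ∑ a ∈ dyadicBlock j k,
    (dyadicCell k a).indicator (fun _ => cellWeight μ S j k a) x with hh
  have hcm : ∀ k a, Measurable ((dyadicCell k a).indicator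
      fun _ : ℝ≥0 => cellWeight μ S j k a) := fun k a =>
    measurable_const.indicator measurableSet_Ioc
  have hint : ∫⁻ x, h x ∂μ ≠ ∞ := by
    rw [lintegral_tsum fun k => (Finset.measurable_fun_sum _ fun a _ => hcm k a).aemeasurable]
    convert hsum using 4 with k
    rw [lintegral_finsetSum _ fun a _ => hcm k a]
    exact Finset.sum_congr rfl fun a _ => lintegral_indicator_const measurableSet_Ioc _
  obtain ⟨k₀, hk₀⟩ := eventually_atTop.1 hgood
  obtain ⟨N, hN⟩ := eventually_atTop.1
    (hgap.and (S.tendsto_y.eventually_ge_atTop (2 ^ j (k₀ + 1))))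
  have hpt : ∀ n, N ≤ n → ∀ x ∈ Ioc (S.y n) (S.y (n + 1)),
      ((x - S.y n : ℝ≥0) : ℝ≥0∞) * (μ (Icc 0 (S.y (n + 1))))⁻¹ ≤ h x := by
    intro n hn x hx
    obtain ⟨k, hk, h1, h2⟩ := exists_block hj ((hN n hn).2.trans_lt hx.1)
    obtain ⟨a, ha, hxa⟩ := exists_mem_dyadicCell (k := k) h1 h2
    -- The point `x` is beyond `2 ^ j (k + 1)`, at least twice `2 ^ j k`. Since the cuts at most
    -- double, the cut before `x` is already beyond `2 ^ j k`, where the mass is known to be large.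
    have hy : 2 ^ j k ≤ S.y n := by
      have h3 : (2 : ℝ≥0) * 2 ^ j k ≤ 2 * S.y n := by
        calc (2 : ℝ≥0) * 2 ^ j k = 2 ^ (j k + 1) := (pow_succ' _ _).symm
          _ ≤ 2 ^ j (k + 1) := pow_le_pow_right₀ one_le_two (hj (Nat.lt_succ_self k))
          _ ≤ x := h1.le
          _ ≤ _ := hx.2.trans (hN n hn).1
      exact le_of_mul_le_mul_left h3 two_pos
    refine (sub_mul_inv_le_cellWeight (hk₀ k hk) hy hx hxa).trans ?_
    refine le_trans ?_ (ENNReal.le_tsum k)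
    calc cellWeight μ S j k a = (dyadicCell k a).indicator (fun _ => cellWeight μ S j k a) x :=
          (indicator_of_mem hxa fun _ => cellWeight μ S j k a).symm
      _ ≤ ∑ a ∈ dyadicBlock j k, (dyadicCell k a).indicator (fun _ => cellWeight μ S j k a) x :=
          Finset.single_le_sum_of_canonicallyOrdered (f := fun a => (dyadicCell k a).indicator
            (fun _ => cellWeight μ S j k a) x) ha
  have hle : ∀ n, N ≤ n → ∫⁻ x in Ioc (S.y n) (S.y (n + 1)), ((x - S.y n : ℝ≥0) : ℝ≥0∞)
      ∂(μ[|Icc 0 (S.y (n + 1))]) ≤ ∫⁻ x in Ioc (S.y n) (S.y (n + 1)), h x ∂μ := by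
    intro n hn
    have hr : (μ[|Icc 0 (S.y (n + 1))]).restrict (Ioc (S.y n) (S.y (n + 1))) =
        (μ (Icc 0 (S.y (n + 1))))⁻¹ • μ.restrict (Ioc (S.y n) (S.y (n + 1))) := by
      rw [ProbabilityTheory.cond, Measure.restrict_smul, Measure.restrict_restrict measurableSet_Ioc,
        inter_eq_left.2 (Ioc_subset_Icc_self.trans (Icc_subset_Icc_left zero_le))]
    have hmx : Measurable fun x : ℝ≥0 => ((x - S.y n : ℝ≥0) : ℝ≥0∞) :=
      (measurable_id.sub_const _).coe_nnreal_ennreal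
    rw [hr, lintegral_smul_measure, smul_eq_mul, mul_comm, ← lintegral_mul_const _ hmx]
    exact setLIntegral_mono' measurableSet_Ioc (hpt n hn)
  -- The first `N` sticks have finite contributions individually.
  rw [← ENNReal.summable.sum_add_tsum_nat_add' (k := N)]
  refine ENNReal.add_ne_top.2 ⟨ENNReal.sum_ne_top.2 fun n _ => ?_, ?_⟩
  · refine ne_top_of_le_ne_top (b := (S.y (n + 1) : ℝ≥0∞) *
      (μ[|Icc 0 (S.y (n + 1))]) (Ioc (S.y n) (S.y (n + 1)))) ?_ ?_
    · refine ENNReal.mul_ne_top ENNReal.coe_ne_top ?_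
      rw [cond_apply measurableSet_Icc]
      refine ne_top_of_le_ne_top ENNReal.one_ne_top (le_trans ?_
        (ENNReal.inv_mul_le_one (μ (Icc 0 (S.y (n + 1))))))
      gcongr
      exact inter_subset_left
    · rw [← setLIntegral_const]
      refine setLIntegral_mono' measurableSet_Ioc fun x hx => ENNReal.coe_le_coe.2 ?_
      exact tsub_le_self.trans hx.2
  · refine ne_top_of_le_ne_top hint ?_
    calc _ ≤ ∑' n, ∫⁻ x in Ioc (S.y (n + N)) (S.y (n + N + 1)), h x ∂μ :=
          ENNReal.tsum_le_tsum fun n => hle (n + N) (Nat.le_add_left N n)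
      _ = ∫⁻ x in ⋃ n, Ioc (S.y (n + N)) (S.y (n + N + 1)), h x ∂μ := by
          refine (lintegral_iUnion (fun n => measurableSet_Ioc) ?_ _).symm
          intro a b hab
          refine disjoint_left.2 fun x hx hx' => hab ?_
          have h1 := S.strictMono_y.lt_iff_lt.1 (hx.1.trans_le hx'.2)
          have h2 := S.strictMono_y.lt_iff_lt.1 (hx'.1.trans_le hx.2)
          omega
      _ ≤ _ := setLIntegral_le_lintegral _ _

end Deterministic

/-! ### Expectation of the cell weights. -/

section

variable {Ω : Type*} {mΩ : MeasurableSpace Ω} {P : Measure Ω}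
  {θ : ℕ → ℝ≥0} {X : ℕ → Ω → ℝ≥0} {S : Ω → Sticks}

namespace IsICRT

theorem measurable_cellWeight (hS : IsICRT P θ X S) (j : ℕ → ℕ) (k a : ℕ) :
    Measurable fun ω => cellWeight (massMeasure θ fun i => X i ω) (S ω) j k a := by
  have hmass := measurable_massMeasure θ hS.measurable_X
  refine Measurable.ite (measurableSet_le measurable_const
    ((Measure.measurable_coe measurableSet_Icc).comp hmass)) ?_ measurable_const
  refine Measurable.const_mul (Measurable.const_add (Finset.measurable_fun_sum _ fun c _ => ?_) _) _
  exact Measurable.ite (hS.measurableSet_noCut measurableSet_Ioc) measurable_const measurable_const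

variable [IsProbabilityMeasure P]

/-- Beyond time `2 ^ j k` on the good event, cuts have rate at least `2 ^ k / 2`. The absence of a
cut on `a - c` cells of length `2 ^ (-k)` then has conditional probability at most `exp (-(a - c) /
2)`, and the mass of the cell is fixed by the conditioning. -/
theorem setLIntegral_noCut_le (hS : IsICRT P θ X S) {j : ℕ → ℕ} {k c a : ℕ}
    (hc : 2 ^ (j k + k) ≤ c) :
    ∫⁻ ω in {ω | (S ω).cutMeasure (Ioc ((c : ℝ≥0) / 2 ^ k) ((a : ℝ≥0) / 2 ^ k)) = 0},
      {ω | ENNReal.ofReal (2 ^ k / 2) ≤ massMeasure θ (fun i => X i ω)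
        (Icc 0 (2 ^ j k))}.indicator
        (fun ω => massMeasure θ (fun i => X i ω) (dyadicCell k a)) ω ∂P ≤
      ENNReal.ofReal (Real.exp (-(1 / 2))) ^ (a - c) *
        ∫⁻ ω, massMeasure θ (fun i => X i ω) (dyadicCell k a) ∂P := by
  have hmass : Measurable[sigmaMass θ X] fun ω => massMeasure θ fun i => X i ω :=
    comap_measurable _
  have hcell : Measurable[sigmaMass θ X] fun ω =>
      massMeasure θ (fun i => X i ω) (dyadicCell k a) :=
    (Measure.measurable_coe measurableSet_Ioc).comp hmass
  have hgood : MeasurableSet[sigmaMass θ X] {ω | ENNReal.ofReal (2 ^ k / 2) ≤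
      massMeasure θ (fun i => X i ω) (Icc 0 (2 ^ j k))} :=
    measurableSet_le measurable_const ((Measure.measurable_coe measurableSet_Icc).comp hmass)
  rw [hS.setLIntegral_noCut measurableSet_Ioc (Metric.isBounded_Ioc _ _)
    (hcell.indicator hgood), ← lintegral_const_mul _ (hcell.mono hS.sigmaMass_le le_rfl)]
  refine lintegral_mono_ae ?_
  filter_upwards [hS.ae_isLocFin] with ω hfin
  by_cases hω : ω ∈ {ω | ENNReal.ofReal (2 ^ k / 2) ≤
      massMeasure θ (fun i => X i ω) (Icc 0 (2 ^ j k))}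
  swap
  · rw [indicator_of_notMem hω, mul_zero]
    exact zero_le
  rw [indicator_of_mem hω]
  gcongr
  refine (voidProb_le hfin _ _).trans ?_
  rw [← ENNReal.ofReal_pow (Real.exp_pos _).le, ← Real.exp_nat_mul]
  refine ENNReal.ofReal_le_ofReal (Real.exp_le_exp.2 ?_)
  have h1 : (2 : ℝ) ^ k / 2 ≤ (massMeasure θ fun i => X i ω).real (Icc 0 ((c : ℝ≥0) / 2 ^ k)) := by
    refine (ENNReal.ofReal_le_iff_le_toReal (hfin.ne_top _)).1 (le_trans hω (measure_mono
      (Icc_subset_Icc_right ?_)))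
    rw [le_div_iff₀ (by positivity), ← pow_add]
    exact_mod_cast hc
  have h2 : (((a : ℝ≥0) / 2 ^ k - (c : ℝ≥0) / 2 ^ k : ℝ≥0) : ℝ) = ((a - c : ℕ) : ℝ) / 2 ^ k := by
    rw [← tsub_div, ← Nat.cast_tsub, NNReal.coe_div, NNReal.coe_natCast, NNReal.coe_pow]
    rfl
  rw [h2]
  have h3 : (2 : ℝ) ^ k / 2 * (((a - c : ℕ) : ℝ) / 2 ^ k) = ((a - c : ℕ) : ℝ) * (1 / 2) := by
    field_simp
  have h4 := mul_le_mul_of_nonneg_right h1 (show 0 ≤ ((a - c : ℕ) : ℝ) / 2 ^ k by positivity)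
  linarith

/-- The expected run length is a geometric sum, bounded uniformly in `k` and `a`. -/
theorem lintegral_cellWeight_le (hS : IsICRT P θ X S) (j : ℕ → ℕ) (k a : ℕ) :
    ∫⁻ ω, cellWeight (massMeasure θ fun i => X i ω) (S ω) j k a *
      massMeasure θ (fun i => X i ω) (dyadicCell k a) ∂P ≤
      2 * (4 ^ k)⁻¹ * (2 + (1 - ENNReal.ofReal (Real.exp (-(1 / 2))))⁻¹) *
        ∫⁻ ω, massMeasure θ (fun i => X i ω) (dyadicCell k a) ∂P := by
  classical
  set r := ENNReal.ofReal (Real.exp (-(1 / 2)))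
  have hr1 : r ≤ 1 := by
    rw [ENNReal.ofReal_le_one, Real.exp_le_one_iff]
    norm_num
  set good : Set Ω := {ω | ENNReal.ofReal (2 ^ k / 2) ≤ massMeasure θ (fun i => X i ω)
        (Icc 0 (2 ^ j k))} with hgood
  have hmass := measurable_massMeasure θ hS.measurable_X
  have hcell : Measurable fun ω => massMeasure θ (fun i => X i ω) (dyadicCell k a) :=
    (Measure.measurable_coe measurableSet_Ioc).comp hmass
  have hgm : MeasurableSet good :=
    measurableSet_le measurable_const ((Measure.measurable_coe measurableSet_Icc).comp hmass)
  have hnc : ∀ c : ℕ, MeasurableSet {ω | (S ω).cutMeasure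
      (Ioc ((c : ℝ≥0) / 2 ^ k) ((a : ℝ≥0) / 2 ^ k)) = 0} := fun c =>
    hS.measurableSet_noCut measurableSet_Ioc
  set g : Ω → ℝ≥0∞ := good.indicator fun ω => massMeasure θ (fun i => X i ω) (dyadicCell k a)
    with hg
  have hgmeas : Measurable g := hcell.indicator hgm
  have heq : ∀ ω, cellWeight (massMeasure θ fun i => X i ω) (S ω) j k a *
      massMeasure θ (fun i => X i ω) (dyadicCell k a) = 2 * (4 ^ k)⁻¹ * (2 * g ω +
        ∑ c ∈ Finset.Ico (2 ^ (j k + k)) a, {ω | (S ω).cutMeasure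
          (Ioc ((c : ℝ≥0) / 2 ^ k) ((a : ℝ≥0) / 2 ^ k)) = 0}.indicator g ω) := by
    intro ω
    by_cases hω : ω ∈ good
    · have hω' : ENNReal.ofReal (2 ^ k / 2) ≤ massMeasure θ (fun i => X i ω)
        (Icc 0 (2 ^ j k)) := hω
      rw [cellWeight, if_pos hω', mul_assoc, add_mul, runLength, Finset.sum_mul]
      have h1 : g ω = massMeasure θ (fun i => X i ω) (dyadicCell k a) := indicator_of_mem hω _
      rw [h1]
      congr 2
      refine Finset.sum_congr rfl fun c _ => ?_
      by_cases hc : ω ∈ {ω | (S ω).cutMeasure (Ioc ((c : ℝ≥0) / 2 ^ k) ((a : ℝ≥0) / 2 ^ k)) = 0}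
      · rw [indicator_of_mem hc, if_pos (by exact hc), one_mul, h1]
      · rw [indicator_of_notMem hc, if_neg (by exact hc), zero_mul]
    · have h1 : g ω = 0 := indicator_of_notMem hω _
      have hω' : ¬ ENNReal.ofReal (2 ^ k / 2) ≤ massMeasure θ (fun i => X i ω)
        (Icc 0 (2 ^ j k)) := hω
      rw [cellWeight, if_neg hω', h1, zero_mul]
      simp [indicator, h1]
  simp only [heq]
  have hsumm : Measurable fun ω => 2 * g ω + ∑ c ∈ Finset.Ico (2 ^ (j k + k)) a,
      {ω | (S ω).cutMeasure (Ioc ((c : ℝ≥0) / 2 ^ k) ((a : ℝ≥0) / 2 ^ k)) = 0}.indicator g ω :=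
    (hgmeas.const_mul _).add (Finset.measurable_fun_sum _ fun c _ => hgmeas.indicator (hnc c))
  rw [lintegral_const_mul _ hsumm, lintegral_add_left (hgmeas.const_mul _),
    lintegral_const_mul _ hgmeas,
    lintegral_finsetSum _ fun c _ => hgmeas.indicator (hnc c),
    mul_assoc (2 * (4 ^ k)⁻¹ : ℝ≥0∞), add_mul]
  gcongr
  · exact indicator_le_self _ _ _
  · refine (Finset.sum_le_sum fun c hc => ?_).trans (le_trans (le_of_eq (Finset.sum_mul _ _ _).symm)
      (mul_le_mul_left (sum_pow_sub_le hr1 (2 ^ (j k + k)) a) _))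
    rw [lintegral_indicator (hnc c)]
    exact hS.setLIntegral_noCut_le (Finset.mem_Ico.1 hc).1

theorem ae_tsum_cellWeight_ne_top (hS : IsICRT P θ X S) {j : ℕ → ℕ}
    (hj : ∀ k, meanMass θ (2 ^ j k) ≤ 2 ^ (k + 1)) :
    ∀ᵐ ω ∂P, ∑' k, ∑ a ∈ dyadicBlock j k, cellWeight (massMeasure θ fun i => X i ω) (S ω) j k a *
      massMeasure θ (fun i => X i ω) (dyadicCell k a) ≠ ∞ := by
  have hmass := measurable_massMeasure θ hS.measurable_X
  have hm : ∀ k a, Measurable fun ω => cellWeight (massMeasure θ fun i => X i ω) (S ω) j k a *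
      massMeasure θ (fun i => X i ω) (dyadicCell k a) := fun k a =>
    (hS.measurable_cellWeight j k a).mul ((Measure.measurable_coe measurableSet_Ioc).comp hmass)
  have hms : ∀ k, Measurable fun ω => ∑ a ∈ dyadicBlock j k,
      cellWeight (massMeasure θ fun i => X i ω) (S ω) j k a *
      massMeasure θ (fun i => X i ω) (dyadicCell k a) := fun k =>
    Finset.measurable_fun_sum _ fun a _ => hm k a
  set C : ℝ≥0∞ := 2 + (1 - ENNReal.ofReal (Real.exp (-(1 / 2))))⁻¹ with hC
  have hCtop : C ≠ ∞ := by
    refine ENNReal.add_ne_top.2 ⟨by simp, ENNReal.inv_ne_top.2 (tsub_pos_of_lt ?_).ne'⟩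
    rw [ENNReal.ofReal_lt_one, Real.exp_lt_one_iff]
    norm_num
  have hblock : ∀ k, ∫⁻ ω, ∑ a ∈ dyadicBlock j k,
      cellWeight (massMeasure θ fun i => X i ω) (S ω) j k a *
      massMeasure θ (fun i => X i ω) (dyadicCell k a) ∂P ≤ 16 * C * 2⁻¹ ^ k := by
    intro k
    rw [lintegral_finsetSum _ fun a _ => hm k a]
    refine (Finset.sum_le_sum fun a _ => hS.lintegral_cellWeight_le j k a).trans ?_
    have hcell : ∀ a ∈ dyadicBlock j k, Measurable fun ω =>
        massMeasure θ (fun i => X i ω) (dyadicCell k a) := fun a _ =>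
      (Measure.measurable_coe measurableSet_Ioc).comp hmass
    rw [← Finset.mul_sum, ← lintegral_finsetSum _ hcell]
    -- The cells of the block are disjoint and lie in `[0, 2 ^ j (k + 2)]`, whose mean mass is at
    -- most `2 ^ (k + 3)`. Against the weight of order `4 ^ (-k)`, this leaves a geometric series.
    have h1 : ∫⁻ ω, ∑ a ∈ dyadicBlock j k, massMeasure θ (fun i => X i ω) (dyadicCell k a) ∂P ≤
        2 ^ (k + 3) := by
      refine (lintegral_mono fun ω => sum_measure_dyadicCell_le _ k _ (j (k + 2))).trans ?_
      rw [hS.lintegral_massMeasure_Icc]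
      exact hj (k + 2)
    refine (mul_le_mul_right h1 _).trans (le_of_eq ?_)
    have h2 : ((4 : ℝ≥0∞) ^ k)⁻¹ * 2 ^ k = 2⁻¹ ^ k := by
      rw [show (4 : ℝ≥0∞) = 2 * 2 by norm_num, mul_pow, ENNReal.mul_inv (by simp) (by simp),
        mul_assoc, ENNReal.inv_mul_cancel (by simp) (by simp), mul_one, ENNReal.inv_pow]
    rw [← h2, pow_add]
    ring
  have hfinal : ∫⁻ ω, ∑' k, ∑ a ∈ dyadicBlock j k,
      cellWeight (massMeasure θ fun i => X i ω) (S ω) j k a *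
      massMeasure θ (fun i => X i ω) (dyadicCell k a) ∂P ≠ ∞ := by
    rw [lintegral_tsum fun k => (hms k).aemeasurable]
    refine ne_top_of_le_ne_top ?_ (ENNReal.tsum_le_tsum hblock)
    rw [ENNReal.tsum_mul_left, ENNReal.tsum_geometric, ENNReal.one_sub_inv_two, inv_inv]
    finiteness
  filter_upwards [ae_lt_top (measurable_tsum_nat hms) hfinal] with ω hω using hω.ne

theorem ae_tsum_stickHeight_ne_top (hS : IsICRT P θ X S) (hθ : IsParameter θ) :
    ∀ᵐ ω ∂P, ∑' n, stickHeight θ X S n ω ≠ ∞ := by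
  obtain ⟨j, hj, hj'⟩ := hS.exists_scales hθ
  filter_upwards [hS.ae_isLocFin, hS.ae_eventually_le_massMeasure hθ fun k => (hj' k).1,
    hS.ae_tsum_cellWeight_ne_top fun k => (hj' k).2, hS.ae_sparseEmptyCells hθ one_pos] with
    ω hfin hgood hsum hsparse
  have hy : Tendsto (fun n => ((S ω).y (n + 1) : ℝ)) atTop atTop :=
    (NNReal.tendsto_coe_atTop.2 (S ω).tendsto_y).comp (tendsto_add_atTop_nat 1)
  have hr : (fun x : ℝ => x ^ (3 / 4 : ℝ)) =o[atTop] fun x : ℝ => x := by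
    refine (Asymptotics.isLittleO_iff_tendsto' ?_).2 ?_
    · filter_upwards [eventually_gt_atTop 0] with x hx h0
      exact absurd h0 hx.ne'
    · refine (tendsto_rpow_neg_atTop (show (0 : ℝ) < 1 / 4 by norm_num)).congr' ?_
      filter_upwards [eventually_gt_atTop 0] with x hx
      rw [← Real.rpow_sub_one hx.ne']
      norm_num
  have ho := hsparse.gap_isBigO.trans_isLittleO (hr.comp_tendsto hy)
  -- Gaps are sublinear in the position of the next cut, so eventually at most half of it.
  have hgap : ∀ᶠ n in atTop, (S ω).y (n + 1) ≤ 2 * (S ω).y n := by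
    filter_upwards [ho.bound (show (0 : ℝ) < 1 / 2 by norm_num)] with n hn
    rw [Function.comp_apply, Real.norm_of_nonneg (NNReal.coe_nonneg _)] at hn
    have h1 := (le_abs_self _).trans hn
    rw [← NNReal.coe_le_coe]
    push_cast
    linarith
  have h := tsum_stickHeight_ne_top hj hgood hgap hsum
  convert h using 3 with n
  rw [stickHeight, gluingKernel_apply hfin]
  rfl

end IsICRT

end

end ICRT

namespace ICRT

/-! ### Convergence of the normalized measures -/

/-- The condition that defines `Sticks.projSet`. -/
def projectedSet (m i j : ℕ) : Set ((ℕ → ℝ≥0) × (ℝ≥0 × ℝ≥0)) := {p | p.2.1 ∈ cell p.1 m i j}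

theorem measurableSet_projectedSet (m i j : ℕ) : MeasurableSet (projectedSet m i j) :=
  (measurableSet_cell m i j).preimage (measurable_fst.prodMk (measurable_fst.comp measurable_snd))

theorem ancestorSet_projectedSet (S : Sticks) (K m i j : ℕ) :
    S.ancestorSet K (projectedSet m i j) = S.projSet K m i j := rfl

section

variable {Ω : Type*} {mΩ : MeasurableSpace Ω} {P : Measure Ω} [IsProbabilityMeasure P]
  {θ : ℕ → ℝ≥0} {X : ℕ → Ω → ℝ≥0} {S : Ω → Sticks}

namespace IsICRT

theorem ae_exists_tendsto_projSet (hS : IsICRT P θ X S) :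
    ∀ᵐ ω ∂P, ∃ L : ℕ → ℕ → ℕ → ℕ → ℝ, ∀ K m i j, 0 < K → 0 < m →
      Tendsto (fun n => ((massMeasure θ fun i => X i ω)[|Icc 0 ((S ω).y n)]).real
        ((S ω).projSet K m i j)) atTop (𝓝 (L K m i j)) := by
  have h : ∀ᵐ ω ∂P, ∀ K m i j, ∃ a, 0 < K →
      Tendsto (fun n => ((massMeasure θ fun i => X i ω)[|Icc 0 ((S ω).y n)]).real
        ((S ω).projSet K m i j)) atTop (𝓝 a) := by
    refine ae_all_iff.2 fun K => ae_all_iff.2 fun m => ae_all_iff.2 fun i => ae_all_iff.2 fun j => ?_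
    by_cases hK : 0 < K
    · have h1 := hS.ae_exists_tendsto_proportion hK (measurableSet_projectedSet m i j)
      simp only [ancestorSet_projectedSet] at h1
      filter_upwards [h1 fun ω n hn hz x hx => (Sticks.mem_projSet_iff hn hx).2 hz] with ω ⟨a, ha⟩
      exact ⟨a, fun _ => ha⟩
    · exact ae_of_all _ fun ω => ⟨0, fun h => absurd h hK⟩
  filter_upwards [h] with ω hω
  choose L hL using hω
  exact ⟨L, fun K m i j hK _ => hL K m i j hK⟩

theorem ae_exists_heightSet_massMeasure_lt (hS : IsICRT P θ X S) (hθ : IsParameter θ) :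
    ∀ᵐ ω ∂P, ∀ q : ℕ, ∀ δ : ℝ, 0 < δ → ∃ K, 0 < K ∧ ∃ a < δ,
      Tendsto (fun n => ((massMeasure θ fun i => X i ω)[|Icc 0 ((S ω).y n)]).real
        ((S ω).heightSet K (1 / (q + 1)))) atTop (𝓝 a) :=
  hS.ae_exists_heightSet_lt (hS.ae_tsum_stickHeight_ne_top hθ)

/-- The mass measure equidistributes, with the limits of its martingales. -/
theorem ae_exists_equidistributes (hS : IsICRT P θ X S) (hθ : IsParameter θ) :
    ∀ᵐ ω ∂P, ∃ L : ℕ → ℕ → ℕ → ℕ → ℝ, (∀ K m i j, 0 < K → 0 < m →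
      Tendsto (fun n => ((massMeasure θ fun i => X i ω)[|Icc 0 ((S ω).y n)]).real
        ((S ω).projSet K m i j)) atTop (𝓝 (L K m i j))) ∧
      Equidistributes (S ω) (massMeasure θ fun i => X i ω) L := by
  filter_upwards [hS.ae_exists_tendsto_projSet, hS.ae_exists_heightSet_massMeasure_lt hθ,
    hS.ae_isLocFin, hS.ae_isProbabilityMeasure_cond] with ω ⟨L, hL⟩ hheight hfin hprob
  refine ⟨L, hL, .of_cuts hfin.ne_top ?_ hL fun ε hε δ hδ => ?_⟩
  · filter_upwards [eventually_gt_atTop 0] with n hn h0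
    have := (hprob n hn).measure_univ
    rw [cond_apply measurableSet_Icc, inter_univ, h0, mul_zero] at this
    exact zero_ne_one this
  -- Heights are controlled at the countably many thresholds `1 / (q + 1)`; one below `ε` is enough.
  · obtain ⟨q, hq⟩ := exists_nat_one_div_lt hε
    obtain ⟨K, hK, a, ha, hlim⟩ := hheight q δ hδ
    refine ⟨K, hK, ?_⟩
    filter_upwards [hlim.eventually_lt_const ha, eventually_gt_atTop 0] with n hn hn0
    have := hprob n hn0
    exact (measureReal_mono (Sticks.heightSet_subset K hq.le)).trans_lt hn

theorem ae_exists_convergesWeakly (hS : IsICRT P θ X S) (hθ : IsParameter θ) :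
    ∀ᵐ ω ∂P, ∃ p, ConvergesWeakly
      ((S ω).normalized (massMeasure θ fun i => X i ω)) p := by
  filter_upwards [hS.ae_exists_equidistributes hθ] with ω ⟨L, _, hL⟩
  exact hL.exists_convergesWeakly

/-- Only countably many sets occur, so all laws of large numbers hold simultaneously almost surely.
The projections under `ν` then have the same limits `L` as under `μ`. -/
theorem ae_convergesWeakly_of_growthConditions (hS : IsICRT P θ X S) (hθ : IsParameter θ)
    {ν : Ω → Measure ℝ≥0} (hν : Measurable[sigmaMassCuts θ X S] ν)
    (hνg : ∀ᵐ ω ∂P, GrowthConditions (S ω) (ν ω)) :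
    ∀ᵐ ω ∂P, ∀ p, ConvergesWeakly ((S ω).normalized (massMeasure θ fun i => X i ω)) p →
      ConvergesWeakly ((S ω).normalized (ν ω)) p := by
  have hproj : ∀ᵐ ω ∂P, ∀ K m i j, 0 < K →
      (S ω).GluingLLN (massMeasure θ fun i => X i ω) (ν ω) K ((S ω).projSet K m i j) := by
    refine ae_all_iff.2 fun K => ae_all_iff.2 fun m => ae_all_iff.2 fun i => ae_all_iff.2 fun j => ?_
    by_cases hK : 0 < K
    · filter_upwards [hS.ae_gluingLLN hν hνg hK (measurableSet_projectedSet m i j)] with ω hω _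
      exact hω
    · exact ae_of_all _ fun ω h => absurd h hK
  have hheight : ∀ᵐ ω ∂P, ∀ K q : ℕ, 0 < K →
      (S ω).GluingLLN (massMeasure θ fun i => X i ω) (ν ω) K
        ((S ω).heightSet K (1 / (q + 1))) := by
    refine ae_all_iff.2 fun K => ae_all_iff.2 fun q => ?_
    by_cases hK : 0 < K
    · filter_upwards [hS.ae_gluingLLN hν hνg hK (measurableSet_highSet (1 / (q + 1)))] with ω hω _
      exact hω
    · exact ae_of_all _ fun ω h => absurd h hK
  filter_upwards [hS.ae_exists_equidistributes hθ, hS.ae_exists_heightSet_massMeasure_lt hθ,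
    hproj, hheight, hνg] with ω ⟨L, hL, hμ⟩ hh hproj hheight hg p hp
  exact hμ.convergesWeakly_of_convergesWeakly
    (.of_gluingLLN hg hL hh (fun K m i j hK _ => hproj K m i j hK) hheight) hp

end IsICRT

end

end ICRT

end

theorem proposition2 {Ω : Type*} [MeasurableSpace Ω] (P : Measure Ω) [IsProbabilityMeasure P]
    (θ : ℕ → ℝ≥0) (hθ : ICRT.IsParameter θ) (X : ℕ → Ω → ℝ≥0) (S : Ω → ICRT.Sticks)
    (hS : ICRT.IsICRT P θ X S) :
    ∃ p : ∀ ω, ProbabilityMeasure (S ω).Tree,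
      (∀ᵐ ω ∂P, ICRT.ConvergesWeakly
        ((S ω).normalized (ICRT.massMeasure θ fun i => X i ω)) (p ω)) ∧
      (∀ᵐ ω ∂P, ICRT.ConvergesWeakly ((S ω).normalized ICRT.lebesgue) (p ω)) ∧
      (∀ᵐ ω ∂P, ICRT.ConvergesWeakly ((S ω).normalized (S ω).cutMeasure) (p ω)) ∧
      ∀ ν : Ω → Measure ℝ≥0,
        Measurable[ICRT.sigmaMassCuts θ X S] ν →
        (∀ᵐ ω ∂P, ICRT.GrowthConditions (S ω) (ν ω)) →
        ∀ᵐ ω ∂P, ICRT.ConvergesWeakly ((S ω).normalized (ν ω)) (p ω) := by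
  have hex : ∀ ω, ∃ p : ProbabilityMeasure (S ω).Tree,
      (∃ p', ICRT.ConvergesWeakly ((S ω).normalized (ICRT.massMeasure θ fun i => X i ω)) p') →
      ICRT.ConvergesWeakly ((S ω).normalized (ICRT.massMeasure θ fun i => X i ω)) p := by
    intro ω
    by_cases h : ∃ p', ICRT.ConvergesWeakly
        ((S ω).normalized (ICRT.massMeasure θ fun i => X i ω)) p'
    · exact h.imp fun p hp _ => hp
    -- On the null event without a limit, `p` is an arbitrary default, the mass at the root.
    · exact ⟨⟨Measure.dirac ((S ω).toTree 0), inferInstance⟩, fun h' => absurd h' h⟩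
  choose p hp using hex
  have hμ : ∀ᵐ ω ∂P, ICRT.ConvergesWeakly
      ((S ω).normalized (ICRT.massMeasure θ fun i => X i ω)) (p ω) := by
    filter_upwards [hS.ae_exists_convergesWeakly hθ] with ω hω using hp ω hω
  have hν : ∀ ν : Ω → Measure ℝ≥0, Measurable[ICRT.sigmaMassCuts θ X S] ν →
      (∀ᵐ ω ∂P, ICRT.GrowthConditions (S ω) (ν ω)) →
      ∀ᵐ ω ∂P, ICRT.ConvergesWeakly ((S ω).normalized (ν ω)) (p ω) := by
    intro ν hν hνg
    filter_upwards [hS.ae_convergesWeakly_of_growthConditions hθ hν hνg, hμ] with ω h1 h2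
    exact h1 _ h2
  refine ⟨p, hμ, hν (fun _ => ICRT.lebesgue) measurable_const ?_,
    hν (fun ω => (S ω).cutMeasure) ICRT.IsICRT.measurable_cutMeasure ?_, hν⟩
  · filter_upwards [hS.ae_forall_sparseEmptyCells hθ] with ω hω
    exact ICRT.Sticks.growthConditions_lebesgue hω
  · filter_upwards [hS.ae_forall_sparseEmptyCells hθ] with ω hω
    exact ICRT.Sticks.growthConditions_cutMeasure hω
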